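/- Let $n\ge 1$ and let $\Gamma^1,\Gamma^2,\Gamma^3\subset\mathbb R^{n+1}$ be compact embedded hypersurfaces of class $C^2$ with common boundary $\Sigma=\partial\Gamma^1=\partial\Gamma^2=\partial\Gamma^3$ (the triple junction) such that $\Gamma^i\cap\Gamma^j=\Sigma$ for $i\ne j$, and let $\gamma^1,\gamma^2,\gamma^3>0$. Integrals over $\Gamma^i$ and $\Sigma$ are taken with respect to the $n$- resp. $(n-1)$-dimensional Hausdorff measure. Put $\mathcal L=\prod_{i=1}^3L^2(\Gamma^i)$, $\mathcal H^1=\prod_{i=1}^3H^1(\Gamma^i)$ with $\|\boldsymbol u\|_{\mathcal H^1}^2=\sum_i\int_{\Gamma^i}|\nabla u^i|^2+|u^i|^2$ (surface gradients), and $$\mathcal E=\{\boldsymbol u\in\mathcal H^1:\ \gamma^1u^1+\gamma^2u^2+\gamma^3u^3=0\ \text{ a.e. on }\Sigma\}\quad\text{(in the sense of traces)},$$ with the norm of $\mathcal H^1$. Let $\mathcal E^{-1}$ be the dual space of $\mathcal E$; an element $\boldsymbol z\in\mathcal L$ is identified with the functional $\boldsymbol\zeta\mapsto(\boldsymbol\gamma\boldsymbol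 z,\boldsymbol\zeta)_{\mathcal L}:=\sum_i\gamma^i\int_{\Gamma^i}z^i\zeta^i$, and $\partial_t\boldsymbol u$ denotes the weak time derivative with respect to this identification. For constants $C_u,C_v$, a time $0<T<\infty$ and data $\mathfrak f\in L^2(0,T;\mathcal L)$, $\mathfrak b^5,\mathfrak b^6\in L^2(0,T;L^2(\Sigma))$, a weak solution is a pair $(\boldsymbol u,\boldsymbol v)\in L^2(0,T;\mathcal E)^2$ with $\partial_t\boldsymbol u\in L^2(0,T;\mathcal E^{-1})$ and $\boldsymbol u|_{t=0}=0$ (for the representative of $\boldsymbol u$ in $C([0,T];\mathcal L)$) such that for all $\boldsymbol\zeta,\boldsymbol\psi\in\mathcal E$ and almost all $t\in(0,T)$ $$\langle\partial_t\boldsymbol u,\boldsymbol\zeta\rangle=-\sum_{i=1}^3\gamma^i\int_{\Gamma^i}\big(\nabla v^i\cdot\nabla\zeta^i+C_uv^i\zeta^i\big)+\int_\Sigma\big(\gamma^1\mathfrak b^5\zeta^1-\gamma^3\mathfrak b^6\zeta^3\big)+\sum_{i=1}^3\gamma^i\int_{\Gamma^i}\mathfrak f^i\zeta^i,$$ $$\sum_{i=1}^3\gamma^i\int_{\Gamma^i}v^i\psi^i=\sum_{i=1}^3\gamma^i\int_{\Gamma^i}\big(\nabla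 u^i\cdot\nabla\psi^i+C_vu^i\psi^i\big).$$ Then there is a constant $C_0>0$, depending only on the $\Gamma^i$ and $\gamma^i$, such that for all $C_u,C_v\ge C_0$ and all $T>0$ there is a constant $C>0$ with the following property. For all $\mathfrak f\in L^2(0,T;\mathcal L)$ and $\mathfrak b^5,\mathfrak b^6\in L^2(0,T;L^2(\Sigma))$ there exists a unique weak solution $(\boldsymbol u,\boldsymbol v)$. Moreover, $\boldsymbol u$ has a representative in $C([0,T];\mathcal E)$, and $$\max_{0\le t\le T}\|\boldsymbol u(t)\|_{\mathcal E}+\|\boldsymbol u\|_{L^2(0,T;\mathcal E)}+\|\partial_t\boldsymbol u\|_{L^2(0,T;\mathcal E^{-1})}+\|\boldsymbol v\|_{L^2(0,T;\mathcal E)}\le C\Big(\|\mathfrak f\|_{L^2(0,T;\mathcal L)}+\sum_{i=5}^6\|\mathfrak b^i\|_{L^2(0,T;L^2(\Sigma))}\Big).$$ -/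

import Mathlib

open MeasureTheory Set Topology
open scoped ENNReal ContDiff RealInnerProductSpace

/-! ### Hypersurfaces with boundary and triple junction clusters -/

/-- The ambient space `ℝ^{n+1}` of `n`-dimensional hypersurfaces. -/
abbrev Amb (n : ℕ) := EuclideanSpace ℝ (Fin (n + 1))

/-- The parameter space `ℝ^n`. -/
abbrev Par (n : ℕ) := EuclideanSpace ℝ (Fin n)

/-- `Φ` is a `C²` diffeomorphism between open subsets of `ℝ^{n+1}` which maps `Γ` to the hyperplane
`{y_last = 0}` (away from the boundary `S`), or to the half-hyperplane `{y_last = 0, y_0 ≥ 0}` with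
`S` being mapped to its edge `{y_last = 0, y_0 = 0}`. -/
structure IsStraightening {n : ℕ} (Γ S : Set (Amb n))
    (Φ : OpenPartialHomeomorph (Amb n) (Amb n)) : Prop where
  contDiffOn : ContDiffOn ℝ 2 Φ Φ.source
  contDiffOn_symm : ContDiffOn ℝ 2 Φ.symm Φ.target
  flat :
    (∀ x ∈ Φ.source, x ∉ S ∧ (x ∈ Γ ↔ Φ x (Fin.last n) = 0)) ∨
    (∀ x ∈ Φ.source, (x ∈ Γ ↔ Φ x (Fin.last n) = 0 ∧ 0 ≤ Φ x 0) ∧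
      (x ∈ S ↔ Φ x (Fin.last n) = 0 ∧ Φ x 0 = 0))

/-- `Γ` is an embedded hypersurface of class `C²` in `ℝ^{n+1}` with boundary `S` (for `n ≥ 1`). -/
structure IsHypersurfaceWithBoundary {n : ℕ} (Γ S : Set (Amb n)) : Prop where
  boundary_subset : S ⊆ Γ
  exists_straightening : ∀ p ∈ Γ, ∃ Φ : OpenPartialHomeomorph (Amb n) (Amb n),
    p ∈ Φ.source ∧ IsStraightening Γ S Φ

/-- A triple junction cluster: three compact embedded hypersurfaces `Γ 0, Γ 1, Γ 2` in `ℝ^{n+1}` with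
the common boundary `S`, the triple junction, which do not meet anywhere else. -/
structure TripleJunctionCluster (n : ℕ) where
  Γ : Fin 3 → Set (Amb n)
  S : Set (Amb n)
  isCompact : ∀ i, IsCompact (Γ i)
  isHypersurface : ∀ i, IsHypersurfaceWithBoundary (Γ i) S
  inter_eq : ∀ i j, i ≠ j → Γ i ∩ Γ j = S

/-! ### Lebesgue and Sobolev spaces on a hypersurface -/

/-- The surface measure: the `d`-dimensional Hausdorff measure (normalised so as to agree with the
Lebesgue measure on `ℝ^d`) on the set `M`. -/
noncomputable abbrev surfaceMeasure {n : ℕ} (d : ℕ) (M : Set (Amb n)) : Measure (Amb n) :=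
  (Measure.euclideanHausdorffMeasure d).restrict M

/-- `L²(M; F)` for a `d`-dimensional surface `M`. -/
noncomputable abbrev SurfL2 {n : ℕ} (d : ℕ) (M : Set (Amb n)) (F : Type) [NormedAddCommGroup F] :=
  Lp F 2 (surfaceMeasure d M)

/-- `ψ : U → Γ ∖ S` is a local parametrization of class `C²` (the inverse of a chart). -/
structure IsLocalParam {n : ℕ} (Γ S : Set (Amb n)) (U : Set (Par n)) (ψ : Par n → Amb n) :
    Prop where
  isOpen : IsOpen U
  contDiffOn : ContDiffOn ℝ 2 ψ U
  injOn : InjOn ψ U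
  mapsTo : MapsTo ψ U (Γ \ S)
  immersion : ∀ y ∈ U, Function.Injective (fderiv ℝ ψ y)

/-- On the open set `U`, the function `d` is the weak derivative of `h` in the direction `e`. -/
structure HasWeakPartial {n : ℕ} (U : Set (Par n)) (e : Par n) (h d : Par n → ℝ) : Prop where
  locallyIntegrable : LocallyIntegrableOn h U
  locallyIntegrable_deriv : LocallyIntegrableOn d U
  integral_eq : ∀ η : Par n → ℝ, ContDiff ℝ ∞ η → HasCompactSupport η → tsupport η ⊆ U →
    ∫ y, h y * fderiv ℝ η y e = -∫ y, d y * η y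

/-- `G` is the weak surface gradient of `f`: it is tangential, and in each local parametrization `ψ`
the function `f ∘ ψ` has the weak derivatives `∂_e (f ∘ ψ) = ⟨G ∘ ψ, ∂_e ψ⟩`. (These two properties
amount to the coordinate formula `G = g^{jk} ∂_j f ∂_k ψ`.) -/
structure HasSurfaceGradient {n : ℕ} (Γ S : Set (Amb n)) (f : Amb n → ℝ) (G : Amb n → Amb n) :
    Prop where
  tangential : ∀ U ψ, IsLocalParam Γ S U ψ →
    ∀ᵐ y ∂(volume.restrict U), G (ψ y) ∈ range (fderiv ℝ ψ y)
  weakPartial : ∀ U ψ, IsLocalParam Γ S U ψ → ∀ e : Par n,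
    HasWeakPartial U e (fun y => f (ψ y)) (fun y => ⟪G (ψ y), fderiv ℝ ψ y e⟫)

lemma exists_nhds_antilipschitz {n : ℕ} {ψ : Par n → Amb n} {y : Par n}
    (h : HasStrictFDerivAt ψ (fderiv ℝ ψ y) y) (hi : Function.Injective (fderiv ℝ ψ y)) :
    ∃ V ∈ 𝓝 y, ∃ K : NNReal, ∀ a ∈ V, ∀ b ∈ V, dist a b ≤ K * dist (ψ a) (ψ b) := by
  obtain ⟨K, hK, hA⟩ := (fderiv ℝ ψ y).toLinearMap.exists_antilipschitzWith
    (LinearMap.ker_eq_bot.2 hi)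
  have hKr : (0 : ℝ) < K := hK
  obtain ⟨V, hV, hVV⟩ := h.approximates_deriv_on_nhds (c := (2 * K)⁻¹)
    (Or.inr (by positivity))
  refine ⟨V, hV, 2 * K, fun a ha b hb => ?_⟩
  have h1 := hVV a ha b hb
  have h2 : dist a b ≤ K * dist (fderiv ℝ ψ y a) (fderiv ℝ ψ y b) := hA.le_mul_dist a b
  generalize fderiv ℝ ψ y = L at h1 h2
  have h3 : dist (L a) (L b) ≤ dist (ψ a) (ψ b) + (2 * (K : ℝ))⁻¹ * dist a b := by
    rw [dist_eq_norm, dist_eq_norm, dist_eq_norm, ← map_sub]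
    have := norm_sub_norm_le (L (a - b)) (ψ a - ψ b)
    push_cast at h1
    rw [norm_sub_rev] at h1
    linarith
  have h4 : K * dist (L a) (L b) ≤ K * dist (ψ a) (ψ b) + dist a b / 2 := by
    have h5 : (K : ℝ) * ((2 * (K : ℝ))⁻¹ * dist a b) = dist a b / 2 := by
      field_simp
    rw [← h5, ← mul_add]
    exact mul_le_mul_of_nonneg_left h3 hKr.le
  push_cast
  linarith

/-- Null sets of the surface measure are null sets in coordinates. -/
lemma IsLocalParam.ae_comp {n : ℕ} {Γ S : Set (Amb n)} {U : Set (Par n)} {ψ : Par n → Amb n}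
    (hψ : IsLocalParam Γ S U ψ) {p : Amb n → Prop} (hp : ∀ᵐ x ∂(surfaceMeasure n Γ), p x) :
    ∀ᵐ y ∂(volume.restrict U), p (ψ y) := by
  rw [ae_restrict_iff' hψ.isOpen.measurableSet, ae_iff]
  have hN : (Measure.euclideanHausdorffMeasure n : Measure (Amb n)) ({x | ¬ p x} ∩ Γ) = 0 := by
    have h0 := ae_iff.1 hp
    exact le_antisymm ((Measure.le_restrict_apply _ _).trans h0.le) zero_le
  have hn : (Measure.hausdorffMeasure (n : ℝ) : Measure (Amb n)) ({x | ¬ p x} ∩ Γ) = 0 := by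
    rw [Measure.euclideanHausdorffMeasure_def] at hN
    simpa [Measure.smul_apply, Measure.addHaarScalarFactor_volume_hausdorffMeasure_ne_zero] using hN
  refine measure_null_of_locally_null _ fun y hy => ?_
  have hyU : y ∈ U := by
    by_contra hh
    exact hy fun h' => absurd h' hh
  have hs : HasStrictFDerivAt ψ (fderiv ℝ ψ y) y :=
    ((hψ.contDiffOn.contDiffAt (hψ.isOpen.mem_nhds hyU)).hasStrictFDerivAt (by norm_num))
  obtain ⟨V, hV, K, hK⟩ := exists_nhds_antilipschitz hs (hψ.immersion y hyU)
  refine ⟨{z | ¬ (z ∈ U → p (ψ z))} ∩ V, Filter.inter_mem self_mem_nhdsWithin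
    (mem_nhdsWithin_of_mem_nhds hV), ?_⟩
  set A := {z | ¬ (z ∈ U → p (ψ z))} ∩ V with hA
  have hAU : ∀ z ∈ A, z ∈ U ∧ ¬ p (ψ z) := fun z hz => by simpa using hz.1
  have hinj : InjOn ψ A := fun a ha b hb hab => hψ.injOn (hAU a ha).1 (hAU b hb).1 hab
  have hlip : LipschitzOnWith K (Function.invFunOn ψ A) (ψ '' A) := by
    refine LipschitzOnWith.of_dist_le_mul ?_
    rintro _ ⟨a, ha, rfl⟩ _ ⟨b, hb, rfl⟩
    rw [hinj.leftInvOn_invFunOn ha, hinj.leftInvOn_invFunOn hb]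
    exact hK a ha.2 b hb.2
  have himg : ψ '' A ⊆ {x | ¬ p x} ∩ Γ := by
    rintro _ ⟨a, ha, rfl⟩
    exact ⟨(hAU a ha).2, (hψ.mapsTo (hAU a ha).1).1⟩
  have h0 := hlip.hausdorffMeasure_image_le (d := n) (by positivity)
  rw [measure_mono_null himg hn, mul_zero, hinj.invFunOn_image le_rfl] at h0
  have h1 : (Measure.euclideanHausdorffMeasure n : Measure (Par n)) A = 0 := by
    rw [Measure.euclideanHausdorffMeasure_def, Measure.smul_apply, le_antisymm h0 zero_le,
      smul_zero]
  have h2 : (Measure.euclideanHausdorffMeasure n : Measure (Par n)) = volume := by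
    rw [Measure.euclideanHausdorffMeasure_def]
    exact (Measure.isAddLeftInvariant_eq_smul _ _).symm
  rwa [h2] at h1

lemma HasWeakPartial.congr {n : ℕ} {U : Set (Par n)} (hU : IsOpen U) {e : Par n}
    {h d h' d' : Par n → ℝ} (H : HasWeakPartial U e h d)
    (hh : ∀ᵐ y ∂(volume.restrict U), h y = h' y) (hd : ∀ᵐ y ∂(volume.restrict U), d y = d' y) :
    HasWeakPartial U e h' d' := by
  have key : ∀ {g g' : Par n → ℝ}, (∀ᵐ y ∂(volume.restrict U), g y = g' y) →
      LocallyIntegrableOn g U → LocallyIntegrableOn g' U := by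
    intro g g' hg hi x hx
    obtain ⟨t, ht, hti⟩ := hi x hx
    refine ⟨t ∩ U, Filter.inter_mem ht self_mem_nhdsWithin, ?_⟩
    exact (hti.mono_set inter_subset_left).congr
      (ae_restrict_of_ae_restrict_of_subset inter_subset_right hg)
  refine ⟨key hh H.1, key hd H.2, fun η h1 h2 h3 => ?_⟩
  have int : ∀ {g g' k : Par n → ℝ}, (∀ᵐ y ∂(volume.restrict U), g y = g' y) →
      (∀ y ∉ U, k y = 0) → ∫ y, g' y * k y = ∫ y, g y * k y := by
    intro g g' k hg hk
    refine integral_congr_ae ?_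
    filter_upwards [(ae_restrict_iff' hU.measurableSet).1 hg] with y hy
    by_cases hyU : y ∈ U
    · rw [hy hyU]
    · simp [hk y hyU]
  rw [int hh, int hd, H.3 η h1 h2 h3]
  · intro y hy
    exact image_eq_zero_of_notMem_tsupport fun hh => hy (h3 hh)
  · intro y hy
    have : fderiv ℝ η y = 0 :=
      image_eq_zero_of_notMem_tsupport fun hh => hy (h3 (tsupport_fderiv_subset ℝ hh))
    simp [this]

lemma HasWeakPartial.add_smul {n : ℕ} {U : Set (Par n)} {e : Par n}
    {h d h' d' : Par n → ℝ} (H : HasWeakPartial U e h d) (H' : HasWeakPartial U e h' d') (c : ℝ) :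
    HasWeakPartial U e (fun y => h y + c * h' y) (fun y => d y + c * d' y) := by
  have sm : ∀ {g : Par n → ℝ}, LocallyIntegrableOn g U →
      LocallyIntegrableOn (fun y => c * g y) U := by
    intro g hg x hx
    obtain ⟨t, ht, hti⟩ := hg x hx
    exact ⟨t, ht, hti.const_mul c⟩
  refine ⟨H.1.add (sm H'.1), H.2.add (sm H'.2), fun η h1 h2 h3 => ?_⟩
  have int : ∀ {g k : Par n → ℝ}, LocallyIntegrableOn g U → Continuous k → HasCompactSupport k →
      tsupport k ⊆ U → Integrable (fun y => g y * k y) := by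
    intro g k hg hk hk1 hk2
    have h4 : IntegrableOn (fun y => g y * k y) (tsupport k) :=
      (hg.integrableOn_compact_subset hk2 hk1).mul_continuousOn hk.continuousOn hk1
    refine (integrableOn_iff_integrable_of_support_subset fun y hy => ?_).1 h4
    exact subset_tsupport _ fun hh => hy (by simp [hh])
  have hη' : Continuous fun y => fderiv ℝ η y e :=
    (h1.continuous_fderiv (by simp)).clm_apply continuous_const
  have hs : tsupport (fun y => fderiv ℝ η y e) ⊆ tsupport η := tsupport_fderiv_apply_subset ℝ e
  have hc : HasCompactSupport fun y => fderiv ℝ η y e :=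
    h2.of_isClosed_subset (isClosed_tsupport _) hs
  have e1 : ∀ y, (h y + c * h' y) * fderiv ℝ η y e =
      h y * fderiv ℝ η y e + c * (h' y * fderiv ℝ η y e) := fun y => by ring
  have e2 : ∀ y, (d y + c * d' y) * η y = d y * η y + c * (d' y * η y) := fun y => by ring
  simp only [e1, e2]
  rw [integral_add (int H.1 hη' hc (hs.trans h3)) ((int H'.1 hη' hc (hs.trans h3)).const_mul c),
    integral_add (int H.2 h1.continuous h2 h3) ((int H'.2 h1.continuous h2 h3).const_mul c),
    integral_const_mul, integral_const_mul, H.3 η h1 h2 h3, H'.3 η h1 h2 h3]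
  ring

lemma HasSurfaceGradient.congr {n : ℕ} {Γ S : Set (Amb n)} {f f' : Amb n → ℝ}
    {G G' : Amb n → Amb n} (H : HasSurfaceGradient Γ S f G)
    (hf : f =ᵐ[surfaceMeasure n Γ] f') (hG : G =ᵐ[surfaceMeasure n Γ] G') :
    HasSurfaceGradient Γ S f' G' := by
  refine ⟨fun U ψ hψ => ?_, fun U ψ hψ e => ?_⟩
  · filter_upwards [H.1 U ψ hψ, hψ.ae_comp hG] with y h1 h2
    rwa [← h2]
  · refine (H.2 U ψ hψ e).congr hψ.isOpen (hψ.ae_comp hf) ?_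
    filter_upwards [hψ.ae_comp hG] with y h2
    rw [h2]

lemma HasSurfaceGradient.add_smul {n : ℕ} {Γ S : Set (Amb n)} {f f' : Amb n → ℝ}
    {G G' : Amb n → Amb n} (H : HasSurfaceGradient Γ S f G) (H' : HasSurfaceGradient Γ S f' G')
    (c : ℝ) :
    HasSurfaceGradient Γ S (fun x => f x + c * f' x) (fun x => G x + c • G' x) := by
  refine ⟨fun U ψ hψ => ?_, fun U ψ hψ e => ?_⟩
  · filter_upwards [H.1 U ψ hψ, H'.1 U ψ hψ] with y h1 h2
    obtain ⟨a, ha⟩ := h1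
    obtain ⟨b, hb⟩ := h2
    exact ⟨a + c • b, by rw [map_add, map_smul, ha, hb]⟩
  · have := (H.2 U ψ hψ e).add_smul (H'.2 U ψ hψ e) c
    simpa only [inner_add_left, real_inner_smul_left] using this

lemma HasSurfaceGradient.zero {n : ℕ} (Γ S : Set (Amb n)) :
    HasSurfaceGradient Γ S (fun _ => 0) (fun _ => 0) := by
  refine ⟨fun U ψ hψ => Filter.Eventually.of_forall fun y => ⟨0, by simp⟩, fun U ψ hψ e => ?_⟩
  have h0 : LocallyIntegrableOn (fun _ : Par n => (0 : ℝ)) U :=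
    (locallyIntegrable_const 0).locallyIntegrableOn U
  exact ⟨h0, by simpa using h0, by simp⟩

/-- The Sobolev space `H¹(Γ)` of an `n`-dimensional hypersurface `Γ` with boundary `S`, as the space of
all pairs `(f, ∇_Γ f)` of square integrable functions, with the norm
`(∫_Γ |f|² + |∇_Γ f|²)^{1/2}`. -/
noncomputable def H1 {n : ℕ} (Γ S : Set (Amb n)) :
    Submodule ℝ (WithLp 2 (SurfL2 n Γ ℝ × SurfL2 n Γ (Amb n))) where
  carrier := {p | HasSurfaceGradient Γ S p.fst p.snd}
  zero_mem' := (HasSurfaceGradient.zero Γ S).congr (Lp.coeFn_zero _ _ _).symm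
    (Lp.coeFn_zero _ _ _).symm
  add_mem' := by
    intro p q hp hq
    refine (HasSurfaceGradient.add_smul hp hq 1).congr ?_ ?_
    · filter_upwards [Lp.coeFn_add p.fst q.fst] with x hx
      rw [WithLp.add_fst, hx, Pi.add_apply, one_mul]
    · filter_upwards [Lp.coeFn_add p.snd q.snd] with x hx
      rw [WithLp.add_snd, hx, Pi.add_apply, one_smul]
  smul_mem' := by
    intro c p hp
    refine (HasSurfaceGradient.add_smul (HasSurfaceGradient.zero Γ S) hp c).congr ?_ ?_
    · filter_upwards [Lp.coeFn_smul c p.fst] with x hx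
      rw [WithLp.smul_fst, hx, Pi.smul_apply, zero_add, smul_eq_mul]
    · filter_upwards [Lp.coeFn_smul c p.snd] with x hx
      rw [WithLp.smul_snd, hx, Pi.smul_apply, zero_add]

noncomputable instance {n : ℕ} (Γ S : Set (Amb n)) : NormedAddCommGroup (H1 Γ S) :=
  Submodule.normedAddCommGroup _

noncomputable instance {n : ℕ} (Γ S : Set (Amb n)) : InnerProductSpace ℝ (H1 Γ S) :=
  Submodule.innerProductSpace _

/-- The function underlying an element of `H¹(Γ)`. -/
noncomputable def H1.fn {n : ℕ} {Γ S : Set (Amb n)} (u : H1 Γ S) : SurfL2 n Γ ℝ := u.1.fst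

/-- The surface gradient `∇_Γ u` of an element of `H¹(Γ)`. -/
noncomputable def H1.grad {n : ℕ} {Γ S : Set (Amb n)} (u : H1 Γ S) : SurfL2 n Γ (Amb n) := u.1.snd

/-- The pairs `(u, τ)` in `H¹(Γ) × L²(S)` for which `u` is the restriction to `Γ`, and `τ` the
restriction to `S`, of the same `C¹` function. -/
noncomputable def restrictionGraph {n : ℕ} (Γ S : Set (Amb n)) :
    Submodule ℝ (H1 Γ S × SurfL2 (n - 1) S ℝ) where
  carrier := {p | ∃ g : Amb n → ℝ, ContDiff ℝ 1 g ∧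
    H1.fn p.1 =ᵐ[surfaceMeasure n Γ] g ∧ p.2 =ᵐ[surfaceMeasure (n - 1) S] g}
  zero_mem' := ⟨fun _ => 0, contDiff_const, Lp.coeFn_zero _ _ _, Lp.coeFn_zero _ _ _⟩
  add_mem' := by
    rintro p q ⟨g, hg, h1, h2⟩ ⟨k, hk, h3, h4⟩
    exact ⟨g + k, hg.add hk, (Lp.coeFn_add p.1.1.fst q.1.1.fst).trans (h1.add h3),
      (Lp.coeFn_add p.2 q.2).trans (h2.add h4)⟩
  smul_mem' := by
    rintro c p ⟨g, hg, h1, h2⟩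
    exact ⟨c • g, hg.const_smul c, (Lp.coeFn_smul c p.1.1.fst).trans (h1.const_smul c),
      (Lp.coeFn_smul c p.2).trans (h2.const_smul c)⟩

/-- `τ ∈ L²(S)` is the trace of `u ∈ H¹(Γ)` on the boundary `S`. The trace operator is the continuous
extension of the restriction `g|_Γ ↦ g|_S` of `C¹` functions, which means that its graph is the
closure of the graph of the restriction. -/
def IsTrace {n : ℕ} {Γ S : Set (Amb n)} (u : H1 Γ S) (τ : SurfL2 (n - 1) S ℝ) : Prop :=
  (u, τ) ∈ (restrictionGraph Γ S).topologicalClosure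

/-! ### Function spaces on a triple junction cluster -/

namespace TripleJunctionCluster

variable {n : ℕ} (c : TripleJunctionCluster n)

/-- `𝓛 = L²(Γ¹) × L²(Γ²) × L²(Γ³)`. -/
noncomputable abbrev L2 := PiLp 2 fun i => SurfL2 n (c.Γ i) ℝ

/-- `𝓗¹ = H¹(Γ¹) × H¹(Γ²) × H¹(Γ³)`. -/
noncomputable abbrev HH1 := PiLp 2 fun i => H1 (c.Γ i) c.S

noncomputable instance : NormedAddCommGroup c.HH1 := PiLp.normedAddCommGroup 2 _

noncomputable instance : InnerProductSpace ℝ c.HH1 := PiLp.innerProductSpace _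

/-- `L²(Σ)` for the triple junction `Σ`. -/
noncomputable abbrev L2S := SurfL2 (n - 1) c.S ℝ

/-- `𝓔 = {u ∈ 𝓗¹ | γ¹u¹ + γ²u² + γ³u³ = 0 a.e. on Σ}`. -/
noncomputable def E (γ : Fin 3 → ℝ) : Submodule ℝ c.HH1 where
  carrier := {u | ∃ τ : Fin 3 → c.L2S, (∀ i, IsTrace (u i) (τ i)) ∧ ∑ i, γ i • τ i = 0}
  zero_mem' := ⟨0, fun i => Submodule.zero_mem (restrictionGraph (c.Γ i) c.S).topologicalClosure,
    by simp⟩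
  add_mem' := by
    rintro u v ⟨τ, h1, h2⟩ ⟨σ, h3, h4⟩
    exact ⟨τ + σ, fun i => Submodule.add_mem _ (h1 i) (h3 i), by
      simp only [Pi.add_apply, smul_add, Finset.sum_add_distrib, h2, h4, add_zero]⟩
  smul_mem' := by
    rintro a u ⟨τ, h1, h2⟩
    exact ⟨a • τ, fun i => Submodule.smul_mem _ a (h1 i), by
      simp only [Pi.smul_apply, smul_comm _ a, ← Finset.smul_sum, h2, smul_zero]⟩

noncomputable instance (γ : Fin 3 → ℝ) : NormedAddCommGroup (c.E γ) :=
  Submodule.normedAddCommGroup _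

noncomputable instance (γ : Fin 3 → ℝ) : InnerProductSpace ℝ (c.E γ) :=
  Submodule.innerProductSpace _

variable {c} {γ : Fin 3 → ℝ}

/-- The inclusion `𝓔 ⊆ 𝓛`. -/
noncomputable def E.toL2 (u : c.E γ) : c.L2 := WithLp.toLp 2 fun i => H1.fn (u.1 i)

variable (γ) in
/-- The weighted product `(γ u, ζ)_𝓛 = ∑ γⁱ ∫_{Γⁱ} uⁱ ζⁱ`. -/
noncomputable def weightedInner (u ζ : c.L2) : ℝ := ∑ i, γ i * ∫ x, u i x * ζ i x ∂(surfaceMeasure n (c.Γ i))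

/-- The form `∑ γⁱ ∫_{Γⁱ} ∇uⁱ · ∇ζⁱ + C uⁱ ζⁱ`. -/
noncomputable def form (C : ℝ) (u ζ : c.E γ) : ℝ :=
  ∑ i, γ i * ∫ x, (⟪H1.grad (u.1 i) x, H1.grad (ζ.1 i) x⟫ + C * (H1.fn (u.1 i) x * H1.fn (ζ.1 i) x))
    ∂(surfaceMeasure n (c.Γ i))

/-! ### Weak solutions -/

/-- `L²(0,T; X)`. -/
noncomputable abbrev L2T (T : ℝ) (X : Type) [NormedAddCommGroup X] :=
  Lp X 2 (volume.restrict (Ioo (0 : ℝ) T))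

/-- `w ∈ L²(0,T; 𝓔⁻¹)` is the weak time derivative of `u ∈ L²(0,T; 𝓔)`, where `𝓔⁻¹` is the dual space of
`𝓔`, and an element `z` of `𝓛` acts on `𝓔` by `ζ ↦ (γ z, ζ)_𝓛`. -/
def HasWeakTimeDeriv {T : ℝ} (u : L2T T (c.E γ)) (w : L2T T (StrongDual ℝ (c.E γ))) : Prop :=
  ∀ φ : ℝ → ℝ, ContDiff ℝ ∞ φ → HasCompactSupport φ → tsupport φ ⊆ Ioo 0 T → ∀ ζ : c.E γ,
    ∫ t in Ioo 0 T, deriv φ t * weightedInner γ (E.toL2 (u t)) (E.toL2 ζ) =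
      -∫ t in Ioo 0 T, φ t * w t ζ

/-- `(u, v)` is a weak solution, and `w` is the time derivative `∂_t u`. -/
structure IsWeakSolution {T : ℝ} (Cu Cv : ℝ) (f : L2T T c.L2) (b₅ b₆ : L2T T c.L2S)
    (u v : L2T T (c.E γ)) (w : L2T T (StrongDual ℝ (c.E γ))) : Prop where
  timeDeriv : HasWeakTimeDeriv u w
  parabolic : ∀ ζ : c.E γ, ∀ τ : Fin 3 → c.L2S, (∀ i, IsTrace (ζ.1 i) (τ i)) →
    ∀ᵐ t ∂(volume.restrict (Ioo 0 T)),
      w t ζ = -form Cu (v t) ζ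
        + ∫ x, (γ 0 * (b₅ t x * τ 0 x) - γ 2 * (b₆ t x * τ 2 x)) ∂(surfaceMeasure (n - 1) c.S)
        + weightedInner γ (f t) (E.toL2 ζ)
  elliptic : ∀ ψ : c.E γ, ∀ᵐ t ∂(volume.restrict (Ioo 0 T)),
    weightedInner γ (E.toL2 (v t)) (E.toL2 ψ) = form Cv (u t) ψ
  /-- The initial condition `u|_{t=0} = 0` for the representative of `u` in `C([0,T]; 𝓛)`. -/
  initial : ∃ U : ℝ → c.L2, ContinuousOn U (Icc 0 T) ∧
    (∀ᵐ t ∂(volume.restrict (Ioo 0 T)), U t = E.toL2 (u t)) ∧ U 0 = 0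

end TripleJunctionCluster

/-! Let `V = 𝓔`, let `B` be the Riesz operator on `V` of the weighted `𝓛`-product, and let `A₁`,
`A₂` be those of the two Dirichlet-type forms. The system reads `(B u)' + A₁ v = l`, `B v = A₂ u`,
`u(0) = 0`, where `l` collects the data. For `Cu, Cv ≥ 1` both `Aᵢ` are coercive with constant `min
γ`, so `C₀ = 1` suffices. Hence `u = K v` with `K = A₂⁻¹ B`, and `v` solves the single degenerate
equation `P v + J A₁ v = J l`. Here `P = B A₂⁻¹ B` is symmetric, nonnegative and injective, and `J`
is integration in time from `0`.

Everything for this equation rests on the inequality `⟨P J f, f⟩ ≥ 0` in `L²(0,T;V)`, since the left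
side is half of `⟨P F, F⟩(T)` for the primitive `F` of `f`. With `χ = J† ψ` it gives `c ‖χ‖² ≤ ⟨χ,
(P + J A₁)† ψ⟩`, so Douglas' factorization lemma produces a solution with `‖v‖ ≤ c⁻¹ ‖l‖`
(`exists_degenerate_evolution`). Testing the homogeneous equation with `J v` gives uniqueness
(`degenerate_evolution_unique`).

Continuity of `u` in `𝓔` comes from `c ‖K x‖² ≤ ⟨P x, x⟩`. For data `J k` the solution is itself a
primitive, so the chain rule is available and bounds `⟨P v, v⟩` uniformly in time by `‖J k‖²`. Such
data are dense, and `K v` is then a uniform limit of continuous functions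
(`SolvesEvolution.exists_continuous`). The weak formulation is equivalent to the integrated system
by the du Bois-Reymond lemma, the initial condition fixing the constant of integration
(`IsHilbertWeakSolution.primitive_eq`).

Geometry enters in three places. The graph of the weak surface gradient is closed, so `H¹(Γ)` is
complete. A trace inequality in half-ball charts makes traces unique and bounded, so `𝓔` is closed
and the boundary data act on it continuously. Finally, the charts cover each hypersurface up to a
null set, so a function vanishing in `L²` has zero gradient, and `B` is injective. Existence of
traces on all of `H¹` is never required, because membership in `𝓔` already supplies them. -/

/-! ### Primitives of square integrable functions of time -/

/-- Integration by parts for primitives of integrable vector-valued functions. -/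
theorem integral_bilin_primitive {V W : Type*} [NormedAddCommGroup V] [NormedSpace ℝ V]
    [CompleteSpace V] [NormedAddCommGroup W] [NormedSpace ℝ W] [CompleteSpace W]
    (B : V →L[ℝ] W →L[ℝ] ℝ) {f : ℝ → V} {g : ℝ → W} {T : ℝ} (hT : 0 ≤ T)
    (hf : IntervalIntegrable f volume 0 T) (hg : IntervalIntegrable g volume 0 T) :
    (∫ t in (0 : ℝ)..T, B (∫ s in (0 : ℝ)..t, f s) (g t)) +
      ∫ t in (0 : ℝ)..T, B (f t) (∫ s in (0 : ℝ)..t, g s) =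
      B (∫ t in (0 : ℝ)..T, f t) (∫ t in (0 : ℝ)..T, g t) := by
  set μ := volume.restrict (Ioc (0 : ℝ) T) with hμ
  have hf' : Integrable f μ := (intervalIntegrable_iff_integrableOn_Ioc_of_le hT).1 hf
  have hg' : Integrable g μ := (intervalIntegrable_iff_integrableOn_Ioc_of_le hT).1 hg
  have hB : Continuous (Function.uncurry fun x y => B x y) := by
    have : Continuous fun p : V × W => B p.1 p.2 := by fun_prop
    exact this
  have hk : Integrable (fun z : ℝ × ℝ => B (f z.1) (g z.2)) (μ.prod μ) :=
    hf'.op_fst_snd hB ⟨‖B‖, fun x y => B.le_opNorm₂ x y⟩ hg'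
  -- The square is cut along its diagonal. On `s ≤ t` the inner integration is over `s` and produces
  -- the primitive of `f`; on the complement it produces the primitive of `g`.
  have hS : MeasurableSet {z : ℝ × ℝ | z.1 ≤ z.2} := measurableSet_le measurable_fst measurable_snd
  have hsum := integral_add_compl hS hk
  have h0 : ∫ z, B (f z.1) (g z.2) ∂(μ.prod μ) = B (∫ t, f t ∂μ) (∫ t, g t ∂μ) := by
    rw [integral_prod _ hk]
    have : ∀ s, ∫ t, B (f s) (g t) ∂μ = B (f s) (∫ t, g t ∂μ) := fun s =>
      (B (f s)).integral_comp_comm hg'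
    simp only [this]
    exact (B.flip (∫ t, g t ∂μ)).integral_comp_comm hf'
  have h1 : ∫ z in {z : ℝ × ℝ | z.1 ≤ z.2}, B (f z.1) (g z.2) ∂(μ.prod μ) =
      ∫ t in (0 : ℝ)..T, B (∫ s in (0 : ℝ)..t, f s) (g t) := by
    rw [← integral_indicator hS, integral_prod_symm _ (hk.indicator hS),
      intervalIntegral.integral_of_le hT]
    refine setIntegral_congr_fun measurableSet_Ioc fun t ht => ?_
    have e1 : (fun s => {z : ℝ × ℝ | z.1 ≤ z.2}.indicator (fun z => B (f z.1) (g z.2)) (s, t)) =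
        (Iic t).indicator fun s => B.flip (g t) (f s) := by
      ext s
      simp [indicator_apply]
    have e2 : Iic t ∩ Ioc 0 T = Ioc 0 t := by
      ext s; simp only [mem_inter_iff, mem_Iic, mem_Ioc]
      exact ⟨fun h => ⟨h.2.1, h.1⟩, fun h => ⟨h.2, h.1, h.2.trans ht.2⟩⟩
    change ∫ s, _ ∂μ = _
    rw [e1, integral_indicator measurableSet_Iic, hμ, Measure.restrict_restrict measurableSet_Iic,
      e2, intervalIntegral.integral_of_le ht.1.le]
    exact (B.flip (g t)).integral_comp_comm (IntegrableOn.mono_set hf' (Ioc_subset_Ioc_right ht.2))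
  have h2 : ∫ z in {z : ℝ × ℝ | z.1 ≤ z.2}ᶜ, B (f z.1) (g z.2) ∂(μ.prod μ) =
      ∫ t in (0 : ℝ)..T, B (f t) (∫ s in (0 : ℝ)..t, g s) := by
    rw [← integral_indicator hS.compl, integral_prod _ (hk.indicator hS.compl),
      intervalIntegral.integral_of_le hT]
    refine setIntegral_congr_fun measurableSet_Ioc fun t ht => ?_
    have e1 : (fun s => {z : ℝ × ℝ | z.1 ≤ z.2}ᶜ.indicator (fun z => B (f z.1) (g z.2)) (t, s)) =
        (Iio t).indicator fun s => B (f t) (g s) := by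
      ext s
      simp [indicator_apply]
    have e2 : Iio t ∩ Ioc 0 T = Ioo 0 t := by
      ext s; simp only [mem_inter_iff, mem_Iio, mem_Ioc, mem_Ioo]
      exact ⟨fun h => ⟨h.2.1, h.1⟩, fun h => ⟨h.2, h.1, h.2.le.trans ht.2⟩⟩
    change ∫ s, _ ∂μ = _
    rw [e1, integral_indicator measurableSet_Iio, hμ, Measure.restrict_restrict measurableSet_Iio,
      e2, ← integral_Ioc_eq_integral_Ioo, intervalIntegral.integral_of_le ht.1.le]
    exact (B (f t)).integral_comp_comm (IntegrableOn.mono_set hg' (Ioc_subset_Ioc_right ht.2))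
  rw [h1, h2, h0] at hsum
  rw [hsum, intervalIntegral.integral_of_le hT, intervalIntegral.integral_of_le hT]

/-- Douglas' factorization lemma: if `‖N† ψ‖ ≤ M ‖R† ψ‖`, then `R v = N l` is solvable. -/
theorem exists_solution_of_adjoint_le {X : Type*} [NormedAddCommGroup X] [InnerProductSpace ℝ X]
    [CompleteSpace X] (R N : X →L[ℝ] X) {M : ℝ} (hM : 0 ≤ M)
    (h : ∀ ψ, ‖N.adjoint ψ‖ ≤ M * ‖R.adjoint ψ‖) (l : X) :
    ∃ v, R v = N l ∧ ‖v‖ ≤ M * ‖l‖ := by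
  set e : X →ₗ[ℝ] LinearMap.range (R.adjoint : X →ₗ[ℝ] X) :=
    (R.adjoint : X →ₗ[ℝ] X).rangeRestrict with he
  set f : X →ₗ[ℝ] ℝ := ((innerSL ℝ l).comp N.adjoint : X →L[ℝ] ℝ).toLinearMap with hf
  have hd : DenseRange e := (LinearMap.surjective_rangeRestrict _).denseRange
  have hb : ∀ ψ, ‖f ψ‖ ≤ (M * ‖l‖) * ‖e ψ‖ := fun ψ => by
    have h1 : ‖f ψ‖ ≤ ‖l‖ * ‖N.adjoint ψ‖ := norm_inner_le_norm l _
    have h2 : ‖e ψ‖ = ‖R.adjoint ψ‖ := rfl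
    rw [h2]
    nlinarith [h ψ, norm_nonneg l]
  -- By `hb`, `R† ψ ↦ ⟨l, N† ψ⟩` is a well-defined functional on the range of `R†` with norm at most
  -- `M ‖l‖`. Its Hahn–Banach extension is represented by some `v`, and `⟨v, R† ψ⟩ = ⟨l, N† ψ⟩` for
  -- all `ψ` says `R v = N l`.
  obtain ⟨g, hg, hgn⟩ := exists_extension_norm_eq (LinearMap.range (R.adjoint : X →ₗ[ℝ] X))
    (f.extendOfNorm e)
  refine ⟨(InnerProductSpace.toDual ℝ X).symm g, ?_, ?_⟩
  · refine ext_inner_right ℝ fun ψ => ?_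
    rw [← ContinuousLinearMap.adjoint_inner_right, InnerProductSpace.toDual_symm_apply,
      ← ContinuousLinearMap.adjoint_inner_right]
    have h1 := hg (e ψ)
    rw [LinearMap.extendOfNorm_eq hd ⟨_, hb⟩] at h1
    exact h1
  · rw [LinearIsometryEquiv.norm_map, hgn]
    exact LinearMap.opNorm_extendOfNorm_le hd (by positivity) hb

namespace TripleJunctionCluster

section Primitive

variable {T : ℝ} {V W : Type} [NormedAddCommGroup V] [NormedAddCommGroup W]

theorem L2T.integrable (f : L2T T V) : Integrable f (volume.restrict (Ioo (0 : ℝ) T)) :=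
  (Lp.memLp f).integrable one_le_two

theorem L2T.intervalIntegrable (f : L2T T V) {t : ℝ} (ht : t ∈ Icc 0 T) :
    IntervalIntegrable f volume 0 t :=
  (intervalIntegrable_iff_integrableOn_Ioo_of_le ht.1).2
    (IntegrableOn.mono_set (L2T.integrable f) (Ioo_subset_Ioo_right ht.2))

theorem ae_of_ae_Ioo {p : ℝ → Prop} (h : ∀ᵐ t ∂(volume.restrict (Ioo (0 : ℝ) T)), p t) {t : ℝ}
    (ht : t ∈ Icc 0 T) : ∀ᵐ s ∂volume, s ∈ Ioc 0 t → p s := by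
  have h1 : ∀ᵐ s ∂(volume.restrict (Ioo (0 : ℝ) t)), p s :=
    ae_restrict_of_ae_restrict_of_subset (Ioo_subset_Ioo_right ht.2) h
  rw [restrict_Ioo_eq_restrict_Ioc] at h1
  exact (ae_restrict_iff' measurableSet_Ioc).1 h1

theorem L2T.integral_norm_le (f : L2T T V) :
    ∫ s in Ioo 0 T, ‖f s‖ ≤ ‖f‖ * (volume.restrict (Ioo (0 : ℝ) T) univ).toReal ^ (1 / 2 : ℝ) := by
  rw [integral_norm_eq_lintegral_enorm (L2T.integrable f).aestronglyMeasurable, Lp.norm_def]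
  have h1 := eLpNorm_le_eLpNorm_mul_rpow_measure_univ (p := 1) (q := 2) one_le_two
    (L2T.integrable f).aestronglyMeasurable
  rw [eLpNorm_one_eq_lintegral_enorm] at h1
  have h2 : (1 / (1 : ℝ≥0∞).toReal - 1 / (2 : ℝ≥0∞).toReal) = (1 / 2 : ℝ) := by norm_num
  rw [h2] at h1
  have h3 := ENNReal.toReal_mono (ENNReal.mul_ne_top (Lp.eLpNorm_ne_top f)
    (ENNReal.rpow_ne_top_of_nonneg (by norm_num) (measure_ne_top _ _))) h1
  rwa [ENNReal.toReal_mul, ← ENNReal.toReal_rpow] at h3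

variable [NormedSpace ℝ V] [NormedSpace ℝ W]

theorem primitive_congr {f g : ℝ → V}
    (h : f =ᵐ[volume.restrict (Ioo (0 : ℝ) T)] g) {t : ℝ} (ht : t ∈ Icc 0 T) :
    ∫ s in (0 : ℝ)..t, f s = ∫ s in (0 : ℝ)..t, g s := by
  refine intervalIntegral.integral_congr_ae ?_
  rw [uIoc_of_le ht.1]
  exact ae_of_ae_Ioo h ht

theorem continuousOn_primitive_of_integrable {f : ℝ → V}
    (hf : Integrable f (volume.restrict (Ioo (0 : ℝ) T))) :
    ContinuousOn (fun t => ∫ s in (0 : ℝ)..t, f s) (Icc 0 T) := by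
  rcases le_or_gt 0 T with hT | hT
  · have h1 : IntegrableOn f (uIcc 0 T) := by
      rw [uIcc_of_le hT, integrableOn_Icc_iff_integrableOn_Ioo]
      exact hf
    simpa only [uIcc_of_le hT] using intervalIntegral.continuousOn_primitive_interval h1
  · simp [Icc_eq_empty hT.not_ge]

theorem L2T.continuousOn_primitive (f : L2T T V) :
    ContinuousOn (fun t => ∫ s in (0 : ℝ)..t, f s) (Icc 0 T) :=
  continuousOn_primitive_of_integrable (L2T.integrable f)

theorem L2T.norm_primitive_le (f : L2T T V) {t : ℝ} (ht : t ∈ Icc 0 T) :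
    ‖∫ s in (0 : ℝ)..t, f s‖ ≤
      ‖f‖ * (volume.restrict (Ioo (0 : ℝ) T) univ).toReal ^ (1 / 2 : ℝ) := by
  refine le_trans ?_ (L2T.integral_norm_le f)
  rw [intervalIntegral.integral_of_le ht.1, integral_Ioc_eq_integral_Ioo]
  refine (norm_integral_le_integral_norm _).trans ?_
  exact setIntegral_mono_set (L2T.integrable f).norm (Filter.Eventually.of_forall fun _ => norm_nonneg _)
    (Ioo_subset_Ioo_right ht.2).eventuallyLE

theorem L2T.memLp_primitive (f : L2T T V) :
    MemLp (fun t => ∫ s in (0 : ℝ)..t, f s) 2 (volume.restrict (Ioo (0 : ℝ) T)) := by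
  refine MemLp.of_bound ?_
    (‖f‖ * (volume.restrict (Ioo (0 : ℝ) T) univ).toReal ^ (1 / 2 : ℝ)) ?_
  · exact ((L2T.continuousOn_primitive f).mono Ioo_subset_Icc_self).aestronglyMeasurable measurableSet_Ioo
  · filter_upwards [ae_restrict_mem measurableSet_Ioo] with t ht
    exact (L2T.norm_primitive_le f) (Ioo_subset_Icc_self ht)

/-- The operator `f ↦ ∫₀ᵗ f` on `L²(0,T; V)`. -/
noncomputable def primitiveL (T : ℝ) (V : Type) [NormedAddCommGroup V] [NormedSpace ℝ V] :
    L2T T V →L[ℝ] L2T T V :=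
  LinearMap.mkContinuous
    { toFun := fun f => (L2T.memLp_primitive f).toLp
      map_add' := fun f g => by
        refine Lp.ext ?_
        filter_upwards [MemLp.coeFn_toLp (L2T.memLp_primitive (f + g)), Lp.coeFn_add
          ((L2T.memLp_primitive f).toLp) ((L2T.memLp_primitive g).toLp), MemLp.coeFn_toLp (L2T.memLp_primitive f),
          MemLp.coeFn_toLp (L2T.memLp_primitive g), ae_restrict_mem measurableSet_Ioo]
          with t h1 h2 h3 h4 ht
        have ht' := Ioo_subset_Icc_self ht
        rw [h1, h2, Pi.add_apply, h3, h4, ← intervalIntegral.integral_add ((L2T.intervalIntegrable f) ht')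
          ((L2T.intervalIntegrable g) ht')]
        exact primitive_congr (Lp.coeFn_add f g) ht'
      map_smul' := fun c f => by
        refine Lp.ext ?_
        filter_upwards [MemLp.coeFn_toLp (L2T.memLp_primitive (c • f)), Lp.coeFn_smul c
          ((L2T.memLp_primitive f).toLp), MemLp.coeFn_toLp (L2T.memLp_primitive f),
          ae_restrict_mem measurableSet_Ioo] with t h1 h2 h3 ht
        have ht' := Ioo_subset_Icc_self ht
        rw [h1, RingHom.id_apply, h2, Pi.smul_apply, h3, ← intervalIntegral.integral_smul]
        exact primitive_congr (Lp.coeFn_smul c f) ht' }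
    ((measureUnivNNReal (volume.restrict (Ioo (0 : ℝ) T)) : ℝ) ^ (2 : ℝ≥0∞).toReal⁻¹ *
      (volume.restrict (Ioo (0 : ℝ) T) univ).toReal ^ (1 / 2 : ℝ))
    (fun f => by
      have : ‖(L2T.memLp_primitive f).toLp‖ ≤
          (measureUnivNNReal (volume.restrict (Ioo (0 : ℝ) T)) : ℝ) ^ (2 : ℝ≥0∞).toReal⁻¹ *
          (‖f‖ * (volume.restrict (Ioo (0 : ℝ) T) univ).toReal ^ (1 / 2 : ℝ)) := by
        refine Lp.norm_le_of_ae_bound (by positivity) ?_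
        filter_upwards [MemLp.coeFn_toLp (L2T.memLp_primitive f), ae_restrict_mem measurableSet_Ioo]
          with t h1 ht
        rw [h1]
        exact (L2T.norm_primitive_le f) (Ioo_subset_Icc_self ht)
      refine this.trans_eq ?_
      ring)

theorem primitiveL_ae (f : L2T T V) : ∀ᵐ t ∂(volume.restrict (Ioo (0 : ℝ) T)),
    primitiveL T V f t = ∫ s in (0 : ℝ)..t, f s :=
  MemLp.coeFn_toLp (L2T.memLp_primitive f)

/-- The pointwise action of a bounded operator commutes with taking primitives. -/
theorem primitiveL_compLpL [CompleteSpace V] [CompleteSpace W] (A : V →L[ℝ] W) (f : L2T T V) :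
    primitiveL T W (A.compLpL 2 _ f) = A.compLpL 2 _ (primitiveL T V f) := by
  refine Lp.ext ?_
  filter_upwards [primitiveL_ae (A.compLpL 2 _ f), A.coeFn_compLpL (primitiveL T V f),
    primitiveL_ae f, ae_restrict_mem measurableSet_Ioo] with t h1 h2 h3 ht
  have ht' := Ioo_subset_Icc_self ht
  rw [h1, h2, h3, primitive_congr (A.coeFn_compLpL f) ht']
  exact A.intervalIntegral_comp_comm ((L2T.intervalIntegrable f) ht')

/-- An element of `L²(0,T; V)` which vanishes when tested with all functionals is zero. -/
theorem L2T.eq_zero_of_forall_dual (f : L2T T V)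
    (h : ∀ l : StrongDual ℝ V, ∀ᵐ t ∂(volume.restrict (Ioo (0 : ℝ) T)), l (f t) = 0) : f = 0 := by
  refine Lp.ext ?_
  refine Filter.EventuallyEq.trans ?_ (Lp.coeFn_zero _ _ _).symm
  exact ae_eq_zero_of_forall_dual_of_isSeparable ℝ
    (Lp.stronglyMeasurable f).isSeparable_range h
    (Filter.Eventually.of_forall fun x => mem_range_self x)

end Primitive

/-! ### Existence and uniqueness for the degenerate evolution equation -/

section Hilbert

variable {T : ℝ} {V : Type} [NormedAddCommGroup V] [InnerProductSpace ℝ V]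

theorem L2T.eq_zero_of_forall_inner (f : L2T T V) [CompleteSpace V]
    (h : ∀ ζ : V, ∀ᵐ t ∂(volume.restrict (Ioo (0 : ℝ) T)), ⟪f t, ζ⟫ = 0) : f = 0 := by
  refine (L2T.eq_zero_of_forall_dual f) fun l => ?_
  filter_upwards [h ((InnerProductSpace.toDual ℝ V).symm l)] with t ht
  rwa [real_inner_comm, InnerProductSpace.toDual_symm_apply] at ht

/-- The chain rule `⟨P F, F⟩(t) = 2 ∫₀ᵗ ⟨P F, f⟩` for the primitive `F` of `f`. -/
theorem integral_inner_primitive [CompleteSpace V] (P : V →L[ℝ] V) (hP : ∀ x y, ⟪P x, y⟫ = ⟪x, P y⟫) (f : L2T T V)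
    {t : ℝ} (ht : t ∈ Icc 0 T) :
    2 * ∫ s in (0 : ℝ)..t, ⟪P (∫ r in (0 : ℝ)..s, f r), f s⟫ =
      ⟪P (∫ s in (0 : ℝ)..t, f s), ∫ s in (0 : ℝ)..t, f s⟫ := by
  have h := integral_bilin_primitive ((innerSL ℝ).comp P) ht.1 ((L2T.intervalIntegrable f) ht)
    ((L2T.intervalIntegrable f) ht)
  simp only [ContinuousLinearMap.comp_apply, innerSL_apply_apply] at h
  rw [← h, two_mul]
  congr 1
  refine intervalIntegral.integral_congr fun s _ => ?_
  simp only [hP (f s), real_inner_comm]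

/-- By `integral_inner_primitive` at `T`, the pairing is half the value of the form of `P` at `∫₀ᵀ
f`. This sign allows the term `(P v)'` to be discarded both in the existence and in the uniqueness
proof. -/
theorem inner_primitiveL_nonneg [CompleteSpace V] (hT : 0 ≤ T) (P : V →L[ℝ] V) (hP : ∀ x y, ⟪P x, y⟫ = ⟪x, P y⟫)
    (hP0 : ∀ x, 0 ≤ ⟪P x, x⟫) (f : L2T T V) : 0 ≤ ⟪P.compLpL 2 _ (primitiveL T V f), f⟫ := by
  have h := integral_inner_primitive P hP f (right_mem_Icc.2 hT)
  have h1 : ⟪P.compLpL 2 _ (primitiveL T V f), f⟫ =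
      ∫ s in (0 : ℝ)..T, ⟪P (∫ r in (0 : ℝ)..s, f r), f s⟫ := by
    rw [L2.inner_def, intervalIntegral.integral_of_le hT, integral_Ioc_eq_integral_Ioo]
    refine integral_congr_ae ?_
    filter_upwards [P.coeFn_compLpL (primitiveL T V f), primitiveL_ae f] with t h2 h3
    rw [h2, h3]
  rw [h1]
  linarith [hP0 (∫ s in (0 : ℝ)..T, f s)]

theorem inner_compLpL_symm (P : V →L[ℝ] V) (hP : ∀ x y, ⟪P x, y⟫ = ⟪x, P y⟫) (f g : L2T T V) :
    ⟪P.compLpL 2 _ f, g⟫ = ⟪f, P.compLpL 2 _ g⟫ := by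
  rw [L2.inner_def, L2.inner_def]
  refine integral_congr_ae ?_
  filter_upwards [P.coeFn_compLpL f, P.coeFn_compLpL g] with t h2 h3
  rw [h2, h3, hP]

theorem coercive_compLpL (A : V →L[ℝ] V) {c : ℝ} (hA : ∀ x, c * ‖x‖ ^ 2 ≤ ⟪A x, x⟫)
    (f : L2T T V) : c * ‖f‖ ^ 2 ≤ ⟪A.compLpL 2 _ f, f⟫ := by
  rw [← real_inner_self_eq_norm_sq, L2.inner_def, L2.inner_def, ← integral_const_mul]
  refine integral_mono_ae ((L2.integrable_inner f f).const_mul c) (L2.integrable_inner _ _) ?_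
  filter_upwards [A.coeFn_compLpL f] with t h
  rw [h, real_inner_self_eq_norm_sq]
  exact hA _

variable [CompleteSpace V]

/-- Existence for the degenerate evolution equation `(P v)' + A v = l`, `(P v)(0) = 0`. -/
theorem exists_degenerate_evolution (hT : 0 ≤ T) (A P : V →L[ℝ] V) {c : ℝ} (hc : 0 < c)
    (hA : ∀ x, c * ‖x‖ ^ 2 ≤ ⟪A x, x⟫) (hP : ∀ x y, ⟪P x, y⟫ = ⟪x, P y⟫)
    (hP0 : ∀ x, 0 ≤ ⟪P x, x⟫) (l : L2T T V) :
    ∃ v : L2T T V, P.compLpL 2 _ v + primitiveL T V (A.compLpL 2 _ v) = primitiveL T V l ∧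
      ‖v‖ ≤ c⁻¹ * ‖l‖ := by
  set A' : L2T T V →L[ℝ] L2T T V := A.compLpL 2 _ with hA'
  set P' : L2T T V →L[ℝ] L2T T V := P.compLpL 2 _ with hP'
  set J := primitiveL T V with hJ
  refine exists_solution_of_adjoint_le (P' + J.comp A') J (by positivity) (fun ψ => ?_) l
  set χ := J.adjoint ψ with hχ
  -- Pairing `(P + J A)† ψ` with `χ = J† ψ` gives `⟨A χ, χ⟩ + ⟨P J ψ, ψ⟩`, because `J` commutes with
  -- `P` and `P` is symmetric. The first term is coercive and the second nonnegative.
  have h1 : c * ‖χ‖ ^ 2 ≤ ‖χ‖ * ‖(P' + J.comp A').adjoint ψ‖ := by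
    calc c * ‖χ‖ ^ 2 ≤ ⟪A' χ, χ⟫ := coercive_compLpL A hA χ
      _ ≤ ⟪A' χ, χ⟫ + ⟪P' (J ψ), ψ⟫ :=
          le_add_of_nonneg_right (inner_primitiveL_nonneg hT P hP hP0 ψ)
      _ = ⟪χ, (P' + J.comp A').adjoint ψ⟫ := by
          have e : ⟪χ, (P' + J.comp A').adjoint ψ⟫ = ⟪P' χ + J (A' χ), ψ⟫ :=
            ContinuousLinearMap.adjoint_inner_right _ _ _
          have e1 : ⟪P' χ, ψ⟫ = ⟪P' (J ψ), ψ⟫ := by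
            rw [hP', inner_compLpL_symm P hP, hχ, ContinuousLinearMap.adjoint_inner_left, hJ,
              primitiveL_compLpL, real_inner_comm]
          have e2 : ⟪A' χ, χ⟫ = ⟪J (A' χ), ψ⟫ := ContinuousLinearMap.adjoint_inner_right _ _ _
          rw [e, inner_add_left, e1, e2, add_comm]
      _ ≤ _ := real_inner_le_norm _ _
  rw [inv_mul_eq_div, le_div_iff₀ hc]
  rcases (norm_nonneg χ).eq_or_lt with h0 | h0
  · rw [← h0]; simp
  · nlinarith

/-- Uniqueness for the degenerate evolution equation. -/
theorem degenerate_evolution_unique (hT : 0 ≤ T) (A P : V →L[ℝ] V) {c : ℝ} (hc : 0 < c)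
    (hA : ∀ x, c * ‖x‖ ^ 2 ≤ ⟪A x, x⟫) (hP : ∀ x y, ⟪P x, y⟫ = ⟪x, P y⟫)
    (hP0 : ∀ x, 0 ≤ ⟪P x, x⟫) (hPi : ∀ x, P x = 0 → x = 0) (v : L2T T V)
    (hv : P.compLpL 2 _ v + primitiveL T V (A.compLpL 2 _ v) = 0) : v = 0 := by
  -- The equation is tested with `J v` instead of `v`: `J A v = A J v` gives a coercive term, and
  -- `⟨P v, J v⟩ = ⟨P J v, v⟩` is nonnegative. Once `J v = 0`, the equation reduces to `P v = 0`.
  have h1 : c * ‖primitiveL T V v‖ ^ 2 ≤ 0 := by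
    calc c * ‖primitiveL T V v‖ ^ 2 ≤ ⟪A.compLpL 2 _ (primitiveL T V v), primitiveL T V v⟫ :=
          coercive_compLpL A hA _
      _ ≤ ⟪A.compLpL 2 _ (primitiveL T V v), primitiveL T V v⟫ +
            ⟪P.compLpL 2 _ (primitiveL T V v), v⟫ :=
          le_add_of_nonneg_right (inner_primitiveL_nonneg hT P hP hP0 v)
      _ = ⟪P.compLpL 2 _ v + primitiveL T V (A.compLpL 2 _ v), primitiveL T V v⟫ := by
          rw [inner_compLpL_symm P hP, inner_add_left, primitiveL_compLpL, add_comm,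
            real_inner_comm]
      _ = 0 := by rw [hv, inner_zero_left]
  have h2 : primitiveL T V v = 0 := by
    have : ‖primitiveL T V v‖ ^ 2 ≤ 0 := by
      by_contra hh
      push Not at hh
      nlinarith
    exact norm_eq_zero.1 (pow_eq_zero_iff two_ne_zero |>.1 (le_antisymm this (by positivity)))
  rw [primitiveL_compLpL, h2, map_zero, add_zero] at hv
  refine Lp.ext ?_
  filter_upwards [P.coeFn_compLpL v, Lp.coeFn_zero V 2 (volume.restrict (Ioo (0 : ℝ) T))]
    with t h3 h4
  rw [hv] at h3
  rw [h4] at h3 ⊢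
  exact hPi _ h3.symm

end Hilbert

end TripleJunctionCluster

/-! ### Test functions in time: the du Bois-Reymond lemma and density of primitives -/

namespace TripleJunctionCluster

section TestFunctions

variable {T : ℝ}

theorem eq_zero_of_tsupport_subset_Ioo {φ : ℝ → ℝ} (h : tsupport φ ⊆ Ioo 0 T) {t : ℝ}
    (ht : t ∉ Ioo 0 T) : φ t = 0 :=
  image_eq_zero_of_notMem_tsupport fun hh => ht (h hh)

theorem integral_deriv_testFunction {φ : ℝ → ℝ} (h1 : ContDiff ℝ ∞ φ) (h3 : tsupport φ ⊆ Ioo 0 T)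
    (t : ℝ) : ∫ s in (0 : ℝ)..t, deriv φ s = φ t := by
  rw [intervalIntegral.integral_deriv_eq_sub (fun x _ => (h1.differentiable (by simp)) x)
    ((h1.continuous_deriv (by simp)).intervalIntegrable _ _),
    eq_zero_of_tsupport_subset_Ioo h3 (t := 0) (by simp), sub_zero]

/-- The fundamental lemma of du Bois-Reymond on an interval. -/
theorem ae_eq_const_of_integral_deriv_mul_eq_zero (hT : 0 < T) {g : ℝ → ℝ}
    (hg : Integrable g (volume.restrict (Ioo (0 : ℝ) T)))
    (h : ∀ φ : ℝ → ℝ, ContDiff ℝ ∞ φ → HasCompactSupport φ → tsupport φ ⊆ Ioo 0 T →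
      ∫ t in Ioo 0 T, deriv φ t * g t = 0) :
    ∃ c, ∀ᵐ t ∂(volume.restrict (Ioo (0 : ℝ) T)), g t = c := by
  -- A bump of integral one supported in `[T/4, 3T/4]`. The constant sought is `∫ θ g`.
  let B : ContDiffBump (T / 2 : ℝ) := ⟨T / 8, T / 4, by linarith, by linarith⟩
  let θ : ℝ → ℝ := B.normed volume
  have hθ1 : ContDiff ℝ ∞ θ := B.contDiff_normed
  have hθs : tsupport θ ⊆ Ioo 0 T := by
    rw [B.tsupport_normed_eq, Real.closedBall_eq_Icc]
    exact fun x hx => ⟨by have : T / 2 - T / 4 ≤ x := hx.1; linarith,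
      by have : x ≤ T / 2 + T / 4 := hx.2; linarith⟩
  have hθ2 : HasCompactSupport θ := B.hasCompactSupport_normed
  have hθi : ∫ t, θ t = 1 := B.integral_normed
  have bdd : ∀ {k : ℝ → ℝ}, Continuous k → HasCompactSupport k →
      Integrable (fun t => k t * g t) (volume.restrict (Ioo (0 : ℝ) T)) := by
    intro k hk hk2
    obtain ⟨M, hM⟩ := hk2.exists_bound_of_continuous hk
    exact hg.bdd_mul hk.aestronglyMeasurable (Filter.Eventually.of_forall hM)
  set c := ∫ t in Ioo 0 T, θ t * g t with hc
  refine ⟨c, ?_⟩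
  have key : ∀ᵐ t ∂volume, t ∈ Ioo 0 T → (fun t => g t - c) t = 0 := by
    refine isOpen_Ioo.ae_eq_zero_of_integral_contDiff_smul_eq_zero ?_ fun ψ h1 h2 h3 => ?_
    · have : IntegrableOn (fun t => g t - c) (Ioo 0 T) := hg.sub (integrable_const c)
      exact this.locallyIntegrableOn
    · set I := ∫ t, ψ t with hI
      -- Removing the mean of `ψ` makes its primitive `φ` compactly supported in `(0,T)`, hence
      -- admissible in the hypothesis. The identity `∫ φ' g = 0` then reads `∫ ψ g = I c`.
      set k : ℝ → ℝ := fun t => ψ t - I * θ t with hk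
      have hk1 : ContDiff ℝ ∞ k := h1.sub (contDiff_const.mul hθ1)
      set φ : ℝ → ℝ := fun t => ∫ s in (0 : ℝ)..t, k s with hφ
      have hd : ∀ t, HasDerivAt φ (k t) t := fun t =>
        intervalIntegral.integral_hasDerivAt_right (hk1.continuous.intervalIntegrable _ _)
          hk1.continuous.aestronglyMeasurable.stronglyMeasurableAtFilter hk1.continuous.continuousAt
      have hdφ : deriv φ = k := funext fun t => (hd t).deriv
      have hφ1 : ContDiff ℝ ∞ φ :=
        contDiff_infty_iff_deriv.2 ⟨fun t => (hd t).differentiableAt, hdφ ▸ hk1⟩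
      set K := tsupport ψ ∪ tsupport θ with hK
      have hKc : IsCompact K := h2.isCompact.union hθ2.isCompact
      have hKs : K ⊆ Ioo 0 T := union_subset h3 hθs
      have hKn : K.Nonempty := by
        by_contra hh
        have h0 : tsupport θ = ∅ := (union_empty_iff.1 (not_nonempty_iff_eq_empty.1 hh)).2
        have : θ = 0 := by
          ext t
          exact image_eq_zero_of_notMem_tsupport (by simp [h0])
        rw [this] at hθi
        simp at hθi
      have hk0 : ∀ t ∉ K, k t = 0 := fun t ht => by
        have e1 : ψ t = 0 := image_eq_zero_of_notMem_tsupport fun hh => ht (Or.inl hh)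
        have e2 : θ t = 0 := image_eq_zero_of_notMem_tsupport fun hh => ht (Or.inr hh)
        simp [hk, e1, e2]
      have ha := hKs (hKc.sInf_mem hKn)
      have hb := hKs (hKc.sSup_mem hKn)
      have hki : ∫ t, k t = 0 := by
        rw [hk, integral_sub (h1.continuous.integrable_of_hasCompactSupport h2)
          ((hθ1.continuous.integrable_of_hasCompactSupport hθ2).const_mul I), integral_const_mul,
          hθi, mul_one, ← hI, sub_self]
      have hkIcc : ∀ a b, a ≤ b → K ⊆ Ioc a b → ∫ t in a..b, k t = 0 := by
        intro a b hab hs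
        rw [intervalIntegral.integral_of_le hab, ← hki]
        refine setIntegral_eq_integral_of_forall_compl_eq_zero fun t ht => hk0 t fun hh => ht (hs hh)
      -- To the left of the supports nothing has been integrated yet; to the right, the whole of `k`
      -- has, and its integral is zero.
      have hφ0 : ∀ t ∉ Icc (sInf K) (sSup K), φ t = 0 := by
        intro t ht
        rcases lt_or_ge t (sInf K) with h4 | h4
        · have : ∀ s ∈ uIcc 0 t, k s = 0 := fun s hs => hk0 s fun hh => by
            have h5 := csInf_le hKc.bddBelow hh
            have h6 : s ≤ max 0 t := hs.2
            rcases max_choice (0 : ℝ) t with h7 | h7 <;> rw [h7] at h6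
            · linarith [ha.1]
            · linarith
          rw [hφ]
          simp only
          rw [intervalIntegral.integral_congr (g := fun _ => 0) this, intervalIntegral.integral_zero]
        · have h5 : sSup K < t := by
            by_contra hh
            exact ht ⟨h4, not_lt.1 hh⟩
          refine hkIcc 0 t (by linarith [hb.1]) fun s hs => ⟨(hKs hs).1, ?_⟩
          exact (le_csSup hKc.bddAbove hs).trans h5.le
      have hφs : tsupport φ ⊆ Icc (sInf K) (sSup K) :=
        closure_minimal (fun t ht => by by_contra hh; exact ht (hφ0 t hh)) isClosed_Icc
      have hφ2 : HasCompactSupport φ := isCompact_Icc.of_isClosed_subset (isClosed_tsupport _) hφs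
      have e := h φ hφ1 hφ2 (hφs.trans fun t ht => ⟨ha.1.trans_le ht.1, ht.2.trans_lt hb.2⟩)
      rw [hdφ] at e
      have e1 : ∫ t in Ioo 0 T, k t * g t = (∫ t in Ioo 0 T, ψ t * g t) - I * c := by
        rw [hc, ← integral_const_mul, ← integral_sub (bdd h1.continuous h2)
          ((bdd hθ1.continuous hθ2).const_mul I)]
        refine integral_congr_ae (Filter.Eventually.of_forall fun t => ?_)
        simp only [hk]
        ring
      have e2 : ∫ t, ψ t • (g t - c) = ∫ t in Ioo 0 T, ψ t • (g t - c) := by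
        refine (setIntegral_eq_integral_of_forall_compl_eq_zero fun t ht => ?_).symm
        rw [eq_zero_of_tsupport_subset_Ioo h3 ht, zero_smul]
      have e3 : I = ∫ t in Ioo 0 T, ψ t :=
        (setIntegral_eq_integral_of_forall_compl_eq_zero fun t ht =>
          eq_zero_of_tsupport_subset_Ioo h3 ht).symm
      rw [e2]
      simp only [smul_eq_mul, mul_sub]
      rw [integral_sub (bdd h1.continuous h2)
        ((h1.continuous.integrable_of_hasCompactSupport h2).integrableOn.mul_const c),
        integral_mul_const, ← e3, ← e1, e]
  filter_upwards [(ae_restrict_iff' measurableSet_Ioo).2 key] with t ht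
  exact sub_eq_zero.1 ht

variable {V : Type} [NormedAddCommGroup V] [InnerProductSpace ℝ V] [CompleteSpace V]

/-- The range of the primitive operator is dense in `L²(0,T; V)`. -/
theorem topologicalClosure_range_primitiveL :
    (LinearMap.range (primitiveL T V : L2T T V →ₗ[ℝ] L2T T V)).topologicalClosure = ⊤ := by
  rw [Submodule.topologicalClosure_eq_top_iff, eq_bot_iff]
  intro ψ hψ
  rw [Submodule.mem_bot]
  refine L2T.eq_zero_of_forall_inner ψ fun ζ => ?_
  have hi : Integrable (fun t => ⟪ψ t, ζ⟫) (volume.restrict (Ioo (0 : ℝ) T)) :=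
    (L2T.integrable ψ).inner_const ζ
  refine (ae_restrict_iff' measurableSet_Ioo).2 ?_
  refine isOpen_Ioo.ae_eq_zero_of_integral_contDiff_smul_eq_zero
    (IntegrableOn.locallyIntegrableOn hi) fun φ h1 h2 h3 => ?_
  have hd : Continuous (deriv φ) := h1.continuous_deriv (by simp)
  -- The primitive of `φ' ζ` is `φ ζ`, so orthogonality of `ψ` to the range gives `∫ φ ⟨ψ, ζ⟩ = 0`
  -- for every test function `φ`.
  have hk : MemLp (fun t => deriv φ t • ζ) 2 (volume.restrict (Ioo (0 : ℝ) T)) := by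
    obtain ⟨M, hM⟩ := h2.deriv.exists_bound_of_continuous hd
    refine MemLp.of_bound (hd.smul continuous_const).aestronglyMeasurable (M * ‖ζ‖)
      (Filter.Eventually.of_forall fun t => ?_)
    rw [norm_smul]
    exact mul_le_mul_of_nonneg_right (hM t) (norm_nonneg _)
  have h4 : ⟪primitiveL T V hk.toLp, ψ⟫ = 0 :=
    (Submodule.mem_orthogonal _ _).1 hψ _ ⟨hk.toLp, rfl⟩
  rw [L2.inner_def] at h4
  refine (setIntegral_eq_integral_of_forall_compl_eq_zero (s := Ioo 0 T)
    fun t ht => by rw [eq_zero_of_tsupport_subset_Ioo h3 ht, zero_smul]).symm.trans ?_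
  refine Eq.trans ?_ h4
  refine integral_congr_ae ?_
  filter_upwards [primitiveL_ae hk.toLp, ae_restrict_mem measurableSet_Ioo] with t h5 ht
  rw [h5, primitive_congr hk.coeFn_toLp (Ioo_subset_Icc_self ht),
    intervalIntegral.integral_smul_const, integral_deriv_testFunction h1 h3, inner_smul_left,
    real_inner_comm]
  rfl

end TestFunctions

/-! ### Energy estimate and continuity in time -/

section Evolution

variable {T : ℝ} {V W : Type} [NormedAddCommGroup V] [InnerProductSpace ℝ V] [CompleteSpace V]
  [NormedAddCommGroup W] [NormedSpace ℝ W] [CompleteSpace W]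

/-- `v` solves the degenerate evolution equation `(P v)' + A v = l`, `(P v)(0) = 0`. -/
def SolvesEvolution (A P : V →L[ℝ] V) (v l : L2T T V) : Prop :=
  P.compLpL 2 _ v + primitiveL T V (A.compLpL 2 _ v) = primitiveL T V l

omit [CompleteSpace V] in
theorem SolvesEvolution.sub {A P : V →L[ℝ] V} {v l v' l' : L2T T V}
    (h : SolvesEvolution A P v l) (h' : SolvesEvolution A P v' l') :
    SolvesEvolution A P (v - v') (l - l') := by
  unfold SolvesEvolution at *
  simp only [map_sub, ← h, ← h']
  abel

/-- Integration in time commutes with `P` and `A`. The solutions obtained in this way are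
primitives, so the chain rule applies to them. -/
theorem SolvesEvolution.primitive {A P : V →L[ℝ] V} {v l : L2T T V}
    (h : SolvesEvolution A P v l) :
    SolvesEvolution A P (primitiveL T V v) (primitiveL T V l) := by
  unfold SolvesEvolution at *
  rw [← primitiveL_compLpL, ← primitiveL_compLpL, ← h, map_add]

/-- Douglas' lemma bounds one solution; by uniqueness it is every solution. -/
theorem SolvesEvolution.norm_le (hT : 0 ≤ T) {A P : V →L[ℝ] V} {c : ℝ} (hc : 0 < c)
    (hA : ∀ x, c * ‖x‖ ^ 2 ≤ ⟪A x, x⟫) (hP : ∀ x y, ⟪P x, y⟫ = ⟪x, P y⟫)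
    (hP0 : ∀ x, 0 ≤ ⟪P x, x⟫) (hPi : ∀ x, P x = 0 → x = 0) {v l : L2T T V}
    (h : SolvesEvolution A P v l) : ‖v‖ ≤ c⁻¹ * ‖l‖ := by
  obtain ⟨v', h1, h2⟩ := exists_degenerate_evolution hT A P hc hA hP hP0 l
  have h3 := h.sub (show SolvesEvolution A P v' l from h1)
  rw [sub_self, SolvesEvolution, map_zero] at h3
  rw [sub_eq_zero.1 (degenerate_evolution_unique hT A P hc hA hP hP0 hPi _ h3)]
  exact h2

/-- The energy estimate for solutions which are primitives. -/
theorem SolvesEvolution.energy (hT : 0 ≤ T) {A P : V →L[ℝ] V} {c : ℝ} (hc : 0 < c)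
    (hA : ∀ x, c * ‖x‖ ^ 2 ≤ ⟪A x, x⟫) (hP : ∀ x y, ⟪P x, y⟫ = ⟪x, P y⟫)
    (hP0 : ∀ x, 0 ≤ ⟪P x, x⟫) (hPi : ∀ x, P x = 0 → x = 0) {r k : L2T T V}
    (h : SolvesEvolution A P r k) {t : ℝ} (ht : t ∈ Icc 0 T) :
    ⟪P (∫ s in (0 : ℝ)..t, r s), ∫ s in (0 : ℝ)..t, r s⟫ ≤ 2 * c⁻¹ * ‖primitiveL T V k‖ ^ 2 := by
  -- Pointwise in time `P r = J k - A J r`. Pairing with `J r` and dropping the nonnegative `⟨A J r,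
  -- J r⟩` leaves `⟨J r, J k⟩`.
  have h1 : ∀ᵐ s ∂(volume.restrict (Ioo (0 : ℝ) T)), ⟪P (∫ q in (0 : ℝ)..s, r q), r s⟫ ≤
      ‖primitiveL T V r s‖ * ‖primitiveL T V k s‖ := by
    have e : P.compLpL 2 _ r + A.compLpL 2 _ (primitiveL T V r) = primitiveL T V k := by
      rw [← primitiveL_compLpL]; exact h
    have e' := (Lp.coeFn_add (P.compLpL 2 _ r) (A.compLpL 2 _ (primitiveL T V r)))
    rw [e] at e'
    filter_upwards [e', P.coeFn_compLpL r, A.coeFn_compLpL (primitiveL T V r), primitiveL_ae r]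
      with s h1 h2 h3 h4
    rw [Pi.add_apply, h2, h3] at h1
    rw [← h4, hP, eq_sub_of_add_eq h1.symm, inner_sub_right]
    have h5 := hA (primitiveL T V r s)
    rw [real_inner_comm] at h5
    have h6 : 0 ≤ c * ‖primitiveL T V r s‖ ^ 2 := by positivity
    linarith [real_inner_le_norm (primitiveL T V r s) (primitiveL T V k s)]
  have hm : ∀ f : L2T T V, MemLp (fun s => ‖f s‖) 2 (volume.restrict (Ioo (0 : ℝ) T)) :=
    fun f => (Lp.memLp f).norm
  have hi : Integrable (fun s => ‖primitiveL T V r s‖ * ‖primitiveL T V k s‖)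
      (volume.restrict (Ioo (0 : ℝ) T)) :=
    (hm (primitiveL T V r)).integrable_mul (hm (primitiveL T V k))
  have hcs : ∫ s in Ioo 0 T, ‖primitiveL T V r s‖ * ‖primitiveL T V k s‖ ≤
      ‖primitiveL T V r‖ * ‖primitiveL T V k‖ := by
    have h2 := real_inner_le_norm (hm (primitiveL T V r)).toLp (hm (primitiveL T V k)).toLp
    rw [L2.inner_def, Lp.norm_toLp, Lp.norm_toLp, eLpNorm_norm, eLpNorm_norm] at h2
    refine (le_of_eq ?_).trans h2
    refine integral_congr_ae ?_
    filter_upwards [(hm (primitiveL T V r)).coeFn_toLp, (hm (primitiveL T V k)).coeFn_toLp]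
      with s h3 h4
    rw [h3, h4]
    simp [mul_comm]
  have h2 : ∫ s in (0 : ℝ)..t, ⟪P (∫ q in (0 : ℝ)..s, r q), r s⟫ ≤
      ∫ s in Ioo 0 T, ‖primitiveL T V r s‖ * ‖primitiveL T V k s‖ := by
    rw [intervalIntegral.integral_of_le ht.1, integral_Ioc_eq_integral_Ioo]
    refine le_trans ?_ (setIntegral_mono_set hi
      (Filter.Eventually.of_forall fun _ => by positivity)
      (Ioo_subset_Ioo_right ht.2).eventuallyLE)
    have hrt : volume.restrict (Ioo (0 : ℝ) t) ≤ volume.restrict (Ioo (0 : ℝ) T) :=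
      Measure.restrict_mono (Ioo_subset_Ioo_right ht.2) le_rfl
    refine integral_mono_ae (Integrable.mono_measure ?_ hrt) (hi.mono_measure hrt) (ae_mono hrt h1)
    refine (L2.integrable_inner (𝕜 := ℝ) (P.compLpL 2 _ (primitiveL T V r)) r).congr ?_
    filter_upwards [P.coeFn_compLpL (primitiveL T V r), primitiveL_ae r] with s h3 h4
    rw [h3, h4]
  rw [← integral_inner_primitive P hP r ht]
  -- `J r` solves the equation with data `J k`, so `‖J r‖ ≤ c⁻¹ ‖J k‖`; the bound involves `J k`
  -- only, never `k`.
  have h3 := h.primitive.norm_le hT hc hA hP hP0 hPi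
  nlinarith [norm_nonneg (primitiveL T V k), norm_nonneg (primitiveL T V r)]

/-- If `P` controls `Q`, then `Q v` is continuous in time. -/
theorem SolvesEvolution.exists_continuous (hT : 0 ≤ T) {A P : V →L[ℝ] V} {c : ℝ} (hc : 0 < c)
    (hA : ∀ x, c * ‖x‖ ^ 2 ≤ ⟪A x, x⟫) (hP : ∀ x y, ⟪P x, y⟫ = ⟪x, P y⟫)
    (hP0 : ∀ x, 0 ≤ ⟪P x, x⟫) (hPi : ∀ x, P x = 0 → x = 0) (Q : V →L[ℝ] W) {M : ℝ} (hM : 0 ≤ M)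
    (hQ : ∀ x, ‖Q x‖ ^ 2 ≤ M * ⟪P x, x⟫) {v l : L2T T V} (h : SolvesEvolution A P v l) :
    ∃ U : ℝ → W, ContinuousOn U (Icc 0 T) ∧
      (∀ᵐ t ∂(volume.restrict (Ioo (0 : ℝ) T)), U t = Q (v t)) ∧ U 0 = 0 ∧
      ∀ t ∈ Icc 0 T, ‖U t‖ ≤ √(M * (2 * c⁻¹)) * ‖l‖ := by
  have est : ∀ {r k : L2T T V}, SolvesEvolution A P r k → ∀ t ∈ Icc 0 T,
      ‖Q (∫ s in (0 : ℝ)..t, r s)‖ ≤ √(M * (2 * c⁻¹)) * ‖primitiveL T V k‖ := by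
    intro r k hrk t ht
    rw [← sq_le_sq₀ (norm_nonneg _) (by positivity), mul_pow, Real.sq_sqrt (by positivity)]
    refine (hQ _).trans ?_
    rw [mul_assoc]
    exact mul_le_mul_of_nonneg_left (hrk.energy hT hc hA hP hP0 hPi ht) hM
  -- Approximate `l` by `y j = J (k j)`, and let `r j` solve the equation with data `k j`. Then `J
  -- (r j)` solves it with data `y j`, and the energy estimate makes `Q J (r j)` a Cauchy sequence
  -- in the uniform norm.
  have hl : l ∈ (LinearMap.range (primitiveL T V : L2T T V →ₗ[ℝ] L2T T V)).topologicalClosure := by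
    rw [topologicalClosure_range_primitiveL]; trivial
  rw [← SetLike.mem_coe, Submodule.topologicalClosure_coe, mem_closure_iff_seq_limit] at hl
  obtain ⟨y, hy, hyl⟩ := hl
  choose k hk using hy
  have hk' : ∀ j, primitiveL T V (k j) = y j := hk
  choose r hr _ using fun j => exists_degenerate_evolution hT A P hc hA hP hP0 (k j)
  have hr' : ∀ j, SolvesEvolution A P (r j) (k j) := hr
  let U : ℕ → C(Icc 0 T, W) := fun j => ⟨fun t => Q (∫ s in (0 : ℝ)..(t : ℝ), r j s),
    Q.continuous.comp (continuousOn_iff_continuous_domRestrict.1 (L2T.continuousOn_primitive (r j)))⟩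
  have hdist : ∀ i j, dist (U i) (U j) ≤ √(M * (2 * c⁻¹)) * dist (y i) (y j) := by
    intro i j
    refine (ContinuousMap.dist_le (by positivity)).2 fun t => ?_
    have h1 := est ((hr' i).sub (hr' j)) t t.2
    rw [map_sub, hk', hk', ← dist_eq_norm, primitive_congr (Lp.coeFn_sub (r i) (r j)) t.2] at h1
    simp only [Pi.sub_apply] at h1
    rw [intervalIntegral.integral_sub (L2T.intervalIntegrable _ t.2)
      (L2T.intervalIntegrable _ t.2), map_sub, ← dist_eq_norm] at h1
    exact h1
  have hcauchy : CauchySeq U := by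
    obtain ⟨b, hb1, hb2, hb3⟩ := cauchySeq_iff_le_tendsto_0.1 hyl.cauchySeq
    refine cauchySeq_iff_le_tendsto_0.2 ⟨fun n => √(M * (2 * c⁻¹)) * b n, fun n => ?_, fun i j n hi hj =>
      (hdist i j).trans (mul_le_mul_of_nonneg_left (hb2 i j n hi hj) (Real.sqrt_nonneg _)), ?_⟩
    · exact mul_nonneg (Real.sqrt_nonneg _) (hb1 n)
    · simpa using hb3.const_mul (√(M * (2 * c⁻¹)))
  obtain ⟨U', hU'⟩ := cauchySeq_tendsto_of_complete hcauchy
  have hpt : ∀ t : Icc 0 T, Filter.Tendsto (fun j => U j t) Filter.atTop (𝓝 (U' t)) := fun t =>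
    ((continuous_eval_const t).tendsto U').comp hU'
  have hv : Filter.Tendsto (fun j => Q.compLpL 2 _ (primitiveL T V (r j))) Filter.atTop
      (𝓝 (Q.compLpL 2 _ v)) := by
    refine ((Q.compLpL 2 _).continuous.tendsto v).comp ?_
    rw [tendsto_iff_dist_tendsto_zero]
    have h0 : Filter.Tendsto (fun j => c⁻¹ * dist (y j) l) Filter.atTop (𝓝 0) := by
      simpa using (tendsto_iff_dist_tendsto_zero.1 hyl).const_mul c⁻¹
    refine squeeze_zero (fun _ => dist_nonneg) (fun j => ?_) h0
    rw [dist_eq_norm, dist_eq_norm, ← hk']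
    exact ((hr' j).primitive.sub h).norm_le hT hc hA hP hP0 hPi
  -- The same functions converge to `Q v` in `L²`, hence almost everywhere along a subsequence,
  -- which identifies the uniform limit with `Q v`.
  obtain ⟨ns, hns, hae⟩ := (tendstoInMeasure_of_tendsto_Lp hv).exists_seq_tendsto_ae
  refine ⟨fun t => U' (projIcc 0 T hT t), (U'.continuous.comp continuous_projIcc).continuousOn,
    ?_, ?_, fun t ht => ?_⟩
  · have h1 : ∀ᵐ t ∂(volume.restrict (Ioo (0 : ℝ) T)), ∀ j,
        Q.compLpL 2 _ (primitiveL T V (r j)) t = Q (∫ s in (0 : ℝ)..t, r j s) := by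
      refine ae_all_iff.2 fun j => ?_
      filter_upwards [Q.coeFn_compLpL (primitiveL T V (r j)), primitiveL_ae (r j)] with t h2 h3
      rw [h2, h3]
    filter_upwards [hae, h1, Q.coeFn_compLpL v, ae_restrict_mem measurableSet_Ioo] with t h2 h3 h4 ht
    have ht' := Ioo_subset_Icc_self ht
    rw [projIcc_of_mem hT ht', ← h4]
    simp only [h3] at h2
    exact tendsto_nhds_unique ((hpt ⟨t, ht'⟩).comp hns.tendsto_atTop) h2
  · have h0 : (0 : ℝ) ∈ Icc 0 T := ⟨le_rfl, hT⟩
    change U' (projIcc 0 T hT 0) = 0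
    rw [projIcc_of_mem hT h0]
    refine tendsto_nhds_unique (hpt ⟨0, h0⟩) ?_
    simp [U]
  · change ‖U' (projIcc 0 T hT t)‖ ≤ _
    rw [projIcc_of_mem hT ht]
    refine le_of_tendsto_of_tendsto (hpt ⟨t, ht⟩).norm (hyl.norm.const_mul _)
      (Filter.Eventually.of_forall fun j => ?_)
    have h1 := est (hr' j) t ht
    rwa [hk'] at h1

end Evolution

end TripleJunctionCluster

/-! ### Surface measures and local parametrizations -/

theorem LipschitzOnWith.euclideanHausdorffMeasure_image_le {X Y : Type*} [EMetricSpace X]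
    [EMetricSpace Y] [MeasurableSpace X] [BorelSpace X] [MeasurableSpace Y] [BorelSpace Y]
    {K : NNReal} {f : X → Y} {s : Set X} (h : LipschitzOnWith K f s) (d : ℕ) :
    (Measure.euclideanHausdorffMeasure d : Measure Y) (f '' s) ≤
      (K : ℝ≥0∞) ^ d * (Measure.euclideanHausdorffMeasure d : Measure X) s := by
  have h1 := h.hausdorffMeasure_image_le (d := d) (by positivity)
  rw [Measure.euclideanHausdorffMeasure_def, Measure.euclideanHausdorffMeasure_def,
    Measure.smul_apply, Measure.smul_apply, mul_smul_comm]
  rw [ENNReal.rpow_natCast] at h1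
  exact smul_le_smul_of_nonneg_left h1 zero_le

/-- The volume of a set is controlled by the surface measure of its image under a map with a
Lipschitz inverse. -/
theorem volume_inter_preimage_le {n : ℕ} {Γ : Set (Amb n)} {ψ : Par n → Amb n} {A : Set (Par n)}
    {K : NNReal} (hK : ∀ a ∈ A, ∀ b ∈ A, dist a b ≤ K * dist (ψ a) (ψ b)) (hA : MapsTo ψ A Γ)
    {B : Set (Amb n)} (hB : MeasurableSet B) :
    volume (A ∩ ψ ⁻¹' B) ≤ (K : ℝ≥0∞) ^ n * surfaceMeasure n Γ B := by
  set A' := A ∩ ψ ⁻¹' B with hA'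
  have hinj : InjOn ψ A' := fun a ha b hb hab => by
    have := hK a ha.1 b hb.1
    rw [hab, dist_self, mul_zero] at this
    exact dist_le_zero.1 this
  have hlip : LipschitzOnWith K (Function.invFunOn ψ A') (ψ '' A') := by
    refine LipschitzOnWith.of_dist_le_mul ?_
    rintro _ ⟨a, ha, rfl⟩ _ ⟨b, hb, rfl⟩
    rw [hinj.leftInvOn_invFunOn ha, hinj.leftInvOn_invFunOn hb]
    exact hK a ha.1 b hb.1
  have h0 := hlip.euclideanHausdorffMeasure_image_le n
  rw [hinj.invFunOn_image le_rfl, EuclideanSpace.euclideanHausdorffMeasure_eq_volume] at h0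
  refine h0.trans (mul_le_mul_right ?_ _)
  rw [Measure.restrict_apply hB]
  refine measure_mono ?_
  rintro _ ⟨a, ha, rfl⟩
  exact ⟨ha.2, hA ha.1⟩

/-- An immersion expands distances by a definite factor near each point, so the volume is controlled
locally. A compact set needs only finitely many such neighbourhoods, whose constants add up. -/
theorem IsLocalParam.exists_volume_le {n : ℕ} {Γ S : Set (Amb n)} {U : Set (Par n)}
    {ψ : Par n → Amb n} (hψ : IsLocalParam Γ S U ψ) {k : Set (Par n)} (hk : IsCompact k)
    (hkU : k ⊆ U) :
    ∃ C : ℝ≥0∞, C ≠ ⊤ ∧ ∀ B, MeasurableSet B → volume (k ∩ ψ ⁻¹' B) ≤ C * surfaceMeasure n Γ B := by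
  refine hk.induction_on (p := fun s => ∃ C : ℝ≥0∞, C ≠ ⊤ ∧ ∀ B, MeasurableSet B →
    volume (s ∩ ψ ⁻¹' B) ≤ C * surfaceMeasure n Γ B) ⟨0, by simp, by simp⟩ ?_ ?_ ?_
  · rintro s t hst ⟨C, hC, h⟩
    exact ⟨C, hC, fun B hB => (measure_mono (inter_subset_inter_left _ hst)).trans (h B hB)⟩
  · rintro s t ⟨C, hC, h⟩ ⟨C', hC', h'⟩
    refine ⟨C + C', ENNReal.add_ne_top.2 ⟨hC, hC'⟩, fun B hB => ?_⟩
    rw [union_inter_distrib_right, add_mul]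
    exact (measure_union_le _ _).trans (add_le_add (h B hB) (h' B hB))
  · intro y hy
    have hyU := hkU hy
    have hs : HasStrictFDerivAt ψ (fderiv ℝ ψ y) y :=
      ((hψ.contDiffOn.contDiffAt (hψ.isOpen.mem_nhds hyU)).hasStrictFDerivAt (by norm_num))
    obtain ⟨V, hV, K, hK⟩ := exists_nhds_antilipschitz hs (hψ.immersion y hyU)
    refine ⟨V ∩ U, mem_nhdsWithin_of_mem_nhds (Filter.inter_mem hV (hψ.isOpen.mem_nhds hyU)),
      (K : ℝ≥0∞) ^ n, by finiteness, fun B hB => ?_⟩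
    exact volume_inter_preimage_le (fun a ha b hb => hK a ha.1 b hb.1)
      (fun a ha => (hψ.mapsTo ha.2).1) hB

theorem map_le_smul_of_volume_le {n : ℕ} {Γ : Set (Amb n)} {ψ : Par n → Amb n} {k : Set (Par n)}
    (hk : MeasurableSet k) (hψ : AEMeasurable ψ (volume.restrict k)) {C : ℝ≥0∞}
    (h : ∀ B, MeasurableSet B → volume (k ∩ ψ ⁻¹' B) ≤ C * surfaceMeasure n Γ B) :
    (volume.restrict k).map ψ ≤ C • surfaceMeasure n Γ := by
  refine Measure.le_iff.2 fun B hB => ?_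
  rw [Measure.map_apply_of_aemeasurable hψ hB, Measure.restrict_apply' hk, inter_comm]
  exact h B hB

/-- The functions in `L²(Γ)` are integrable in coordinates. -/
theorem IsLocalParam.integral_norm_comp_le {n : ℕ} {Γ S : Set (Amb n)} {U : Set (Par n)}
    {ψ : Par n → Amb n} (hψ : IsLocalParam Γ S U ψ) {k : Set (Par n)} (hk : IsCompact k)
    (hkU : k ⊆ U) (F : Type) [NormedAddCommGroup F] :
    ∃ C : ℝ, ∀ f : SurfL2 n Γ F, IntegrableOn (fun y => f (ψ y)) k ∧
      ∫ y in k, ‖f (ψ y)‖ ≤ C * ‖f‖ := by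
  obtain ⟨C, hC, h⟩ := hψ.exists_volume_le hk hkU
  have hm : AEMeasurable ψ (volume.restrict k) :=
    (hψ.contDiffOn.continuousOn.mono hkU).aemeasurable hk.measurableSet
  have hle := map_le_smul_of_volume_le hk.measurableSet hm h
  have hfin : IsFiniteMeasure (volume.restrict k : Measure (Par n)) :=
    ⟨by rw [Measure.restrict_apply_univ]; exact hk.measure_lt_top⟩
  -- The first factor pays for passing from parameter volume to surface measure, the second is
  -- Cauchy–Schwarz on `k`, which has finite volume.
  set D : ℝ≥0∞ := C ^ (1 / (2 : ℝ≥0∞)).toReal *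
    (volume.restrict k : Measure (Par n)) univ ^ (1 / (1 : ℝ≥0∞).toReal - 1 / (2 : ℝ≥0∞).toReal)
    with hD
  have hDt : D ≠ ⊤ := by
    refine ENNReal.mul_ne_top (ENNReal.rpow_ne_top_of_nonneg ENNReal.toReal_nonneg hC)
      (ENNReal.rpow_ne_top_of_nonneg ?_ (measure_ne_top _ _))
    norm_num
  refine ⟨D.toReal, fun f => ?_⟩
  have h1 : MemLp f 2 ((volume.restrict k).map ψ) := (Lp.memLp f).of_measure_le_smul hC hle
  have h2 : MemLp (fun y => f (ψ y)) 2 (volume.restrict k) := h1.comp_of_map hm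
  refine ⟨h2.integrable one_le_two, ?_⟩
  rw [integral_norm_eq_lintegral_enorm h2.1, Lp.norm_def, ← ENNReal.toReal_mul]
  refine ENNReal.toReal_mono (ENNReal.mul_ne_top hDt (Lp.eLpNorm_ne_top f)) ?_
  rw [← eLpNorm_one_eq_lintegral_enorm]
  refine (eLpNorm_le_eLpNorm_mul_rpow_measure_univ one_le_two h2.1).trans ?_
  have h3 : eLpNorm (fun y => f (ψ y)) 2 (volume.restrict k) ≤
      C ^ (1 / (2 : ℝ≥0∞)).toReal * eLpNorm f 2 (surfaceMeasure n Γ) := by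
    have e := eLpNorm_map_measure (p := 2) h1.1 hm
    rw [Function.comp_def] at e
    rw [← e, ← smul_eq_mul, ← eLpNorm_smul_measure_of_ne_top (by simp)]
    exact eLpNorm_mono_measure _ hle
  calc _ ≤ C ^ (1 / (2 : ℝ≥0∞)).toReal * eLpNorm f 2 (surfaceMeasure n Γ) * _ :=
        mul_le_mul_left h3 _
    _ = _ := by rw [hD]; ring

theorem IsLocalParam.locallyIntegrableOn_comp {n : ℕ} {Γ S : Set (Amb n)} {U : Set (Par n)}
    {ψ : Par n → Amb n} (hψ : IsLocalParam Γ S U ψ) {F : Type} [NormedAddCommGroup F]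
    (f : SurfL2 n Γ F) : LocallyIntegrableOn (fun y => f (ψ y)) U := by
  refine (locallyIntegrableOn_iff hψ.isOpen.isLocallyClosed).2 fun k hkU hk => ?_
  obtain ⟨C, h⟩ := hψ.integral_norm_comp_le hk hkU F
  exact (h f).1

theorem IsLocalParam.continuousOn_fderiv {n : ℕ} {Γ S : Set (Amb n)} {U : Set (Par n)}
    {ψ : Par n → Amb n} (hψ : IsLocalParam Γ S U ψ) (e : Par n) :
    ContinuousOn (fun y => fderiv ℝ ψ y e) U :=
  (hψ.contDiffOn.continuousOn_fderiv_of_isOpen hψ.isOpen (by norm_num)).clm_apply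
    continuousOn_const

/-- `∫ ⟨f ∘ ψ, k⟩` depends continuously on `f ∈ L²(Γ)`, for `k` continuous with compact support. -/
theorem IsLocalParam.integral_inner_comp {n : ℕ} {Γ S : Set (Amb n)} {U : Set (Par n)}
    {ψ : Par n → Amb n} (hψ : IsLocalParam Γ S U ψ) {F : Type} [NormedAddCommGroup F]
    [InnerProductSpace ℝ F] {k : Par n → F} {s : Set (Par n)} (hs : IsCompact s) (hsU : s ⊆ U)
    (hk : ContinuousOn k U) :
    (∀ f : SurfL2 n Γ F, IntegrableOn (fun y => ⟪f (ψ y), k y⟫) s) ∧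
    Continuous fun f : SurfL2 n Γ F => ∫ y in s, ⟪f (ψ y), k y⟫ := by
  obtain ⟨C, h⟩ := hψ.integral_norm_comp_le hs hsU F
  obtain ⟨M, hM⟩ := hs.exists_bound_of_continuousOn (hk.mono hsU)
  have hM' : ∀ᵐ y ∂(volume.restrict s), ‖k y‖ ≤ M := by
    filter_upwards [ae_restrict_mem hs.measurableSet] with y hy using hM y hy
  have hks : AEStronglyMeasurable k (volume.restrict s) :=
    (hk.mono hsU).aestronglyMeasurable_of_isCompact hs hs.measurableSet
  have hi : ∀ f : SurfL2 n Γ F, IntegrableOn (fun y => ⟪f (ψ y), k y⟫) s := by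
    intro f
    refine Integrable.mono' ((h f).1.norm.mul_const M) ((h f).1.1.inner hks) ?_
    filter_upwards [hM'] with y hy
    exact (norm_inner_le_norm _ _).trans (mul_le_mul_of_nonneg_left hy (norm_nonneg _))
  refine ⟨hi, ?_⟩
  have hadd : ∀ f g : SurfL2 n Γ F, ∀ᵐ y ∂(volume.restrict s), (f - g) (ψ y) =
      f (ψ y) - g (ψ y) := fun f g =>
    ae_restrict_of_ae_restrict_of_subset hsU (hψ.ae_comp (Lp.coeFn_sub f g))
  have hd : ∀ f g : SurfL2 n Γ F, dist (∫ y in s, ⟪f (ψ y), k y⟫) (∫ y in s, ⟪g (ψ y), k y⟫) ≤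
      |M| * |C| * dist f g := by
    intro f g
    rw [dist_eq_norm, ← integral_sub (hi f) (hi g), dist_eq_norm]
    have e : ∫ y in s, (⟪f (ψ y), k y⟫ - ⟪g (ψ y), k y⟫) = ∫ y in s, ⟪(f - g) (ψ y), k y⟫ := by
      refine integral_congr_ae ?_
      filter_upwards [hadd f g] with y hy
      rw [hy, inner_sub_left]
    rw [e]
    calc _ ≤ ∫ y in s, ‖(f - g) (ψ y)‖ * |M| := by
          refine norm_integral_le_of_norm_le ((h (f - g)).1.norm.mul_const _) ?_
          filter_upwards [hM'] with y hy
          exact (norm_inner_le_norm _ _).trans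
            (mul_le_mul_of_nonneg_left (hy.trans (le_abs_self M)) (norm_nonneg _))
      _ ≤ (|C| * ‖f - g‖) * |M| := by
          rw [integral_mul_const]
          refine mul_le_mul_of_nonneg_right ((h (f - g)).2.trans ?_) (abs_nonneg _)
          exact mul_le_mul_of_nonneg_right (le_abs_self C) (norm_nonneg _)
      _ = _ := by ring
  refine (LipschitzWith.of_dist_le_mul (K := ⟨|M| * |C|, by positivity⟩) hd).continuous

/-- The graph of the weak surface gradient is closed. -/
theorem isClosed_H1 {n : ℕ} (Γ S : Set (Amb n)) :
    IsClosed (H1 Γ S : Set (WithLp 2 (SurfL2 n Γ ℝ × SurfL2 n Γ (Amb n)))) := by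
  refine isClosed_of_closure_subset fun p hp => ?_
  obtain ⟨q, hq, hqp⟩ := mem_closure_iff_seq_limit.1 hp
  have hq' : ∀ j, HasSurfaceGradient Γ S (q j).fst (q j).snd := hq
  have hfst : Filter.Tendsto (fun j => (q j).fst) Filter.atTop (𝓝 p.fst) :=
    ((WithLp.prod_continuous_ofLp 2 _ _).fst.tendsto p).comp hqp
  have hsnd : Filter.Tendsto (fun j => (q j).snd) Filter.atTop (𝓝 p.snd) :=
    ((WithLp.prod_continuous_ofLp 2 _ _).snd.tendsto p).comp hqp
  change HasSurfaceGradient Γ S p.fst p.snd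
  refine ⟨fun U ψ hψ => ?_, fun U ψ hψ e => ⟨hψ.locallyIntegrableOn_comp _, ?_, ?_⟩⟩
  -- Tangentiality is pointwise membership in a finite-dimensional, hence closed, subspace, so it
  -- survives almost everywhere convergence of a subsequence of the gradients.
  · obtain ⟨ns, -, hae⟩ := (tendstoInMeasure_of_tendsto_Lp hsnd).exists_seq_tendsto_ae
    filter_upwards [hψ.ae_comp hae, ae_all_iff.2 fun j => (hq' j).tangential U ψ hψ] with y h1 h2
    have hc : IsClosed (range (fderiv ℝ ψ y)) :=
      (LinearMap.range (fderiv ℝ ψ y).toLinearMap).closed_of_finiteDimensional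
    exact hc.mem_of_tendsto h1 (Filter.Eventually.of_forall fun j => h2 _)
  · exact (locallyIntegrableOn_iff hψ.isOpen.isLocallyClosed).2 fun k hkU hk =>
      (hψ.integral_inner_comp hk hkU (hψ.continuousOn_fderiv e)).1 p.snd
  · intro η h1 h2 h3
    have hη' : Continuous fun y => fderiv ℝ η y e :=
      (h1.continuous_fderiv (by simp)).clm_apply continuous_const
    have z1 : ∀ h : Par n → ℝ, ∫ y, h y * fderiv ℝ η y e =
        ∫ y in tsupport η, ⟪h y, fderiv ℝ η y e⟫ := fun h => by
      rw [← setIntegral_eq_integral_of_forall_compl_eq_zero (s := tsupport η)]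
      · refine integral_congr_ae (Filter.Eventually.of_forall fun y => ?_)
        simp [mul_comm]
      · intro y hy
        have : fderiv ℝ η y = 0 :=
          image_eq_zero_of_notMem_tsupport fun hh => hy (tsupport_fderiv_subset ℝ hh)
        simp [this]
    have z2 : ∀ G : Par n → Amb n, ∫ y, ⟪G y, fderiv ℝ ψ y e⟫ * η y =
        ∫ y in tsupport η, ⟪G y, η y • fderiv ℝ ψ y e⟫ := fun G => by
      rw [← setIntegral_eq_integral_of_forall_compl_eq_zero (s := tsupport η)]
      · refine integral_congr_ae (Filter.Eventually.of_forall fun y => ?_)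
        simp [real_inner_smul_right, mul_comm]
      · intro y hy
        rw [image_eq_zero_of_notMem_tsupport hy, mul_zero]
    rw [z1, z2]
    -- For fixed `η` both sides of the integration by parts identity are continuous in the function
    -- and in its gradient, so the identity passes to the limit.
    have c1 := (hψ.integral_inner_comp h2 h3 hη'.continuousOn).2
    have c2 := (hψ.integral_inner_comp (k := fun y => η y • fderiv ℝ ψ y e) h2 h3
      (h1.continuous.continuousOn.smul (hψ.continuousOn_fderiv e))).2
    refine tendsto_nhds_unique ((c1.tendsto _).comp hfst) ?_
    refine ((c2.tendsto _).comp hsnd).neg.congr fun j => ?_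
    have := ((hq' j).weakPartial U ψ hψ e).integral_eq η h1 h2 h3
    rw [z1, z2] at this
    exact this.symm

/-- Weak partial derivatives of `C¹` functions are the classical ones. -/
theorem HasSurfaceGradient.fderiv_comp_eq {n : ℕ} {Γ S : Set (Amb n)} {f : Amb n → ℝ}
    {G : Amb n → Amb n} (H : HasSurfaceGradient Γ S f G) {U : Set (Par n)} {ψ : Par n → Amb n}
    (hψ : IsLocalParam Γ S U ψ) {g : Amb n → ℝ} (hg : ContDiff ℝ 1 g)
    (hfg : f =ᵐ[surfaceMeasure n Γ] g) (e : Par n) :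
    ∀ᵐ y ∂(volume.restrict U), fderiv ℝ (fun z => g (ψ z)) y e = ⟪G (ψ y), fderiv ℝ ψ y e⟫ := by
  have hd : ContDiffOn ℝ 1 (fun z => g (ψ z)) U :=
    hg.comp_contDiffOn (hψ.contDiffOn.of_le (by norm_num))
  have hd' : ContinuousOn (fun y => fderiv ℝ (fun z => g (ψ z)) y e) U :=
    (hd.continuousOn_fderiv_of_isOpen hψ.isOpen le_rfl).clm_apply continuousOn_const
  have hw := (H.weakPartial U ψ hψ e).congr hψ.isOpen (hψ.ae_comp hfg)
    (Filter.Eventually.of_forall fun _ => rfl)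
  have int : ∀ {a k : Par n → ℝ}, LocallyIntegrableOn a U → Continuous k → HasCompactSupport k →
      tsupport k ⊆ U → Integrable (fun y => a y * k y) := by
    intro a k ha hk hk1 hk2
    have h4 : IntegrableOn (fun y => a y * k y) (tsupport k) :=
      (ha.integrableOn_compact_subset hk2 hk1).mul_continuousOn hk.continuousOn hk1
    refine (integrableOn_iff_integrable_of_support_subset fun y hy => ?_).1 h4
    exact subset_tsupport _ fun hh => hy (by simp [hh])
  -- Comparing the classical with the weak integration by parts, the difference of the two
  -- derivatives annihilates every test function.
  have key := hψ.isOpen.ae_eq_zero_of_integral_contDiff_smul_eq_zero (μ := volume)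
    (f := fun y => fderiv ℝ (fun z => g (ψ z)) y e - ⟪G (ψ y), fderiv ℝ ψ y e⟫)
    ((hd'.locallyIntegrableOn hψ.isOpen.measurableSet).sub hw.2) fun η h1 h2 h3 => by
      have hη' : Continuous fun y => fderiv ℝ η y e :=
        (h1.continuous_fderiv (by simp)).clm_apply continuous_const
      have hs : tsupport (fun y => fderiv ℝ η y e) ⊆ tsupport η := tsupport_fderiv_apply_subset ℝ e
      have i1 := int (hd'.locallyIntegrableOn hψ.isOpen.measurableSet) h1.continuous h2 h3
      have i2 := int hw.2 h1.continuous h2 h3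
      have e1 := integral_mul_fderiv_eq_neg_fderiv_mul_of_integrable (μ := volume)
        (f := fun z => g (ψ z)) (g := η) (v := e) i1
        (int (hd.continuousOn.locallyIntegrableOn hψ.isOpen.measurableSet) hη'
          (h2.of_isClosed_subset (isClosed_tsupport _) hs) (hs.trans h3))
        (int (hd.continuousOn.locallyIntegrableOn hψ.isOpen.measurableSet) h1.continuous h2 h3)
        (fun x hx => (hd.contDiffAt (hψ.isOpen.mem_nhds (h3 hx))).differentiableAt (by norm_num))
        (fun x _ => h1.differentiable (by simp) x)
      have e2 := hw.integral_eq η h1 h2 h3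
      rw [e1, neg_inj] at e2
      simp only [smul_eq_mul, mul_comm (η _), sub_mul]
      rw [integral_sub i1 i2, e2, sub_self]
  filter_upwards [(ae_restrict_iff' hψ.isOpen.measurableSet).2 key] with y hy
  exact sub_eq_zero.1 hy

/-- The surface gradient of zero vanishes in coordinates. -/
theorem HasSurfaceGradient.comp_eq_zero {n : ℕ} {Γ S : Set (Amb n)} {f : Amb n → ℝ}
    {G : Amb n → Amb n} (H : HasSurfaceGradient Γ S f G) (hf : f =ᵐ[surfaceMeasure n Γ] 0)
    {U : Set (Par n)} {ψ : Par n → Amb n} (hψ : IsLocalParam Γ S U ψ) :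
    ∀ᵐ y ∂(volume.restrict U), G (ψ y) = 0 := by
  -- The exceptional null set depends on the direction, so only the finitely many basis directions
  -- are used here; linearity recovers the others.
  have h := fun i => H.fderiv_comp_eq hψ (contDiff_const (c := (0 : ℝ))) hf
    (EuclideanSpace.basisFun (Fin n) ℝ i)
  filter_upwards [ae_all_iff.2 h, H.tangential U ψ hψ] with y h1 h2
  obtain ⟨v, hv⟩ := h2
  have h3 : ∀ e, ⟪G (ψ y), fderiv ℝ ψ y e⟫ = 0 := by
    intro e
    rw [← (EuclideanSpace.basisFun (Fin n) ℝ).sum_repr e, map_sum, inner_sum]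
    refine Finset.sum_eq_zero fun i _ => ?_
    rw [map_smul, real_inner_smul_right, ← h1 i]
    simp
  -- `G ∘ ψ` is orthogonal to all tangent vectors and is the tangent vector `Dψ v` itself.
  have h4 := h3 v
  rw [hv] at h4
  exact inner_self_eq_zero.1 h4

/-! ### Charts -/

/-- The embedding `y ↦ (y, 0)` of `ℝ^n` into `ℝ^{n+1}`. -/
noncomputable def hyperplaneEmb (n : ℕ) : Par n →ₗᵢ[ℝ] Amb n where
  toFun y := WithLp.toLp 2 (Fin.snoc (α := fun _ => ℝ) y 0)
  map_add' x y := by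
    ext i
    refine Fin.lastCases ?_ (fun j => ?_) i <;> simp
  map_smul' c x := by
    ext i
    refine Fin.lastCases ?_ (fun j => ?_) i <;> simp
  norm_map' x := by
    rw [EuclideanSpace.norm_eq, EuclideanSpace.norm_eq, Fin.sum_univ_castSucc]
    simp

theorem hyperplaneEmb_last (n : ℕ) (y : Par n) : hyperplaneEmb n y (Fin.last n) = 0 := by
  simp [hyperplaneEmb]

theorem hyperplaneEmb_castSucc (n : ℕ) (y : Par n) (i : Fin n) :
    hyperplaneEmb n y i.castSucc = y i := by
  simp [hyperplaneEmb]

theorem hyperplaneEmb_zero (m : ℕ) (y : Par (m + 1)) : hyperplaneEmb (m + 1) y 0 = y 0 :=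
  hyperplaneEmb_castSucc (m + 1) y 0

theorem exists_hyperplaneEmb_eq {n : ℕ} {x : Amb n} (hx : x (Fin.last n) = 0) :
    ∃ y, hyperplaneEmb n y = x := by
  refine ⟨WithLp.toLp 2 fun i => x i.castSucc, ?_⟩
  ext i
  refine Fin.lastCases ?_ (fun j => ?_) i
  · rw [hyperplaneEmb_last, hx]
  · rw [hyperplaneEmb_castSucc]

/-- `ψ` parametrizes `Γ` near `p` by a ball, or by the part of a ball in a half-space if `p ∈ S`, and
`ψ` is bi-Lipschitz. -/
structure IsChartAt {m : ℕ} (Γ S : Set (Amb (m + 1))) (p : Amb (m + 1))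
    (ψ : Par (m + 1) → Amb (m + 1)) (y₀ : Par (m + 1)) (r : ℝ) (L K : NNReal)
    (W Z : Set (Par (m + 1))) : Prop where
  pos : 0 < r
  contDiffOn : ContDiffOn ℝ 2 ψ (Metric.ball y₀ r)
  lipschitz : LipschitzOnWith L ψ (Metric.ball y₀ r)
  antilipschitz : ∀ a ∈ Metric.ball y₀ r, ∀ b ∈ Metric.ball y₀ r, dist a b ≤ K * dist (ψ a) (ψ b)
  isLocalParam : IsLocalParam Γ S W ψ
  subset_ball : W ⊆ Metric.ball y₀ r
  null : Z ⊆ {y | y 0 = 0}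
  covers : ∃ N ∈ 𝓝 p, Γ ∩ N ⊆ ψ '' (W ∪ Z ∩ Metric.ball y₀ r)
  boundary : p ∈ S → y₀ 0 = 0 ∧ W = Metric.ball y₀ r ∩ {y | 0 < y 0} ∧
    ∀ s, 0 < s → s ≤ r → ∃ N ∈ 𝓝 p, S ∩ N ⊆ ψ '' (Metric.ball y₀ s ∩ {y | y 0 = 0})

/-- The inverse of a straightening, restricted to the hyperplane, is bi-Lipschitz on a small ball
because both it and the straightening are `C²`. Near a boundary point `ψ` is defined on the full
ball, beyond the half that parametrizes `Γ`, so `C¹` functions pulled back by `ψ` are differentiable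
up to and across the edge. -/
theorem IsHypersurfaceWithBoundary.exists_chart {m : ℕ} {Γ S : Set (Amb (m + 1))}
    (h : IsHypersurfaceWithBoundary Γ S) {p : Amb (m + 1)} (hp : p ∈ Γ) :
    ∃ ψ y₀ r L K W Z, IsChartAt Γ S p ψ y₀ r L K W Z := by
  obtain ⟨Φ, hpΦ, hΦ⟩ := h.exists_straightening p hp
  have hΓ0 : ∀ x ∈ Φ.source, x ∈ Γ → Φ x (Fin.last (m + 1)) = 0 := by
    rcases hΦ.flat with h1 | h1
    · exact fun x hx hxΓ => (h1 x hx).2.1 hxΓ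
    · exact fun x hx hxΓ => ((h1 x hx).1.1 hxΓ).1
  obtain ⟨y₀, hy₀⟩ := exists_hyperplaneEmb_eq (hΓ0 p hpΦ hp)
  set ι := hyperplaneEmb (m + 1) with hι
  have hq : Φ p ∈ Φ.target := Φ.map_source hpΦ
  have hsd : ContDiffAt ℝ 2 Φ.symm (Φ p) :=
    hΦ.contDiffOn_symm.contDiffAt (Φ.open_target.mem_nhds hq)
  have hd : ContDiffAt ℝ 2 Φ p := hΦ.contDiffOn.contDiffAt (Φ.open_source.mem_nhds hpΦ)
  obtain ⟨L, t, ht, hL⟩ := (hsd.of_le (by norm_num)).exists_lipschitzOnWith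
  obtain ⟨K, t', ht', hK⟩ := (hd.of_le (by norm_num)).exists_lipschitzOnWith
  have ht'' : Φ.symm ⁻¹' t' ∈ 𝓝 (Φ p) := by
    refine hsd.continuousAt ?_
    rwa [Φ.left_inv hpΦ]
  -- The radius is so small that `Φ.symm` is defined and Lipschitz on the ball and maps it to where
  -- `Φ` is Lipschitz.
  obtain ⟨r, hr, hball⟩ := Metric.mem_nhds_iff.1
    (Filter.inter_mem (Filter.inter_mem ht ht'') (Φ.open_target.mem_nhds hq))
  have hιb : ∀ {s y}, y ∈ Metric.ball y₀ s ↔ ι y ∈ Metric.ball (Φ p) s := fun {s y} => by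
    rw [Metric.mem_ball, Metric.mem_ball, ← hy₀, ι.dist_map]
  set ψ : Par (m + 1) → Amb (m + 1) := fun y => Φ.symm (ι y) with hψ
  have hbt : ∀ y ∈ Metric.ball y₀ r, ι y ∈ Φ.target := fun y hy => (hball (hιb.1 hy)).2
  have hψs : ∀ y ∈ Metric.ball y₀ r, ψ y ∈ Φ.source := fun y hy => Φ.map_target (hbt y hy)
  have hΦψ : ∀ y ∈ Metric.ball y₀ r, Φ (ψ y) = ι y := fun y hy => Φ.right_inv (hbt y hy)
  have hcd : ContDiffOn ℝ 2 ψ (Metric.ball y₀ r) :=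
    hΦ.contDiffOn_symm.comp ι.contDiff.contDiffOn hbt
  have hlip : LipschitzOnWith L ψ (Metric.ball y₀ r) := by
    refine LipschitzOnWith.of_dist_le_mul fun a ha b hb => ?_
    rw [← ι.dist_map a b]
    exact hL.dist_le_mul _ (hball (hιb.1 ha)).1.1 _ (hball (hιb.1 hb)).1.1
  have hanti : ∀ a ∈ Metric.ball y₀ r, ∀ b ∈ Metric.ball y₀ r,
      dist a b ≤ K * dist (ψ a) (ψ b) := fun a ha b hb => by
    rw [← ι.dist_map a b, ← hΦψ a ha, ← hΦψ b hb]
    exact hK.dist_le_mul _ (hball (hιb.1 ha)).1.2 _ (hball (hιb.1 hb)).1.2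
  have hinj : InjOn ψ (Metric.ball y₀ r) := fun a ha b hb hab => by
    have := hanti a ha b hb
    rw [hab, dist_self, mul_zero] at this
    exact dist_le_zero.1 this
  have himm : ∀ y ∈ Metric.ball y₀ r, Function.Injective (fderiv ℝ ψ y) := by
    intro y hy
    have h1 : HasFDerivAt ψ (fderiv ℝ ψ y) y :=
      ((hcd.contDiffAt (Metric.isOpen_ball.mem_nhds hy)).differentiableAt (by norm_num)).hasFDerivAt
    have h2 : HasFDerivAt Φ (fderiv ℝ Φ (ψ y)) (ψ y) :=
      ((hΦ.contDiffOn.contDiffAt (Φ.open_source.mem_nhds (hψs y hy))).differentiableAt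
        (by norm_num)).hasFDerivAt
    -- Differentiating `Φ ∘ ψ = ι` exhibits `Dψ` as the right factor of an injective map.
    have h3 : HasFDerivAt ι ((fderiv ℝ Φ (ψ y)).comp (fderiv ℝ ψ y)) y := by
      refine (h2.comp y h1).congr_of_eventuallyEq ?_
      filter_upwards [Metric.isOpen_ball.mem_nhds hy] with z hz using (hΦψ z hz).symm
    have h4 := h3.unique ι.toContinuousLinearMap.hasFDerivAt
    intro a b hab
    apply ι.injective
    have e : ∀ z, ι z = fderiv ℝ Φ (ψ y) (fderiv ℝ ψ y z) := fun z =>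
      (DFunLike.congr_fun h4 z).symm
    rw [e, e, hab]
  have hparam : ∀ W ⊆ Metric.ball y₀ r, IsOpen W → MapsTo ψ W (Γ \ S) → IsLocalParam Γ S W ψ :=
    fun W hW hWo hWm => ⟨hWo, hcd.mono hW, hinj.mono hW, hWm, fun y hy => himm y (hW hy)⟩
  have hnhds : ∀ s, 0 < s → Φ.source ∩ Φ ⁻¹' Metric.ball (Φ p) s ∈ 𝓝 p := fun s hs =>
    Filter.inter_mem (Φ.open_source.mem_nhds hpΦ)
      (hd.continuousAt (Metric.ball_mem_nhds _ hs))
  have hpre : ∀ s x, x ∈ Φ.source → Φ x ∈ Metric.ball (Φ p) s → x ∈ Γ →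
      ∃ y ∈ Metric.ball y₀ s, ι y = Φ x ∧ ψ y = x := by
    intro s x hx hxs hxΓ
    obtain ⟨y, hy⟩ := exists_hyperplaneEmb_eq (hΓ0 x hx hxΓ)
    refine ⟨y, hιb.2 (by rw [hι, hy]; exact hxs), hy, ?_⟩
    simp only [hψ, hι, hy, Φ.left_inv hx]
  rcases hΦ.flat with hf | hf
  · refine ⟨ψ, y₀, r, L, K, Metric.ball y₀ r, ∅, hr, hcd, hlip, hanti,
      hparam _ le_rfl Metric.isOpen_ball fun y hy => ?_, le_rfl, empty_subset _,
      ⟨_, hnhds r hr, ?_⟩, fun hpS => absurd hpS (hf p hpΦ).1⟩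
    · refine ⟨(hf _ (hψs y hy)).2.2 ?_, (hf _ (hψs y hy)).1⟩
      rw [hΦψ y hy, hι, hyperplaneEmb_last]
    · rintro x ⟨hxΓ, hx, hxs⟩
      obtain ⟨y, hy, -, hyx⟩ := hpre r x hx hxs hxΓ
      exact ⟨y, Or.inl hy, hyx⟩
  · have hopen : IsOpen {y : Par (m + 1) | 0 < y 0} :=
      isOpen_lt continuous_const (by fun_prop)
    refine ⟨ψ, y₀, r, L, K, Metric.ball y₀ r ∩ {y | 0 < y 0}, {y | y 0 = 0}, hr, hcd, hlip, hanti,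
      hparam _ inter_subset_left (Metric.isOpen_ball.inter hopen) fun y hy => ?_, inter_subset_left,
      le_rfl, ⟨_, hnhds r hr, ?_⟩, fun hpS => ⟨?_, rfl, fun s hs hsr => ⟨_, hnhds s hs, ?_⟩⟩⟩
    · have hy0 : 0 < y 0 := hy.2
      have hf' := hf _ (hψs y hy.1)
      rw [hΦψ y hy.1, hι, hyperplaneEmb_last, hyperplaneEmb_zero] at hf'
      exact ⟨hf'.1.2 ⟨rfl, hy0.le⟩, fun hh => hy0.ne' (hf'.2.1 hh).2⟩
    · rintro x ⟨hxΓ, hx, hxs⟩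
      obtain ⟨y, hy, hyΦ, hyx⟩ := hpre r x hx hxs hxΓ
      have h0 : 0 ≤ y 0 := by
        rw [← hyperplaneEmb_zero, ← hι, hyΦ]
        exact ((hf x hx).1.1 hxΓ).2
      rcases h0.eq_or_lt with h0 | h0
      · exact ⟨y, Or.inr ⟨h0.symm, hy⟩, hyx⟩
      · exact ⟨y, Or.inl ⟨hy, h0⟩, hyx⟩
    · rw [← hyperplaneEmb_zero, hy₀]
      exact ((hf p hpΦ).2.1 hpS).2
    · rintro x ⟨hxS, hx, hxs⟩
      obtain ⟨y, hy, hyΦ, hyx⟩ := hpre s x hx hxs (h.boundary_subset hxS)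
      refine ⟨y, ⟨hy, ?_⟩, hyx⟩
      change y 0 = 0
      rw [← hyperplaneEmb_zero, ← hι, hyΦ]
      exact ((hf x hx).2.1 hxS).2

theorem volume_hyperplane (m : ℕ) : volume {y : Par (m + 1) | y 0 = 0} = 0 := by
  have h : ({y : Par (m + 1) | y 0 = 0} : Set _) =
      (LinearMap.ker (EuclideanSpace.proj (𝕜 := ℝ) (0 : Fin (m + 1))).toLinearMap :
        Submodule ℝ (Par (m + 1))) := by
    ext y; simp
  rw [h]
  refine Measure.addHaar_submodule _ _ fun htop => ?_
  have : (EuclideanSpace.single (0 : Fin (m + 1)) (1 : ℝ)) ∈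
      LinearMap.ker (EuclideanSpace.proj (𝕜 := ℝ) (0 : Fin (m + 1))).toLinearMap := by
    rw [htop]; trivial
  simp at this

/-- The surface gradient of zero vanishes almost everywhere. -/
theorem HasSurfaceGradient.ae_eq_zero {m : ℕ} {Γ S : Set (Amb (m + 1))}
    (hΓ : IsHypersurfaceWithBoundary Γ S) {f : Amb (m + 1) → ℝ} {G : Amb (m + 1) → Amb (m + 1)}
    (H : HasSurfaceGradient Γ S f G) (hf : f =ᵐ[surfaceMeasure (m + 1) Γ] 0)
    (hm : MeasurableSet Γ) : G =ᵐ[surfaceMeasure (m + 1) Γ] 0 := by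
  refine (ae_restrict_iff' hm).2 (ae_iff.2 ?_)
  refine measure_null_of_locally_null _ fun p hp => ?_
  have hpΓ : p ∈ Γ := by
    by_contra hh
    exact hp fun h' => absurd h' hh
  obtain ⟨ψ, y₀, r, L, K, W, Z, hc⟩ := hΓ.exists_chart hpΓ
  obtain ⟨N, hN, hcov⟩ := hc.covers
  refine ⟨{x | ¬ (x ∈ Γ → G x = 0)} ∩ N, Filter.inter_mem self_mem_nhdsWithin
    (mem_nhdsWithin_of_mem_nhds hN), ?_⟩
  have h1 := (ae_restrict_iff' hc.isLocalParam.isOpen.measurableSet).1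
    (H.comp_eq_zero hf hc.isLocalParam)
  -- In the chart, `G` can be nonzero only on a null subset of `W` or on the edge `y 0 = 0`, which
  -- is Lebesgue null. The Lipschitz map `ψ` carries null sets to null sets of the surface measure.
  set A : Set (Par (m + 1)) := ({y | ¬ (y ∈ W → G (ψ y) = 0)} ∪ {y | y 0 = 0}) ∩
    Metric.ball y₀ r with hA
  have hA0 : volume A = 0 :=
    measure_mono_null inter_subset_left (measure_union_null (ae_iff.1 h1) (volume_hyperplane m))
  have h2 := (hc.lipschitz.mono (s := A) inter_subset_right).euclideanHausdorffMeasure_image_le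
    (m + 1)
  rw [EuclideanSpace.euclideanHausdorffMeasure_eq_volume, hA0, mul_zero] at h2
  refine measure_mono_null ?_ (le_antisymm h2 zero_le)
  rintro x ⟨hx, hxN⟩
  have hx' : x ∈ Γ ∧ G x ≠ 0 := by simpa using hx
  obtain ⟨y, hy, rfl⟩ := hcov ⟨hx'.1, hxN⟩
  refine ⟨y, ⟨?_, ?_⟩, rfl⟩
  · rcases hy with hy | hy
    · exact Or.inl fun hh => hx'.2 (hh hy)
    · exact Or.inr (hc.null hy.1)
  · rcases hy with hy | hy
    · exact hc.subset_ball hy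
    · exact hy.2

/-! ### The trace inequality -/

/-- The identification `ℝ × ℝ^m ≃ ℝ^{m+1}`, `(s, y) ↦ (s, y)`. -/
noncomputable def consEquiv (m : ℕ) : ℝ × Par m ≃ᵐ Par (m + 1) :=
  ((MeasurableEquiv.refl ℝ).prodCongr (MeasurableEquiv.toLp 2 (Fin m → ℝ)).symm).trans
    ((MeasurableEquiv.piFinSuccAbove (fun _ : Fin (m + 1) => ℝ) 0).symm.trans
      (MeasurableEquiv.toLp 2 (Fin (m + 1) → ℝ)))

theorem consEquiv_zero (m : ℕ) (z : ℝ × Par m) : consEquiv m z 0 = z.1 := by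
  simp [consEquiv]
  rfl

theorem consEquiv_succ (m : ℕ) (z : ℝ × Par m) (i : Fin m) : consEquiv m z i.succ = z.2 i := by
  simp [consEquiv]
  rfl

theorem measurePreserving_consEquiv (m : ℕ) : MeasurePreserving (consEquiv m) volume volume := by
  have h1 : MeasurePreserving ((MeasurableEquiv.refl ℝ).prodCongr
      (MeasurableEquiv.toLp 2 (Fin m → ℝ)).symm) (volume : Measure (ℝ × Par m)) volume :=
    (MeasurePreserving.id volume).prod (PiLp.volume_preserving_ofLp (Fin m))
  have h2 := (volume_preserving_piFinSuccAbove (fun _ : Fin (m + 1) => ℝ) 0).symm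
  exact (PiLp.volume_preserving_toLp (Fin (m + 1))).comp (h2.comp h1)

theorem consEquiv_eq_add (m : ℕ) (s : ℝ) (y : Par m) :
    consEquiv m (s, y) = consEquiv m (0, y) + s • EuclideanSpace.single 0 1 := by
  ext i
  refine Fin.cases ?_ (fun j => ?_) i
  · simp [consEquiv_zero]
  · simp [consEquiv_succ]

theorem dist_consEquiv_zero (m : ℕ) (y z : Par m) :
    dist (consEquiv m (0, y)) (consEquiv m (0, z)) = dist y z := by
  rw [EuclideanSpace.dist_eq, EuclideanSpace.dist_eq, Fin.sum_univ_succ]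
  simp [consEquiv_zero, consEquiv_succ]

theorem continuous_consEquiv (m : ℕ) : Continuous (consEquiv m) := by
  have h : ⇑(consEquiv m) = fun z : ℝ × Par m =>
      consEquiv m (0, z.2) + z.1 • EuclideanSpace.single 0 1 :=
    funext fun z => consEquiv_eq_add m z.1 z.2
  have h0 : Continuous fun y : Par m => consEquiv m (0, y) :=
    (Isometry.of_dist_eq (dist_consEquiv_zero m)).continuous
  rw [h]
  exact (h0.comp continuous_snd).add (continuous_fst.smul continuous_const)

theorem exists_consEquiv_zero_eq {m : ℕ} {y : Par (m + 1)} (hy : y 0 = 0) :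
    ∃ z, consEquiv m (0, z) = y := by
  refine ⟨WithLp.toLp 2 fun i => y i.succ, ?_⟩
  ext i
  refine Fin.cases ?_ (fun j => ?_) i
  · simp [consEquiv_zero, hy]
  · simp [consEquiv_succ]

theorem ENNReal.add_sq_le_four_mul (a b : ℝ≥0∞) : (a + b) ^ 2 ≤ 4 * (a ^ 2 + b ^ 2) := by
  have h1 : a + b ≤ 2 * max a b := by
    rw [two_mul]; exact add_le_add (le_max_left _ _) (le_max_right _ _)
  calc (a + b) ^ 2 ≤ (2 * max a b) ^ 2 := pow_le_pow_left' h1 2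
    _ = 4 * max a b ^ 2 := by rw [mul_pow]; norm_num
    _ ≤ 4 * (a ^ 2 + b ^ 2) := by
      refine mul_le_mul_right ?_ _
      rcases max_choice a b with h | h <;> rw [h]
      · exact le_self_add
      · exact le_add_self

theorem sq_eLpNorm_two {α F : Type*} [MeasurableSpace α] {μ : Measure α} [NormedAddCommGroup F]
    (f : α → F) : eLpNorm f 2 μ ^ 2 = ∫⁻ x, ‖f x‖ₑ ^ 2 ∂μ := by
  rw [eLpNorm_eq_lintegral_rpow_enorm_toReal (by simp) (by simp)]
  simp only [ENNReal.toReal_ofNat, ENNReal.rpow_ofNat]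
  rw [← ENNReal.rpow_natCast, ← ENNReal.rpow_mul]
  norm_num

/-- A one-dimensional trace inequality. -/
theorem enorm_sq_le_of_hasDerivAt {h k : ℝ → ℝ} {δ s : ℝ} (hs : s ∈ Ioo 0 δ)
    (hd : ∀ t ∈ Ico 0 δ, HasDerivAt h (k t) t) (hk : ContinuousOn k (Ico 0 δ)) :
    ‖h 0‖ₑ ^ 2 ≤ 4 * (‖h s‖ₑ ^ 2 + ENNReal.ofReal δ * ∫⁻ t in Ioo 0 δ, ‖k t‖ₑ ^ 2) := by
  have hsub : Icc 0 s ⊆ Ico 0 δ := fun t ht => ⟨ht.1, ht.2.trans_lt hs.2⟩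
  have hk' : ContinuousOn k (Icc 0 s) := hk.mono hsub
  have h1 : ∫ t in (0 : ℝ)..s, k t = h s - h 0 := by
    refine intervalIntegral.integral_eq_sub_of_hasDerivAt (fun t ht => hd t (hsub ?_)) ?_
    · rwa [uIcc_of_le hs.1.le] at ht
    · exact ContinuousOn.intervalIntegrable (by rwa [uIcc_of_le hs.1.le])
  have h2 : ‖h 0‖ₑ ≤ ‖h s‖ₑ + ‖∫ t in (0 : ℝ)..s, k t‖ₑ := by
    have : h 0 = h s - ∫ t in (0 : ℝ)..s, k t := by rw [h1]; ring
    rw [this]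
    exact enorm_sub_le
  have hm : AEStronglyMeasurable k (volume.restrict (Ioc 0 s)) :=
    (hk'.mono Ioc_subset_Icc_self).aestronglyMeasurable measurableSet_Ioc
  have h3 : ‖∫ t in (0 : ℝ)..s, k t‖ₑ ^ 2 ≤ ENNReal.ofReal δ * ∫⁻ t in Ioo 0 δ, ‖k t‖ₑ ^ 2 := by
    rw [intervalIntegral.integral_of_le hs.1.le]
    have h4 : ‖∫ t in Ioc 0 s, k t‖ₑ ≤ eLpNorm k 2 (volume.restrict (Ioc 0 s)) *
        ENNReal.ofReal s ^ (1 / 2 : ℝ) := by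
      refine (enorm_integral_le_lintegral_enorm _).trans ?_
      rw [← eLpNorm_one_eq_lintegral_enorm]
      refine (eLpNorm_le_eLpNorm_mul_rpow_measure_univ one_le_two hm).trans_eq ?_
      congr 1
      rw [Measure.restrict_apply_univ, Real.volume_Ioc, sub_zero]
      norm_num
    refine (pow_le_pow_left' h4 2).trans ?_
    rw [mul_pow, sq_eLpNorm_two, ← ENNReal.rpow_natCast (_ ^ (1 / 2 : ℝ)), ← ENNReal.rpow_mul,
      mul_comm]
    have e : ENNReal.ofReal s ^ (1 / 2 * ((2 : ℕ) : ℝ)) = ENNReal.ofReal s := by norm_num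
    rw [e]
    exact mul_le_mul' (ENNReal.ofReal_le_ofReal hs.2.le)
      (lintegral_mono_set fun t ht => ⟨ht.1, ht.2.trans_lt hs.2⟩)
  refine (pow_le_pow_left' h2 2).trans ((ENNReal.add_sq_le_four_mul _ _).trans ?_)
  gcongr

/-- The pointwise bound for `h 0` is averaged over the base point `s ∈ (0,δ)`. The factor `1 + δ²`
is a common majorant of the coefficients of the two terms. -/
theorem lintegral_slice_le {h k : ℝ → ℝ} {δ : ℝ}
    (hd : ∀ t ∈ Ico 0 δ, HasDerivAt h (k t) t) (hk : ContinuousOn k (Ico 0 δ)) :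
    ENNReal.ofReal δ * ‖h 0‖ₑ ^ 2 ≤
      4 * (1 + ENNReal.ofReal δ ^ 2) * ∫⁻ t in Ioo 0 δ, (‖h t‖ₑ ^ 2 + ‖k t‖ₑ ^ 2) := by
  set I := ∫⁻ t in Ioo 0 δ, ‖k t‖ₑ ^ 2 with hI
  have hv : volume (Ioo 0 δ) = ENNReal.ofReal δ := by rw [Real.volume_Ioo, sub_zero]
  have h1 : ENNReal.ofReal δ * ‖h 0‖ₑ ^ 2 ≤
      ∫⁻ s in Ioo 0 δ, 4 * (‖h s‖ₑ ^ 2 + ENNReal.ofReal δ * I) := by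
    have e : ENNReal.ofReal δ * ‖h 0‖ₑ ^ 2 = ∫⁻ _ in Ioo 0 δ, ‖h 0‖ₑ ^ 2 := by
      rw [setLIntegral_const, hv, mul_comm]
    rw [e]
    refine setLIntegral_mono' measurableSet_Ioo fun s hs => ?_
    exact enorm_sq_le_of_hasDerivAt hs hd hk
  rw [lintegral_const_mul' _ _ (by simp), lintegral_add_right _ measurable_const,
    setLIntegral_const, hv] at h1
  refine h1.trans ?_
  rw [mul_assoc 4]
  refine mul_le_mul_right ?_ _
  calc (∫⁻ s in Ioo 0 δ, ‖h s‖ₑ ^ 2) + ENNReal.ofReal δ * I * ENNReal.ofReal δ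
      ≤ (1 + ENNReal.ofReal δ ^ 2) * (∫⁻ s in Ioo 0 δ, ‖h s‖ₑ ^ 2) +
        (1 + ENNReal.ofReal δ ^ 2) * I := by
        refine add_le_add (le_mul_of_one_le_left zero_le le_self_add) ?_
        rw [mul_right_comm, ← sq]
        exact mul_le_mul_left le_add_self _
    _ = (1 + ENNReal.ofReal δ ^ 2) * ((∫⁻ s in Ioo 0 δ, ‖h s‖ₑ ^ 2) + I) := by ring
    _ ≤ _ := mul_le_mul_right (le_lintegral_add _ _) _

/-- A Lipschitz map increases `m`-dimensional Hausdorff measure at most by `L ^ m`. This bounds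
surface integrals by parameter integrals; `map_le_smul_of_volume_le` gives the converse direction.
-/
theorem restrict_le_smul_map {m : ℕ} {X : Type*} [EMetricSpace X] [MeasurableSpace X] [BorelSpace X]
    {L : NNReal} {ψ : Par m → X} {D : Set (Par m)} (hD : MeasurableSet D)
    (hψ : LipschitzOnWith L ψ D) (hm : AEMeasurable ψ (volume.restrict D)) {A : Set X}
    (hA : A ⊆ ψ '' D) :
    (Measure.euclideanHausdorffMeasure m).restrict A ≤
      (L : ℝ≥0∞) ^ m • (volume.restrict D).map ψ := by
  refine Measure.le_iff.2 fun B hB => ?_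
  rw [Measure.restrict_apply hB, Measure.smul_apply, Measure.map_apply_of_aemeasurable hm hB,
    Measure.restrict_apply' hD, smul_eq_mul]
  have h1 : B ∩ A ⊆ ψ '' (ψ ⁻¹' B ∩ D) := by
    rintro x ⟨hxB, hxA⟩
    obtain ⟨y, hy, rfl⟩ := hA hxA
    exact ⟨y, ⟨hxB, hy⟩, rfl⟩
  refine (measure_mono h1).trans ?_
  have h2 := (hψ.mono (s := ψ ⁻¹' B ∩ D) inter_subset_right).euclideanHausdorffMeasure_image_le m
  rwa [EuclideanSpace.euclideanHausdorffMeasure_eq_volume] at h2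

/-- The trace inequality near a boundary point. -/
theorem IsChartAt.trace_le {m : ℕ} {Γ S : Set (Amb (m + 1))} {p : Amb (m + 1)}
    {ψ : Par (m + 1) → Amb (m + 1)} {y₀ : Par (m + 1)} {r : ℝ} {L K : NNReal}
    {W Z : Set (Par (m + 1))} (hc : IsChartAt Γ S p ψ y₀ r L K W Z) (hp : p ∈ S) :
    ∃ N ∈ 𝓝 p, ∃ C : ℝ≥0∞, C ≠ ⊤ ∧ ∀ (u : H1 Γ S) (g : Amb (m + 1) → ℝ), ContDiff ℝ 1 g →
      H1.fn u =ᵐ[surfaceMeasure (m + 1) Γ] g →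
      ∫⁻ x in S ∩ N, ‖g x‖ₑ ^ 2 ∂(Measure.euclideanHausdorffMeasure m) ≤
        C * ∫⁻ x, (‖H1.fn u x‖ₑ ^ 2 + ‖H1.grad u x‖ₑ ^ 2) ∂(surfaceMeasure (m + 1) Γ) := by
  obtain ⟨hy₀, hW, hcov⟩ := hc.boundary hp
  -- With half the radius, the box of height `δ` over the `δ`-ball `D` in the edge stays inside the
  -- ball of radius `r`.
  set δ := r / 2 with hδ
  have hr := hc.pos
  have hδ0 : 0 < δ := by positivity
  obtain ⟨N, hN, hSN⟩ := hcov δ hδ0 (by linarith)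
  obtain ⟨z₀, hz₀⟩ := exists_consEquiv_zero_eq hy₀
  set e := consEquiv m with he
  set D := Metric.ball z₀ δ with hD
  set v : Par (m + 1) := EuclideanSpace.single 0 1 with hv
  have hvn : ‖v‖ = 1 := by simp [hv]
  have hball : ∀ s ∈ Ico 0 δ, ∀ y ∈ D, e (s, y) ∈ Metric.ball y₀ r := by
    intro s hs y hy
    rw [Metric.mem_ball, he, consEquiv_eq_add, ← hz₀]
    calc dist (consEquiv m (0, y) + s • v) (consEquiv m (0, z₀))
        ≤ dist (consEquiv m (0, y) + s • v) (consEquiv m (0, y)) +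
          dist (consEquiv m (0, y)) (consEquiv m (0, z₀)) := dist_triangle _ _ _
      _ < δ + δ := by
          refine add_lt_add ?_ ?_
          · rw [dist_eq_norm, add_sub_cancel_left, norm_smul, hvn, mul_one, Real.norm_eq_abs,
              abs_of_nonneg hs.1]
            exact hs.2
          · rw [dist_consEquiv_zero]; exact hy
      _ = r := by rw [hδ]; ring
  have h0 : (0 : ℝ) ∈ Ico 0 δ := ⟨le_rfl, hδ0⟩
  set ψ₀ : Par m → Amb (m + 1) := fun y => ψ (e (0, y)) with hψ₀
  have hψ₀L : LipschitzOnWith L ψ₀ D := by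
    refine LipschitzOnWith.of_dist_le_mul fun a ha b hb => ?_
    rw [← dist_consEquiv_zero m a b]
    exact hc.lipschitz.dist_le_mul _ (hball 0 h0 a ha) _ (hball 0 h0 b hb)
  have hψ₀m : AEMeasurable ψ₀ (volume.restrict D) :=
    hψ₀L.continuousOn.aemeasurable Metric.isOpen_ball.measurableSet
  have hcover : S ∩ N ⊆ ψ₀ '' D := by
    intro x hx
    obtain ⟨y, ⟨hy, hy0⟩, rfl⟩ := hSN hx
    obtain ⟨z, rfl⟩ := exists_consEquiv_zero_eq hy0
    refine ⟨z, ?_, rfl⟩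
    rw [Metric.mem_ball, ← hz₀, dist_consEquiv_zero] at hy
    exact hy
  have hWo : IsOpen W := hc.isLocalParam.isOpen
  have hQW : e '' (Ioo 0 δ ×ˢ D) ⊆ W := by
    rintro _ ⟨⟨s, y⟩, ⟨hs, hy⟩, rfl⟩
    rw [hW]
    refine ⟨hball s (Ioo_subset_Ico_self hs) y hy, ?_⟩
    change 0 < e (s, y) 0
    rw [he, consEquiv_zero]
    exact hs.1
  have hψm : AEMeasurable ψ (volume.restrict W) :=
    hc.isLocalParam.contDiffOn.continuousOn.aemeasurable hWo.measurableSet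
  have hmap := map_le_smul_of_volume_le hWo.measurableSet hψm fun B hB =>
    volume_inter_preimage_le (A := W) (Γ := Γ) (fun a ha b hb => hc.antilipschitz a
      (hc.subset_ball ha) b (hc.subset_ball hb)) (fun a ha => (hc.isLocalParam.mapsTo ha).1) hB
  set C₁ : ℝ≥0∞ := (ENNReal.ofReal δ)⁻¹ * (4 * (1 + ENNReal.ofReal δ ^ 2)) with hC₁
  have hδne : ENNReal.ofReal δ ≠ 0 := by simpa using hδ0
  have hC₁t : C₁ ≠ ⊤ := by
    refine ENNReal.mul_ne_top (ENNReal.inv_ne_top.2 hδne) ?_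
    finiteness
  -- One factor for each step: `L ^ m` for passing from `S` to `D`, `C₁` for the one-dimensional
  -- inequality on the normal lines, `1 + L ^ 2` for estimating the coordinate derivative by the
  -- surface gradient, and `K ^ (m + 1)` for returning from `W` to `Γ`.
  set C : ℝ≥0∞ := (L : ℝ≥0∞) ^ m * (C₁ * ((1 + (L : ℝ≥0∞) ^ 2) * (K : ℝ≥0∞) ^ (m + 1))) with hC
  refine ⟨N, hN, C, by rw [hC]; finiteness, fun u g hg hug => ?_⟩
  set k : Par (m + 1) → ℝ := fun y => fderiv ℝ (fun z => g (ψ z)) y v with hk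
  have hgd : ContDiffOn ℝ 1 (fun z => g (ψ z)) (Metric.ball y₀ r) :=
    hg.comp_contDiffOn (hc.contDiffOn.of_le (by norm_num))
  have hkc : ContinuousOn k (Metric.ball y₀ r) :=
    (hgd.continuousOn_fderiv_of_isOpen Metric.isOpen_ball le_rfl).clm_apply continuousOn_const
  set F : Par (m + 1) → ℝ≥0∞ := fun y => ‖g (ψ y)‖ₑ ^ 2 + ‖k y‖ₑ ^ 2 with hF
  have hFc : ContinuousOn F (Metric.ball y₀ r) := by
    have a1 : ContinuousOn (fun y => ‖g (ψ y)‖ₑ ^ 2) (Metric.ball y₀ r) :=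
      (ENNReal.continuous_pow 2).comp_continuousOn (continuous_enorm.comp_continuousOn hgd.continuousOn)
    have a2 : ContinuousOn (fun y => ‖k y‖ₑ ^ 2) (Metric.ball y₀ r) :=
      (ENNReal.continuous_pow 2).comp_continuousOn (continuous_enorm.comp_continuousOn hkc)
    exact a1.add a2
  have step1 : ∫⁻ x in S ∩ N, ‖g x‖ₑ ^ 2 ∂(Measure.euclideanHausdorffMeasure m) ≤
      (L : ℝ≥0∞) ^ m * ∫⁻ y in D, ‖g (ψ₀ y)‖ₑ ^ 2 := by
    refine (lintegral_mono' (restrict_le_smul_map Metric.isOpen_ball.measurableSet hψ₀L hψ₀m hcover)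
      le_rfl).trans_eq ?_
    rw [lintegral_smul_measure, lintegral_map' (by
      exact (hg.continuous.measurable.enorm.pow_const 2).aemeasurable) hψ₀m, smul_eq_mul]
  -- On the line through `y` orthogonal to the edge, `g ∘ ψ` is `C¹` up to height `0`.
  have step2 : ∀ y ∈ D, ‖g (ψ₀ y)‖ₑ ^ 2 ≤ C₁ * ∫⁻ s in Ioo 0 δ, F (e (s, y)) := by
    intro y hy
    have hd : ∀ t ∈ Ico 0 δ, HasDerivAt (fun s => g (ψ (e (s, y)))) (k (e (t, y))) t := by
      intro t ht
      have d1 := ((hgd.contDiffAt (Metric.isOpen_ball.mem_nhds (hball t ht y hy))).differentiableAt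
        (by norm_num)).hasFDerivAt
      have d2 : HasDerivAt (fun s => e (s, y)) v t := by
        have : (fun s => e (s, y)) = fun s => e (0, y) + s • v :=
          funext fun s => consEquiv_eq_add m s y
        rw [this]
        simpa using ((hasDerivAt_id t).smul_const v).const_add (e (0, y))
      exact d1.comp_hasDerivAt t d2
    have hkc' : ContinuousOn (fun t => k (e (t, y))) (Ico 0 δ) :=
      hkc.comp ((continuous_consEquiv m).comp (by fun_prop : Continuous fun t : ℝ => (t, y))).continuousOn
        fun t ht => hball t ht y hy
    have h1 := lintegral_slice_le hd hkc'
    rw [hC₁, mul_assoc, ← ENNReal.div_eq_inv_mul, ENNReal.le_div_iff_mul_le (Or.inl hδne)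
      (Or.inl ENNReal.ofReal_ne_top), mul_comm]
    exact h1
  have hFm : AEMeasurable (fun z => F (e z))
      ((volume.restrict (Ioo 0 δ)).prod (volume.restrict D)) := by
    rw [Measure.prod_restrict]
    refine ContinuousOn.aemeasurable (hFc.comp (continuous_consEquiv m).continuousOn fun z hz => ?_)
      (measurableSet_Ioo.prod Metric.isOpen_ball.measurableSet)
    exact hball z.1 (Ioo_subset_Ico_self hz.1) z.2 hz.2
  -- Integrating the line estimates over `D` and using Tonelli gives an integral over a box
  -- contained in `W`.
  have step3 : ∫⁻ y in D, ‖g (ψ₀ y)‖ₑ ^ 2 ≤ C₁ * ∫⁻ y in W, F y := by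
    refine (setLIntegral_mono' Metric.isOpen_ball.measurableSet step2).trans ?_
    rw [lintegral_const_mul' _ _ hC₁t, ← lintegral_prod_symm _ hFm, Measure.prod_restrict]
    refine mul_le_mul_right ?_ _
    refine le_trans (le_of_eq ?_) (lintegral_mono_set hQW)
    exact (measurePreserving_consEquiv m).setLIntegral_comp_emb (consEquiv m).measurableEmbedding F _
  set Ψ : Amb (m + 1) → ℝ≥0∞ := fun x => ‖H1.fn u x‖ₑ ^ 2 + ‖H1.grad u x‖ₑ ^ 2 with hΨ
  have hΨm : Measurable Ψ :=
    ((Lp.stronglyMeasurable _).measurable.enorm.pow_const 2).add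
      ((Lp.stronglyMeasurable _).measurable.enorm.pow_const 2)
  have hu : HasSurfaceGradient Γ S (H1.fn u) (H1.grad u) := u.2
  -- Almost everywhere in `W` the derivative of `g ∘ ψ` along `v` is `⟨∇u ∘ ψ, Dψ v⟩`, where `‖Dψ‖ ≤
  -- L` and `v` is a unit vector.
  have step4 : ∫⁻ y in W, F y ≤ (1 + (L : ℝ≥0∞) ^ 2) * ∫⁻ y in W, Ψ (ψ y) := by
    rw [← lintegral_const_mul' _ _ (by finiteness)]
    refine lintegral_mono_ae ?_
    filter_upwards [hu.fderiv_comp_eq hc.isLocalParam hg hug v, hc.isLocalParam.ae_comp hug,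
      ae_restrict_mem hWo.measurableSet] with y h1 h2 hy
    have h3 : ‖fderiv ℝ ψ y‖ ≤ L := norm_fderiv_le_of_lipschitzOn ℝ
      (Metric.isOpen_ball.mem_nhds (hc.subset_ball hy)) hc.lipschitz
    have h4 : ‖k y‖ ≤ L * ‖H1.grad u (ψ y)‖ := by
      rw [hk]
      simp only
      rw [h1]
      refine (norm_inner_le_norm _ _).trans ?_
      rw [mul_comm]
      refine mul_le_mul_of_nonneg_right (((fderiv ℝ ψ y).le_opNorm v).trans ?_) (norm_nonneg _)
      rwa [hvn, mul_one]
    have h5 : ‖k y‖ₑ ≤ L * ‖H1.grad u (ψ y)‖ₑ := by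
      have h6 : ‖k y‖₊ ≤ L * ‖H1.grad u (ψ y)‖₊ := h4
      rw [enorm_eq_nnnorm, enorm_eq_nnnorm]
      exact_mod_cast h6
    simp only [hF, hΨ]
    rw [← h2, mul_add]
    refine add_le_add (le_mul_of_one_le_left zero_le le_self_add) ?_
    refine (pow_le_pow_left' h5 2).trans ?_
    rw [mul_pow]
    exact mul_le_mul_left le_add_self _
  have step5 : ∫⁻ y in W, Ψ (ψ y) ≤
      (K : ℝ≥0∞) ^ (m + 1) * ∫⁻ x, Ψ x ∂(surfaceMeasure (m + 1) Γ) := by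
    rw [← lintegral_map' hΨm.aemeasurable hψm, ← smul_eq_mul, ← lintegral_smul_measure]
    exact lintegral_mono' hmap le_rfl
  calc _ ≤ (L : ℝ≥0∞) ^ m * (C₁ * ((1 + (L : ℝ≥0∞) ^ 2) * ((K : ℝ≥0∞) ^ (m + 1) *
        ∫⁻ x, Ψ x ∂(surfaceMeasure (m + 1) Γ)))) := by
        refine step1.trans (mul_le_mul_right (step3.trans (mul_le_mul_right (step4.trans
          (mul_le_mul_right step5 _)) _)) _)
    _ = _ := by rw [hC]; ring

/-- The trace inequality for `C¹` functions. -/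
theorem IsHypersurfaceWithBoundary.exists_trace_le {m : ℕ} {Γ S : Set (Amb (m + 1))}
    (h : IsHypersurfaceWithBoundary Γ S) (hS : IsCompact S) :
    ∃ C : ℝ, ∀ q ∈ restrictionGraph Γ S, ‖q.2‖ ≤ C * ‖q.1‖ := by
  -- The local estimates are summed over a finite cover of the compact set `S`.
  obtain ⟨C, hC, hle⟩ := hS.induction_on (p := fun s => ∃ C : ℝ≥0∞, C ≠ ⊤ ∧
    ∀ (u : H1 Γ S) (g : Amb (m + 1) → ℝ), ContDiff ℝ 1 g →
      H1.fn u =ᵐ[surfaceMeasure (m + 1) Γ] g →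
      ∫⁻ x in s, ‖g x‖ₑ ^ 2 ∂(Measure.euclideanHausdorffMeasure m) ≤
        C * ∫⁻ x, (‖H1.fn u x‖ₑ ^ 2 + ‖H1.grad u x‖ₑ ^ 2) ∂(surfaceMeasure (m + 1) Γ))
    ⟨0, by simp, by simp⟩
    (by
      rintro s t hst ⟨C, hC, h⟩
      exact ⟨C, hC, fun u g hg hug => (lintegral_mono_set hst).trans (h u g hg hug)⟩)
    (by
      rintro s t ⟨C, hC, h⟩ ⟨C', hC', h'⟩
      refine ⟨C + C', ENNReal.add_ne_top.2 ⟨hC, hC'⟩, fun u g hg hug => ?_⟩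
      rw [add_mul]
      exact (lintegral_union_le _ _ _).trans (add_le_add (h u g hg hug) (h' u g hg hug)))
    (by
      intro p hp
      obtain ⟨ψ, y₀, r, L, K, W, Z, hc⟩ := h.exists_chart (h.boundary_subset hp)
      obtain ⟨N, hN, hNC⟩ := hc.trace_le hp
      exact ⟨S ∩ N, Filter.inter_mem self_mem_nhdsWithin (mem_nhdsWithin_of_mem_nhds hN), hNC⟩)
  refine ⟨√C.toReal, ?_⟩
  rintro ⟨u, τ⟩ ⟨g, hg, hu, hτ⟩
  have h1 := hle u g hg hu
  have hτ' : τ =ᵐ[surfaceMeasure m S] g := hτ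
  have h2 : eLpNorm τ 2 (surfaceMeasure m S) ^ 2 ≤
      C * (eLpNorm (H1.fn u) 2 (surfaceMeasure (m + 1) Γ) ^ 2 +
        eLpNorm (H1.grad u) 2 (surfaceMeasure (m + 1) Γ) ^ 2) := by
    rw [eLpNorm_congr_ae hτ', sq_eLpNorm_two, sq_eLpNorm_two, sq_eLpNorm_two,
      ← lintegral_add_left ((Lp.stronglyMeasurable _).measurable.enorm.pow_const 2)]
    exact h1
  have h3 : ‖u‖ ^ 2 = ‖H1.fn u‖ ^ 2 + ‖H1.grad u‖ ^ 2 := WithLp.prod_norm_sq_eq_of_L2 u.1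
  have ht : ∀ {F : Type} [NormedAddCommGroup F] (f : SurfL2 (m + 1) Γ F),
      eLpNorm f 2 (surfaceMeasure (m + 1) Γ) ^ 2 ≠ ⊤ := fun f =>
    ENNReal.pow_ne_top (Lp.eLpNorm_ne_top f)
  have h4 := ENNReal.toReal_mono (ENNReal.mul_ne_top hC (ENNReal.add_ne_top.2 ⟨ht _, ht _⟩)) h2
  rw [ENNReal.toReal_mul, ENNReal.toReal_add (ht _) (ht _), ENNReal.toReal_pow, ENNReal.toReal_pow,
    ENNReal.toReal_pow] at h4
  have h5 : ‖τ‖ ^ 2 ≤ C.toReal * ‖u‖ ^ 2 := by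
    rw [h3, Lp.norm_def, Lp.norm_def, Lp.norm_def]
    exact h4
  change ‖τ‖ ≤ _ * ‖u‖
  rw [← sq_le_sq₀ (norm_nonneg _) (by positivity), mul_pow, Real.sq_sqrt ENNReal.toReal_nonneg]
  exact h5

/-! ### The coupled system reduced to one degenerate equation -/

namespace TripleJunctionCluster

section Coupled

variable {T : ℝ} {V : Type} [NormedAddCommGroup V] [InnerProductSpace ℝ V] [CompleteSpace V]

/-- A coercive bounded operator has a bounded right inverse. -/
theorem exists_right_inverse_of_coercive (A : V →L[ℝ] V) {c : ℝ} (hc : 0 < c)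
    (hA : ∀ x, c * ‖x‖ ^ 2 ≤ ⟪A x, x⟫) : ∃ R : V →L[ℝ] V, ∀ x, A (R x) = x := by
  have hco : IsCoercive ((innerSL ℝ).comp A : V →L[ℝ] V →L[ℝ] ℝ) :=
    ⟨c, hc, fun x => by
      have := hA x
      rw [sq, ← mul_assoc] at this
      exact this⟩
  refine ⟨(hco.continuousLinearEquivOfBilin.symm : V →L[ℝ] V), fun x => ?_⟩
  refine ext_inner_right ℝ fun y => ?_
  have := hco.continuousLinearEquivOfBilin_apply (hco.continuousLinearEquivOfBilin.symm x) y
  rw [ContinuousLinearEquiv.apply_symm_apply] at this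
  rw [this]
  rfl

omit [CompleteSpace V] in
theorem L2T.compLpL_eq_iff {W : Type} [NormedAddCommGroup W] [NormedSpace ℝ W]
    (A : V →L[ℝ] W) (f : L2T T V) (g : L2T T W) :
    A.compLpL 2 _ f = g ↔ ∀ᵐ t ∂(volume.restrict (Ioo (0 : ℝ) T)), A (f t) = g t := by
  constructor
  · rintro rfl
    filter_upwards [A.coeFn_compLpL f] with t h using h.symm
  · intro h
    refine Lp.ext ?_
    filter_upwards [A.coeFn_compLpL f, h] with t h1 h2
    rw [h1, h2]

omit [CompleteSpace V] in
theorem eq_zero_of_coercive {A : V →L[ℝ] V} {c : ℝ} (hc : 0 < c)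
    (hA : ∀ x, c * ‖x‖ ^ 2 ≤ ⟪A x, x⟫) {x : V} (h : A x = 0) : x = 0 := by
  have := hA x
  rw [h, inner_zero_left] at this
  have h2 : ‖x‖ ^ 2 ≤ 0 := by
    by_contra hh
    push Not at hh
    nlinarith
  exact norm_eq_zero.1 (pow_eq_zero_iff two_ne_zero |>.1 (le_antisymm h2 (by positivity)))

/-- Well-posedness of the system `(B u)' + A₁ v = l`, `B v = A₂ u`, `u(0) = 0`. -/
theorem coupled_wellposed (hT : 0 ≤ T) (A₁ A₂ B : V →L[ℝ] V) {c : ℝ} (hc : 0 < c)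
    (hA₁ : ∀ x, c * ‖x‖ ^ 2 ≤ ⟪A₁ x, x⟫) (hA₂ : ∀ x, c * ‖x‖ ^ 2 ≤ ⟪A₂ x, x⟫)
    (hs : ∀ x y, ⟪A₂ x, y⟫ = ⟪x, A₂ y⟫) (hB : ∀ x y, ⟪B x, y⟫ = ⟪x, B y⟫)
    (hBi : ∀ x, B x = 0 → x = 0) :
    ∃ C : ℝ, 0 < C ∧ ∀ l : L2T T V, ∃ u v : L2T T V,
      A₂.compLpL 2 _ u = B.compLpL 2 _ v ∧
      B.compLpL 2 _ u = primitiveL T V (l - A₁.compLpL 2 _ v) ∧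
      (∀ u' v' : L2T T V, A₂.compLpL 2 _ u' = B.compLpL 2 _ v' →
        B.compLpL 2 _ u' = primitiveL T V (l - A₁.compLpL 2 _ v') → u' = u ∧ v' = v) ∧
      ∃ U : ℝ → V, ContinuousOn U (Icc 0 T) ∧
        (∀ᵐ t ∂(volume.restrict (Ioo (0 : ℝ) T)), U t = u t) ∧ U 0 = 0 ∧
        ∀ t ∈ Icc 0 T, ‖U t‖ + ‖u‖ + ‖l - A₁.compLpL 2 _ v‖ + ‖v‖ ≤ C * ‖l‖ := by
  obtain ⟨R, hR⟩ := exists_right_inverse_of_coercive A₂ hc hA₂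
  have hRs : ∀ x y, ⟪R x, y⟫ = ⟪x, R y⟫ := fun x y => by
    rw [← hR y, ← hs, hR, hR]
  -- `K = A₂⁻¹ B` solves the elliptic equation for `u`. Inserting `u = K v` into the parabolic
  -- equation replaces `B u` by `P v` with `P = B A₂⁻¹ B`.
  set K : V →L[ℝ] V := R.comp B with hK
  have hKa : ∀ x, A₂ (K x) = B x := fun x => hR _
  set P : V →L[ℝ] V := B.comp K with hPdef
  have hPa : ∀ x, P x = B (K x) := fun x => rfl
  have hP : ∀ x y, ⟪P x, y⟫ = ⟪x, P y⟫ := fun x y =>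
    (hB (K x) y).trans ((hRs (B x) (B y)).trans (hB x (K y)))
  -- `⟨P x, x⟩ = ⟨K x, B x⟩ = ⟨K x, A₂ K x⟩`: the energy of `v` measured by `P` controls the full
  -- `V`-norm of `u = K v`, which is why `u` is continuous with values in `V`.
  have hPK : ∀ x, c * ‖K x‖ ^ 2 ≤ ⟪P x, x⟫ := fun x => by
    rw [hPa, hB, ← hKa, ← hs]
    exact hA₂ _
  have hP0 : ∀ x, 0 ≤ ⟪P x, x⟫ := fun x => le_trans (by positivity) (hPK x)
  have hPi : ∀ x, P x = 0 → x = 0 := fun x hx => by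
    have h1 : K x = 0 := hBi _ hx
    apply hBi
    rw [← hKa, h1, map_zero]
  have hQ : ∀ x, ‖K x‖ ^ 2 ≤ c⁻¹ * ⟪P x, x⟫ := fun x => by
    rw [inv_mul_eq_div, le_div_iff₀ hc, mul_comm]
    exact hPK x
  have hKL : ∀ v : L2T T V, A₂.compLpL 2 _ (K.compLpL 2 _ v) = B.compLpL 2 _ v := fun v => by
    refine (L2T.compLpL_eq_iff _ _ _).2 ?_
    filter_upwards [K.coeFn_compLpL v, B.coeFn_compLpL v] with t h1 h2
    rw [h1, h2, hKa]
  have hPL : ∀ v : L2T T V, B.compLpL 2 _ (K.compLpL 2 _ v) = P.compLpL 2 _ v := fun v => by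
    refine (L2T.compLpL_eq_iff _ _ _).2 ?_
    filter_upwards [K.coeFn_compLpL v, P.coeFn_compLpL v] with t h1 h2
    rw [h1, h2]
    rfl
  have hinj : ∀ u v : L2T T V, A₂.compLpL 2 _ u = B.compLpL 2 _ v → u = K.compLpL 2 _ v := by
    intro u v h
    refine Lp.ext ?_
    filter_upwards [(L2T.compLpL_eq_iff _ _ _).1 h, B.coeFn_compLpL v, K.coeFn_compLpL v]
      with t h1 h2 h3
    rw [h3]
    refine sub_eq_zero.1 (eq_zero_of_coercive hc hA₂ ?_)
    rw [map_sub, h1, h2, hKa, sub_self]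
  set D := √(c⁻¹ * (2 * c⁻¹)) with hD
  -- The four summands bound `U t`, `u = K v`, `l - A₁ v` and `v`, in this order.
  refine ⟨D + ‖K‖ * c⁻¹ + (1 + ‖A₁‖ * c⁻¹) + c⁻¹, by positivity, fun l => ?_⟩
  obtain ⟨v, hv, hvn⟩ := exists_degenerate_evolution hT A₁ P hc hA₁ hP hP0 l
  have hv' : SolvesEvolution A₁ P v l := hv
  obtain ⟨U, hU1, hU2, hU3, hU4⟩ :=
    hv'.exists_continuous hT hc hA₁ hP hP0 hPi K (inv_nonneg.2 hc.le) hQ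
  have hKn : ‖K.compLpL 2 (volume.restrict (Ioo (0 : ℝ) T)) v‖ ≤ ‖K‖ * (c⁻¹ * ‖l‖) :=
    (K.norm_compLp_le v).trans (mul_le_mul_of_nonneg_left hvn (norm_nonneg _))
  have hAn : ‖A₁.compLpL 2 (volume.restrict (Ioo (0 : ℝ) T)) v‖ ≤ ‖A₁‖ * (c⁻¹ * ‖l‖) :=
    (A₁.norm_compLp_le v).trans (mul_le_mul_of_nonneg_left hvn (norm_nonneg _))
  refine ⟨K.compLpL 2 _ v, v, hKL v, ?_, fun u' v' h1 h2 => ?_, U, hU1, ?_, hU3, fun t ht => ?_⟩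
  · rw [hPL, map_sub, ← hv, add_sub_cancel_right]
  · have h3 := hinj u' v' h1
    rw [h3, hPL, map_sub] at h2
    have h4 : SolvesEvolution A₁ P v' l := by
      rw [SolvesEvolution, h2, sub_add_cancel]
    have h5 := h4.sub hv'
    rw [sub_self, SolvesEvolution, map_zero] at h5
    have h6 := sub_eq_zero.1 (degenerate_evolution_unique hT A₁ P hc hA₁ hP hP0 hPi _ h5)
    exact ⟨by rw [h3, h6], h6⟩
  · filter_upwards [hU2, K.coeFn_compLpL v] with t h1 h2
    rw [h1, h2]
  · have h1 := hU4 t ht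
    have h2 := norm_sub_le l (A₁.compLpL 2 (volume.restrict (Ioo (0 : ℝ) T)) v)
    have h3 : (D + ‖K‖ * c⁻¹ + (1 + ‖A₁‖ * c⁻¹) + c⁻¹) * ‖l‖ =
      D * ‖l‖ + ‖K‖ * (c⁻¹ * ‖l‖) + (‖l‖ + ‖A₁‖ * (c⁻¹ * ‖l‖)) + c⁻¹ * ‖l‖ := by ring
    rw [h3]
    linarith

/-- The primitive of `a` has the weak derivative `a`. -/
theorem integral_deriv_mul_primitive (hT : 0 ≤ T) {φ : ℝ → ℝ} (h1 : ContDiff ℝ ∞ φ)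
    (h3 : tsupport φ ⊆ Ioo 0 T) {a : ℝ → ℝ}
    (ha : Integrable a (volume.restrict (Ioo (0 : ℝ) T))) :
    ∫ t in Ioo 0 T, deriv φ t * ∫ s in (0 : ℝ)..t, a s = -∫ t in Ioo 0 T, φ t * a t := by
  have hai : IntervalIntegrable a volume 0 T :=
    (intervalIntegrable_iff_integrableOn_Ioo_of_le hT).2 ha
  have h := integral_bilin_primitive (ContinuousLinearMap.mul ℝ ℝ) hT
    ((h1.continuous_deriv (by simp)).intervalIntegrable 0 T) hai
  simp only [ContinuousLinearMap.mul_apply', integral_deriv_testFunction h1 h3,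
    eq_zero_of_tsupport_subset_Ioo h3 (t := T) (by simp), zero_mul] at h
  rw [intervalIntegral.integral_of_le hT, intervalIntegral.integral_of_le hT,
    integral_Ioc_eq_integral_Ioo, integral_Ioc_eq_integral_Ioo] at h
  linarith

end Coupled

end TripleJunctionCluster

/-! ### Equivalence of the weak formulation and the integrated system in a Hilbert space -/

namespace TripleJunctionCluster

section WeakSolutions

variable {T : ℝ} {V Y Z : Type} [NormedAddCommGroup V] [InnerProductSpace ℝ V] [CompleteSpace V]
  [NormedAddCommGroup Y] [NormedSpace ℝ Y] [NormedAddCommGroup Z] [NormedSpace ℝ Z]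

/-- The weak formulation of the system `(B u)' = l - A₁ v`, `B v = A₂ u`, `u(0) = 0`, where `B = F ∘ ι`
and `l` is made up of the data `f`, `b₅` and `b₆`. -/
structure IsHilbertWeakSolution (ι : V →L[ℝ] Z) (F : Z →L[ℝ] V) (A₁ A₂ : V →L[ℝ] V)
    (N₅ N₆ : Y →L[ℝ] V) (f : L2T T Z) (b₅ b₆ : L2T T Y) (u v : L2T T V)
    (w : L2T T (StrongDual ℝ V)) : Prop where
  timeDeriv : ∀ φ : ℝ → ℝ, ContDiff ℝ ∞ φ → HasCompactSupport φ → tsupport φ ⊆ Ioo 0 T → ∀ ζ : V,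
    ∫ t in Ioo 0 T, deriv φ t * ⟪F (ι (u t)), ζ⟫ = -∫ t in Ioo 0 T, φ t * w t ζ
  parabolic : ∀ ζ : V, ∀ᵐ t ∂(volume.restrict (Ioo (0 : ℝ) T)),
    w t ζ = -⟪A₁ (v t), ζ⟫ + ⟪N₅ (b₅ t) + N₆ (b₆ t), ζ⟫ + ⟪F (f t), ζ⟫
  elliptic : ∀ ψ : V, ∀ᵐ t ∂(volume.restrict (Ioo (0 : ℝ) T)),
    ⟪F (ι (v t)), ψ⟫ = ⟪A₂ (u t), ψ⟫
  initial : ∃ U : ℝ → Z, ContinuousOn U (Icc 0 T) ∧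
    (∀ᵐ t ∂(volume.restrict (Ioo (0 : ℝ) T)), U t = ι (u t)) ∧ U 0 = 0

/-- The inner product with a fixed vector commutes with primitives. -/
theorem inner_primitive (f : L2T T V) {t : ℝ} (ht : t ∈ Icc 0 T) (ζ : V) :
    ⟪∫ s in (0 : ℝ)..t, f s, ζ⟫ = ∫ s in (0 : ℝ)..t, ⟪f s, ζ⟫ := by
  have := ((innerSL ℝ) ζ).intervalIntegral_comp_comm (L2T.intervalIntegrable f ht)
  simp only [innerSL_apply_apply] at this
  rw [real_inner_comm, ← this]
  simp only [real_inner_comm]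

omit [CompleteSpace V] in
theorem L2T.integrable_inner_const (f : L2T T V) (ζ : V) :
    Integrable (fun t => ⟪f t, ζ⟫) (volume.restrict (Ioo (0 : ℝ) T)) :=
  (L2T.integrable f).inner_const ζ

variable (ι : V →L[ℝ] Z) (F : Z →L[ℝ] V) (A₁ A₂ : V →L[ℝ] V) (N₅ N₆ : Y →L[ℝ] V)

/-- The right-hand side of the evolution equation. -/
noncomputable def dataL (f : L2T T Z) (b₅ b₆ : L2T T Y) : L2T T V :=
  F.compLpL 2 _ f + (N₅.compLpL 2 _ b₅ + N₆.compLpL 2 _ b₆)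

variable {ι F A₁ A₂ N₅ N₆} {f : L2T T Z} {b₅ b₆ : L2T T Y} {u v : L2T T V}

omit [CompleteSpace V] in
theorem dataL_sub_ae : ∀ᵐ t ∂(volume.restrict (Ioo (0 : ℝ) T)),
    (dataL F N₅ N₆ f b₅ b₆ - A₁.compLpL 2 _ v) t =
      F (f t) + (N₅ (b₅ t) + N₆ (b₆ t)) - A₁ (v t) := by
  have e1 := Lp.coeFn_sub (dataL F N₅ N₆ f b₅ b₆) (A₁.compLpL 2 (volume.restrict (Ioo (0 : ℝ) T)) v)
  have e2 := Lp.coeFn_add (F.compLpL 2 (volume.restrict (Ioo (0 : ℝ) T)) f)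
    (N₅.compLpL 2 (volume.restrict (Ioo (0 : ℝ) T)) b₅ +
      N₆.compLpL 2 (volume.restrict (Ioo (0 : ℝ) T)) b₆)
  have e3 := Lp.coeFn_add (N₅.compLpL 2 (volume.restrict (Ioo (0 : ℝ) T)) b₅)
    (N₆.compLpL 2 (volume.restrict (Ioo (0 : ℝ) T)) b₆)
  filter_upwards [e1, e2, e3, F.coeFn_compLpL f, N₅.coeFn_compLpL b₅, N₆.coeFn_compLpL b₆,
    A₁.coeFn_compLpL v] with t h1 h2 h3 h4 h5 h6 h7
  rw [h1, Pi.sub_apply, h7, dataL, h2, Pi.add_apply, h3, Pi.add_apply, h4, h5, h6]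

omit [CompleteSpace V] in
theorem inner_dataL_sub_ae (ζ : V) : ∀ᵐ t ∂(volume.restrict (Ioo (0 : ℝ) T)),
    ⟪(dataL F N₅ N₆ f b₅ b₆ - A₁.compLpL 2 _ v) t, ζ⟫ =
      -⟪A₁ (v t), ζ⟫ + ⟪N₅ (b₅ t) + N₆ (b₆ t), ζ⟫ + ⟪F (f t), ζ⟫ := by
  filter_upwards [dataL_sub_ae (F := F) (N₅ := N₅) (N₆ := N₆) (f := f) (b₅ := b₅) (b₆ := b₆)
    (A₁ := A₁) (v := v)] with t h
  rw [h, inner_sub_left, inner_add_left]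
  ring

/-- The integrated form of the system implies the weak formulation. -/
theorem isHilbertWeakSolution_of_primitive (hT : 0 ≤ T)
    (h1 : A₂.compLpL 2 _ u = (F.comp ι).compLpL 2 _ v)
    (h2 : (F.comp ι).compLpL 2 _ u =
      primitiveL T V (dataL F N₅ N₆ f b₅ b₆ - A₁.compLpL 2 _ v))
    {U : ℝ → V} (hU : ContinuousOn U (Icc 0 T))
    (hUu : ∀ᵐ t ∂(volume.restrict (Ioo (0 : ℝ) T)), U t = u t) (hU0 : U 0 = 0) :
    IsHilbertWeakSolution ι F A₁ A₂ N₅ N₆ f b₅ b₆ u v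
      ((innerSL ℝ : V →L[ℝ] StrongDual ℝ V).compLpL 2 _
        (dataL F N₅ N₆ f b₅ b₆ - A₁.compLpL 2 _ v)) := by
  set l := dataL F N₅ N₆ f b₅ b₆ - A₁.compLpL 2 _ v with hl
  have hw : ∀ᵐ t ∂(volume.restrict (Ioo (0 : ℝ) T)), ∀ ζ,
      (innerSL ℝ : V →L[ℝ] StrongDual ℝ V).compLpL 2 _ l t ζ = ⟪l t, ζ⟫ := by
    filter_upwards [(innerSL ℝ : V →L[ℝ] StrongDual ℝ V).coeFn_compLpL l] with t h ζ
    rw [h]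
    rfl
  refine ⟨fun φ hφ1 hφ2 hφ3 ζ => ?_, fun ζ => ?_, fun ψ => ?_, fun t => ι (U t),
    ι.continuous.comp_continuousOn hU, ?_, by simp [hU0]⟩
  · have h := integral_deriv_mul_primitive hT hφ1 hφ3 (L2T.integrable_inner_const l ζ)
    have e1 : ∫ t in Ioo 0 T, φ t * (innerSL ℝ : V →L[ℝ] StrongDual ℝ V).compLpL 2 _ l t ζ =
        ∫ t in Ioo 0 T, φ t * ⟪l t, ζ⟫ := by
      refine integral_congr_ae ?_
      filter_upwards [hw] with t ht
      rw [ht]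
    rw [e1, ← h]
    refine integral_congr_ae ?_
    filter_upwards [(L2T.compLpL_eq_iff _ _ _).1 h2, primitiveL_ae l,
      ae_restrict_mem measurableSet_Ioo] with t ht1 ht2 ht3
    rw [← inner_primitive l (Ioo_subset_Icc_self ht3), ← ht2, ← ht1]
    rfl
  · filter_upwards [hw, inner_dataL_sub_ae (F := F) (N₅ := N₅) (N₆ := N₆) (f := f) (b₅ := b₅)
      (b₆ := b₆) (A₁ := A₁) (v := v) ζ] with t ht1 ht2
    rw [ht1, ← ht2]
  · filter_upwards [(L2T.compLpL_eq_iff _ _ _).1 h1, (F.comp ι).coeFn_compLpL v] with t ht1 ht2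
    rw [ht1, ht2]
    rfl
  · filter_upwards [hUu] with t ht
    rw [ht]

theorem IsHilbertWeakSolution.elliptic_eq {w : L2T T (StrongDual ℝ V)}
    (h : IsHilbertWeakSolution ι F A₁ A₂ N₅ N₆ f b₅ b₆ u v w) :
    A₂.compLpL 2 _ u = (F.comp ι).compLpL 2 _ v := by
  refine sub_eq_zero.1 (L2T.eq_zero_of_forall_inner _ fun ζ => ?_)
  filter_upwards [h.elliptic ζ, Lp.coeFn_sub (A₂.compLpL 2 (volume.restrict (Ioo (0 : ℝ) T)) u)
    ((F.comp ι).compLpL 2 _ v), A₂.coeFn_compLpL u, (F.comp ι).coeFn_compLpL v] with t h1 h2 h3 h4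
  rw [h2, Pi.sub_apply, h3, h4, inner_sub_left, sub_eq_zero, ← h1]
  rfl

/-- Tested with any `ζ`, the difference of the two sides has zero weak time derivative and is
therefore constant. The continuous representative in `Z` starts at zero, so the constant vanishes.
Hence uniqueness for the integrated system applies to every weak solution. -/
theorem IsHilbertWeakSolution.primitive_eq (hT : 0 < T) {w : L2T T (StrongDual ℝ V)}
    (h : IsHilbertWeakSolution ι F A₁ A₂ N₅ N₆ f b₅ b₆ u v w) :
    (F.comp ι).compLpL 2 _ u =
      primitiveL T V (dataL F N₅ N₆ f b₅ b₆ - A₁.compLpL 2 _ v) := by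
  set l := dataL F N₅ N₆ f b₅ b₆ - A₁.compLpL 2 _ v with hl
  obtain ⟨U, hU1, hU2, hU3⟩ := h.initial
  refine sub_eq_zero.1 (L2T.eq_zero_of_forall_inner _ fun ζ => ?_)
  have hB : ∀ᵐ t ∂(volume.restrict (Ioo (0 : ℝ) T)), (F.comp ι).compLpL 2 _ u t = F (ι (u t)) :=
    (F.comp ι).coeFn_compLpL u
  have hI1 : Integrable (fun t => ⟪F (ι (u t)), ζ⟫) (volume.restrict (Ioo (0 : ℝ) T)) :=
    (L2T.integrable_inner_const ((F.comp ι).compLpL 2 _ u) ζ).congr (by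
      filter_upwards [hB] with t ht
      rw [ht])
  have hI2 : Integrable (fun t => ∫ s in (0 : ℝ)..t, ⟪l s, ζ⟫) (volume.restrict (Ioo (0 : ℝ) T)) :=
    ((continuousOn_primitive_of_integrable (L2T.integrable_inner_const l ζ)).integrableOn_Icc).mono_set
      Ioo_subset_Icc_self
  obtain ⟨k, hk⟩ := ae_eq_const_of_integral_deriv_mul_eq_zero hT (hI1.sub hI2) (by
    intro φ hφ1 hφ2 hφ3
    have e1 := h.timeDeriv φ hφ1 hφ2 hφ3 ζ
    have e2 := integral_deriv_mul_primitive hT.le hφ1 hφ3 (L2T.integrable_inner_const l ζ)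
    have e3 : ∫ t in Ioo 0 T, φ t * w t ζ = ∫ t in Ioo 0 T, φ t * ⟪l t, ζ⟫ := by
      refine integral_congr_ae ?_
      filter_upwards [h.parabolic ζ, inner_dataL_sub_ae (F := F) (N₅ := N₅) (N₆ := N₆) (f := f)
        (b₅ := b₅) (b₆ := b₆) (A₁ := A₁) (v := v) ζ] with t ht1 ht2
      rw [ht1, ← ht2]
    have hφb : ∃ M, ∀ t, ‖deriv φ t‖ ≤ M :=
      (hφ2.deriv).exists_bound_of_continuous (hφ1.continuous_deriv (by simp))
    obtain ⟨M, hM⟩ := hφb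
    have hms : AEStronglyMeasurable (deriv φ) (volume.restrict (Ioo (0 : ℝ) T)) :=
      (hφ1.continuous_deriv (by simp)).aestronglyMeasurable
    have i1 := hI1.bdd_mul hms (Filter.Eventually.of_forall hM)
    have i2 := hI2.bdd_mul hms (Filter.Eventually.of_forall hM)
    simp only [Pi.sub_apply, mul_sub]
    rw [integral_sub i1 i2, e1, e2, e3, sub_self])
  have hc : ContinuousOn (fun t => ⟪F (U t), ζ⟫ - ∫ s in (0 : ℝ)..t, ⟪l s, ζ⟫) (Icc 0 T) :=
    ((F.continuous.comp_continuousOn hU1).inner continuousOn_const).sub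
      (continuousOn_primitive_of_integrable (L2T.integrable_inner_const l ζ))
  have hae : (fun t => ⟪F (U t), ζ⟫ - ∫ s in (0 : ℝ)..t, ⟪l s, ζ⟫)
      =ᵐ[volume.restrict (Icc 0 T)] fun _ => k := by
    rw [← restrict_Ioo_eq_restrict_Icc]
    filter_upwards [hk, hU2] with t h1 h2
    rw [h2, ← h1]
    rfl
  -- Continuous functions that agree almost everywhere agree on the closed interval, so `k` can be
  -- read off at `t = 0`.
  have hall := Measure.eqOn_Icc_of_ae_eq volume hT.ne hae hc continuousOn_const
  have hk0 : k = 0 := by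
    have := hall (left_mem_Icc.2 hT.le)
    simpa [hU3] using this.symm
  filter_upwards [hk, Lp.coeFn_sub ((F.comp ι).compLpL 2 (volume.restrict (Ioo (0 : ℝ) T)) u)
    (primitiveL T V l), hB, primitiveL_ae l, ae_restrict_mem measurableSet_Ioo] with t h1 h2 h3 h4 h5
  rw [h2, Pi.sub_apply, h3, h4, inner_sub_left, inner_primitive l (Ioo_subset_Icc_self h5)]
  exact h1.trans hk0

variable (ι F A₁ A₂ N₅ N₆)

/-- Weak solutions are precisely the solutions of the integrated system, so `coupled_wellposed`
applies. The time derivative is the functional represented by `l - A₁ v`, which that theorem also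
estimates. -/
theorem hilbert_wellposed (hT : 0 < T) {g : ℝ} (hg : 0 < g)
    (hA₁ : ∀ x, g * ‖x‖ ^ 2 ≤ ⟪A₁ x, x⟫) (hA₂ : ∀ x, g * ‖x‖ ^ 2 ≤ ⟪A₂ x, x⟫)
    (hs : ∀ x y, ⟪A₂ x, y⟫ = ⟪x, A₂ y⟫) (hB : ∀ x y, ⟪F (ι x), y⟫ = ⟪x, F (ι y)⟫)
    (hBi : ∀ x, F (ι x) = 0 → x = 0) :
    ∃ C : ℝ, 0 < C ∧ ∀ (f : L2T T Z) (b₅ b₆ : L2T T Y), ∃ (u v : L2T T V)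
      (w : L2T T (StrongDual ℝ V)), IsHilbertWeakSolution ι F A₁ A₂ N₅ N₆ f b₅ b₆ u v w ∧
      (∀ (u' v' : L2T T V) (w' : L2T T (StrongDual ℝ V)),
        IsHilbertWeakSolution ι F A₁ A₂ N₅ N₆ f b₅ b₆ u' v' w' → u' = u ∧ v' = v) ∧
      ∃ U : ℝ → V, ContinuousOn U (Icc 0 T) ∧
        (∀ᵐ t ∂(volume.restrict (Ioo (0 : ℝ) T)), U t = u t) ∧
        ∀ t ∈ Icc 0 T, ‖U t‖ + ‖u‖ + ‖w‖ + ‖v‖ ≤ C * (‖f‖ + (‖b₅‖ + ‖b₆‖)) := by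
  obtain ⟨C, hC, h⟩ := coupled_wellposed hT.le A₁ A₂ (F.comp ι) hg hA₁ hA₂ hs hB hBi
  set J : V →L[ℝ] StrongDual ℝ V := innerSL ℝ with hJ
  -- The operator norms bound the data by `f`, `b₅` and `b₆`, with `1` added to keep the constant
  -- positive. The factor `1 + ‖J‖` accounts for passing from `l - A₁ v` to the functional it
  -- represents.
  refine ⟨(1 + ‖J‖) * (C * (‖F‖ + ‖N₅‖ + ‖N₆‖ + 1)), by positivity, fun f b₅ b₆ => ?_⟩
  obtain ⟨u, v, h1, h2, h3, U, hU1, hU2, hU3, hU4⟩ := h (dataL F N₅ N₆ f b₅ b₆)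
  refine ⟨u, v, J.compLpL 2 _ (dataL F N₅ N₆ f b₅ b₆ - A₁.compLpL 2 _ v),
    isHilbertWeakSolution_of_primitive hT.le h1 h2 hU1 hU2 hU3, fun u' v' w' h' =>
      h3 u' v' h'.elliptic_eq (h'.primitive_eq hT), U, hU1, hU2, fun t ht => ?_⟩
  set l := dataL F N₅ N₆ f b₅ b₆ - A₁.compLpL 2 _ v
  have e1 : ‖J.compLpL 2 (volume.restrict (Ioo (0 : ℝ) T)) l‖ ≤ ‖J‖ * ‖l‖ := J.norm_compLp_le l
  have e2 : ‖dataL F N₅ N₆ f b₅ b₆‖ ≤ (‖F‖ + ‖N₅‖ + ‖N₆‖ + 1) * (‖f‖ + (‖b₅‖ + ‖b₆‖)) := by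
    have a1 : ‖F.compLpL 2 (volume.restrict (Ioo (0 : ℝ) T)) f‖ ≤ ‖F‖ * ‖f‖ := F.norm_compLp_le f
    have a2 : ‖N₅.compLpL 2 (volume.restrict (Ioo (0 : ℝ) T)) b₅‖ ≤ ‖N₅‖ * ‖b₅‖ :=
      N₅.norm_compLp_le b₅
    have a3 : ‖N₆.compLpL 2 (volume.restrict (Ioo (0 : ℝ) T)) b₆‖ ≤ ‖N₆‖ * ‖b₆‖ :=
      N₆.norm_compLp_le b₆
    have a4 := norm_add₃_le (a := F.compLpL 2 (volume.restrict (Ioo (0 : ℝ) T)) f)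
      (b := N₅.compLpL 2 (volume.restrict (Ioo (0 : ℝ) T)) b₅)
      (c := N₆.compLpL 2 (volume.restrict (Ioo (0 : ℝ) T)) b₆)
    rw [add_assoc] at a4
    have a5 : 0 ≤ ‖F‖ * (‖b₅‖ + ‖b₆‖) + ‖N₅‖ * (‖f‖ + ‖b₆‖) + ‖N₆‖ * (‖f‖ + ‖b₅‖) +
      (‖f‖ + (‖b₅‖ + ‖b₆‖)) := by positivity
    refine a4.trans ?_
    linarith
  have e3 := (hU4 t ht).trans (mul_le_mul_of_nonneg_left e2 hC.le)
  rw [← mul_assoc] at e3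
  set X := C * (‖F‖ + ‖N₅‖ + ‖N₆‖ + 1) * (‖f‖ + (‖b₅‖ + ‖b₆‖)) with hX
  have e4 : (1 + ‖J‖) * (C * (‖F‖ + ‖N₅‖ + ‖N₆‖ + 1)) * (‖f‖ + (‖b₅‖ + ‖b₆‖)) =
    X + ‖J‖ * X := by rw [hX]; ring
  rw [e4]
  have e5 : ‖l‖ ≤ X := by
    linarith [norm_nonneg (U t), norm_nonneg u, norm_nonneg v]
  have e6 := mul_le_mul_of_nonneg_left e5 (norm_nonneg J)
  linarith [norm_nonneg l]

end WeakSolutions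

end TripleJunctionCluster

/-! ### Riesz representation of the weighted forms -/

namespace TripleJunctionCluster

section Forms

variable {V : Type} {L G : Fin 3 → Type} [NormedAddCommGroup V] [InnerProductSpace ℝ V]
  [CompleteSpace V]
  [∀ i, NormedAddCommGroup (L i)] [∀ i, InnerProductSpace ℝ (L i)] [∀ i, CompleteSpace (L i)]
  [∀ i, NormedAddCommGroup (G i)] [∀ i, InnerProductSpace ℝ (G i)] [∀ i, CompleteSpace (G i)]

omit [CompleteSpace V] in
theorem exists_clm_of_norm_le {W : Type} [NormedAddCommGroup W] [NormedSpace ℝ W] {f : V → W}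
    (ha : ∀ x y, f (x + y) = f x + f y) (hm : ∀ (a : ℝ) x, f (a • x) = a • f x) {C : ℝ}
    (hb : ∀ x, ‖f x‖ ≤ C * ‖x‖) : ∃ A : V →L[ℝ] W, ∀ x, A x = f x :=
  ⟨LinearMap.mkContinuous { toFun := f, map_add' := ha, map_smul' := hm } C hb, fun _ => rfl⟩

/-- The Riesz representations of weighted products and of weighted Dirichlet forms. -/
theorem exists_rieszForm {fn : ∀ i, V → L i} {grad : ∀ i, V → G i} {γ : Fin 3 → ℝ}
    (hγ : ∀ i, 0 < γ i)
    (fa : ∀ i x y, fn i (x + y) = fn i x + fn i y)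
    (fm : ∀ i (a : ℝ) x, fn i (a • x) = a • fn i x)
    (ga : ∀ i x y, grad i (x + y) = grad i x + grad i y)
    (gm : ∀ i (a : ℝ) x, grad i (a • x) = a • grad i x)
    (hn : ∀ x, ‖x‖ ^ 2 = ∑ i, (‖fn i x‖ ^ 2 + ‖grad i x‖ ^ 2))
    (hi : ∀ x, (∀ i, fn i x = 0) → x = 0) :
    ∃ (ι : V →L[ℝ] PiLp 2 L) (F : PiLp 2 L →L[ℝ] V) (A : ℝ → V →L[ℝ] V) (g : ℝ), 0 < g ∧
      (∀ x, ι x = WithLp.toLp 2 fun i => fn i x) ∧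
      (∀ z y, ⟪F z, y⟫ = ∑ i, γ i * ⟪z i, fn i y⟫) ∧
      (∀ C x y, ⟪A C x, y⟫ = ∑ i, γ i * (⟪grad i x, grad i y⟫ + C * ⟪fn i x, fn i y⟫)) ∧
      (∀ C, 1 ≤ C → ∀ x, g * ‖x‖ ^ 2 ≤ ⟪A C x, x⟫) ∧
      (∀ C x y, ⟪A C x, y⟫ = ⟪x, A C y⟫) ∧ (∀ x y, ⟪F (ι x), y⟫ = ⟪x, F (ι y)⟫) ∧
      ∀ x, F (ι x) = 0 → x = 0 := by
  have hle : ∀ i x, ‖fn i x‖ ^ 2 + ‖grad i x‖ ^ 2 ≤ ‖x‖ ^ 2 := fun i x => by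
    rw [hn]
    exact Finset.single_le_sum (f := fun i => ‖fn i x‖ ^ 2 + ‖grad i x‖ ^ 2)
      (fun _ _ => by positivity) (Finset.mem_univ i)
  have hf : ∀ i x, ‖fn i x‖ ≤ 1 * ‖x‖ := fun i x => by
    rw [one_mul, ← sq_le_sq₀ (norm_nonneg _) (norm_nonneg _)]
    linarith [hle i x, sq_nonneg ‖grad i x‖]
  have hg : ∀ i x, ‖grad i x‖ ≤ 1 * ‖x‖ := fun i x => by
    rw [one_mul, ← sq_le_sq₀ (norm_nonneg _) (norm_nonneg _)]
    linarith [hle i x, sq_nonneg ‖fn i x‖]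
  choose P hP using fun i => exists_clm_of_norm_le (fa i) (fm i) (hf i)
  choose D hD using fun i => exists_clm_of_norm_le (ga i) (gm i) (hg i)
  -- The smallest weight is the coercivity constant of every form with `C ≥ 1`.
  obtain ⟨i₀, hi₀⟩ := Finite.exists_min γ
  set ι : V →L[ℝ] PiLp 2 L :=
    (PiLp.continuousLinearEquiv 2 ℝ L).symm.toContinuousLinearMap.comp (ContinuousLinearMap.pi P)
    with hι
  set F : PiLp 2 L →L[ℝ] V := ∑ i, γ i • ((P i).adjoint.comp (PiLp.proj 2 L i)) with hF
  set A : ℝ → V →L[ℝ] V := fun C =>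
    ∑ i, γ i • ((D i).adjoint.comp (D i) + C • (P i).adjoint.comp (P i)) with hA
  have hιe : ∀ x, ι x = WithLp.toLp 2 fun i => fn i x := fun x => by
    simp only [← hP]
    rfl
  have hFe : ∀ z y, ⟪F z, y⟫ = ∑ i, γ i * ⟪z i, fn i y⟫ := fun z y => by
    simp only [hF, sum_apply, sum_inner, smul_apply,
      real_inner_smul_left, ContinuousLinearMap.comp_apply, ContinuousLinearMap.adjoint_inner_left,
      hP]
    rfl
  have hAe : ∀ C x y, ⟪A C x, y⟫ =
      ∑ i, γ i * (⟪grad i x, grad i y⟫ + C * ⟪fn i x, fn i y⟫) := fun C x y => by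
    simp only [hA, sum_apply, sum_inner, smul_apply,
      real_inner_smul_left, ContinuousLinearMap.comp_apply, ContinuousLinearMap.adjoint_inner_left,
      add_apply, inner_add_left, hP, hD]
  have hFι : ∀ x y, ⟪F (ι x), y⟫ = ∑ i, γ i * ⟪fn i x, fn i y⟫ := fun x y => by
    rw [hFe, hιe]
  refine ⟨ι, F, A, γ i₀, hγ i₀, hιe, hFe, hAe, fun C hC x => ?_, fun C x y => ?_, fun x y => ?_,
    fun x hx => hi x fun i => ?_⟩
  · rw [hAe, hn, Finset.mul_sum]
    refine Finset.sum_le_sum fun i _ => ?_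
    rw [real_inner_self_eq_norm_sq, real_inner_self_eq_norm_sq]
    have h1 : ‖fn i x‖ ^ 2 ≤ C * ‖fn i x‖ ^ 2 := le_mul_of_one_le_left (by positivity) hC
    exact mul_le_mul (hi₀ i) (by linarith) (by positivity) (hγ i).le
  · refine (hAe C x y).trans (Eq.trans ?_ ((hAe C y x).symm.trans (real_inner_comm _ _)))
    refine Finset.sum_congr rfl fun i _ => ?_
    simp only [real_inner_comm]
  · refine (hFι x y).trans (Eq.trans ?_ ((hFι y x).symm.trans (real_inner_comm _ _)))
    refine Finset.sum_congr rfl fun i _ => ?_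
    simp only [real_inner_comm]
  · have h1 := hFι x x
    rw [hx, inner_zero_left] at h1
    have h2 := (Finset.sum_eq_zero_iff_of_nonneg fun i _ =>
      mul_nonneg (hγ i).le real_inner_self_nonneg).1 h1.symm
    exact inner_self_eq_zero.1
      ((mul_eq_zero.1 (h2 i (Finset.mem_univ i))).resolve_left (hγ i).ne')

end Forms

/-! ### Traces as bounded operators given by their graphs -/

section Traces

variable {H : Fin 3 → Type} {Y : Type} [∀ i, NormedAddCommGroup (H i)]
  [∀ i, NormedSpace ℝ (H i)] [NormedAddCommGroup Y] [NormedSpace ℝ Y]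

/-- The bound is a closed condition on pairs, so it passes from the restriction graph to its
closure. -/
theorem norm_le_of_mem_topologicalClosure {X : Type} [NormedAddCommGroup X] [NormedSpace ℝ X]
    {gr : Submodule ℝ (X × Y)} {C : ℝ} (h : ∀ q ∈ gr, ‖q.2‖ ≤ C * ‖q.1‖) {x : X} {y : Y}
    (hq : (x, y) ∈ gr.topologicalClosure) : ‖y‖ ≤ C * ‖x‖ := by
  have hcl : IsClosed {q : X × Y | ‖q.2‖ ≤ C * ‖q.1‖} :=
    isClosed_le (by fun_prop) (by fun_prop)
  exact closure_minimal h hcl hq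

/-- The difference of two values over the same point lies over `0` in the closed subspace, where the
bound forces it to vanish. The relation `IsTrace` is thereby single-valued. -/
theorem eq_of_mem_topologicalClosure {X : Type} [NormedAddCommGroup X] [NormedSpace ℝ X]
    {gr : Submodule ℝ (X × Y)} {C : ℝ} (h : ∀ q ∈ gr, ‖q.2‖ ≤ C * ‖q.1‖) {x : X} {y z : Y}
    (hy : (x, y) ∈ gr.topologicalClosure) (hz : (x, z) ∈ gr.topologicalClosure) : y = z := by
  have h1 := norm_le_of_mem_topologicalClosure h
    (x := x - x) (y := y - z) (gr.topologicalClosure.sub_mem hy hz)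
  rw [sub_self, norm_zero, mul_zero] at h1
  exact sub_eq_zero.1 (norm_le_zero_iff.1 h1)

variable (gr : ∀ i, Submodule ℝ (H i × Y)) (γ : Fin 3 → ℝ)

/-- A linear condition on the values of bounded operators, which are given by their graphs, defines
a closed set. -/
theorem isClosed_setOf_traces [CompleteSpace Y] {C : Fin 3 → ℝ}
    (h : ∀ i, ∀ q ∈ gr i, ‖q.2‖ ≤ C i * ‖q.1‖) :
    IsClosed {u : PiLp 2 H | ∃ τ : Fin 3 → Y, (∀ i, (u i, τ i) ∈ (gr i).topologicalClosure) ∧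
      ∑ i, γ i • τ i = 0} := by
  refine isClosed_of_closure_subset fun u hu => ?_
  obtain ⟨q, hq, hqu⟩ := mem_closure_iff_seq_limit.1 hu
  choose τ hτ hτ0 using hq
  have hqi : ∀ i, Filter.Tendsto (fun j => q j i) Filter.atTop (𝓝 (u i)) := fun i =>
    ((PiLp.continuous_apply 2 _ i).tendsto u).comp hqu
  -- The bound transfers the Cauchy property from the functions to their traces, so the traces
  -- converge and the linear condition passes to the limit.
  have hcau : ∀ i, CauchySeq fun j => τ j i := by
    intro i
    obtain ⟨b, hb1, hb2, hb3⟩ := cauchySeq_iff_le_tendsto_0.1 (hqi i).cauchySeq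
    refine cauchySeq_iff_le_tendsto_0.2 ⟨fun j => |C i| * b j, fun j =>
      mul_nonneg (abs_nonneg _) (hb1 j), fun j k N hj hk => ?_, by simpa using hb3.const_mul |C i|⟩
    rw [dist_eq_norm]
    refine (norm_le_of_mem_topologicalClosure (h i) (x := q j i - q k i)
      ((gr i).topologicalClosure.sub_mem (hτ j i) (hτ k i))).trans ?_
    rw [← dist_eq_norm]
    exact mul_le_mul (le_abs_self _) (hb2 j k N hj hk) dist_nonneg (abs_nonneg _)
  choose σ hσ using fun i => cauchySeq_tendsto_of_complete (hcau i)
  refine ⟨σ, fun i => ?_, ?_⟩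
  · exact (gr i).isClosed_topologicalClosure.mem_of_tendsto
      ((hqi i).prodMk_nhds (hσ i)) (Filter.Eventually.of_forall fun j => hτ j i)
  · refine tendsto_nhds_unique (tendsto_finsetSum _ fun i _ => (hσ i).const_smul (γ i)) ?_
    simp only [hτ0]
    exact tendsto_const_nhds

/-- A bounded operator which is given by its graph. -/
theorem exists_clm_of_graph {V X : Type} [NormedAddCommGroup V] [InnerProductSpace ℝ V]
    [NormedAddCommGroup X] [NormedSpace ℝ X] {gr : Submodule ℝ (X × Y)} {C : ℝ}
    (h : ∀ q ∈ gr, ‖q.2‖ ≤ C * ‖q.1‖) {p : V → X} (pa : ∀ x y, p (x + y) = p x + p y)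
    (pm : ∀ (a : ℝ) x, p (a • x) = a • p x) (pn : ∀ x, ‖p x‖ ≤ ‖x‖)
    (hex : ∀ x, ∃ y, (p x, y) ∈ gr.topologicalClosure) :
    ∃ R : V →L[ℝ] Y, ∀ x y, (p x, y) ∈ gr.topologicalClosure → y = R x := by
  choose τ hτ using hex
  obtain ⟨R, hR⟩ := exists_clm_of_norm_le (f := τ) (C := |C|)
    (fun x y => eq_of_mem_topologicalClosure h (hτ (x + y)) (by
      rw [pa]
      exact gr.topologicalClosure.add_mem (hτ x) (hτ y)))
    (fun a x => eq_of_mem_topologicalClosure h (hτ (a • x)) (by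
      rw [pm]
      exact gr.topologicalClosure.smul_mem a (hτ x)))
    (fun x => (norm_le_of_mem_topologicalClosure h (hτ x)).trans
      (mul_le_mul (le_abs_self C) (pn x) (norm_nonneg _) (abs_nonneg _)))
  exact ⟨R, fun x y hy => by rw [hR]; exact eq_of_mem_topologicalClosure h hy (hτ x)⟩

end Traces

end TripleJunctionCluster

/-! ### Well-posedness for abstract forms and trace graphs -/

namespace TripleJunctionCluster

theorem exists_riesz_trace {V Y : Type} [NormedAddCommGroup V] [InnerProductSpace ℝ V]
    [CompleteSpace V] [NormedAddCommGroup Y] [InnerProductSpace ℝ Y] [CompleteSpace Y]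
    (R : V →L[ℝ] Y) (a : ℝ) : ∃ N : Y →L[ℝ] V, ∀ y x, ⟪N y, x⟫ = a * ⟪y, R x⟫ :=
  ⟨a • R.adjoint, fun y x => by
    rw [smul_apply, real_inner_smul_left, ContinuousLinearMap.adjoint_inner_left]⟩

/-- A dictionary that replaces the Riesz operators by the forms they represent, so that the Hilbert
space theorem applies to equations stated by means of forms. -/
theorem isHilbertWeakSolution_iff {T : ℝ} {V Y Z : Type} [NormedAddCommGroup V]
    [InnerProductSpace ℝ V] [NormedAddCommGroup Y] [NormedSpace ℝ Y]
    [NormedAddCommGroup Z] [NormedSpace ℝ Z] (ι : V →L[ℝ] Z) (F : Z →L[ℝ] V) (A₁ A₂ : V →L[ℝ] V)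
    (N₅ N₆ : Y →L[ℝ] V) {j : V → Z} {wI : Z → Z → ℝ} {a₁ a₂ : V → V → ℝ} {b : Y → Y → V → ℝ}
    (hι : ∀ x, ι x = j x) (hF : ∀ z x, ⟪F z, x⟫ = wI z (j x)) (hA₁ : ∀ x y, ⟪A₁ x, y⟫ = a₁ x y)
    (hA₂ : ∀ x y, ⟪A₂ x, y⟫ = a₂ x y) (hN : ∀ y z x, ⟪N₅ y + N₆ z, x⟫ = b y z x)
    (f : L2T T Z) (b₅ b₆ : L2T T Y) (u v : L2T T V) (w : L2T T (StrongDual ℝ V)) :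
    IsHilbertWeakSolution ι F A₁ A₂ N₅ N₆ f b₅ b₆ u v w ↔
      (∀ φ : ℝ → ℝ, ContDiff ℝ ∞ φ → HasCompactSupport φ → tsupport φ ⊆ Ioo 0 T → ∀ ζ : V,
        ∫ t in Ioo 0 T, deriv φ t * wI (j (u t)) (j ζ) = -∫ t in Ioo 0 T, φ t * w t ζ) ∧
      (∀ ζ : V, ∀ᵐ t ∂(volume.restrict (Ioo (0 : ℝ) T)),
        w t ζ = -a₁ (v t) ζ + b (b₅ t) (b₆ t) ζ + wI (f t) (j ζ)) ∧
      (∀ ψ : V, ∀ᵐ t ∂(volume.restrict (Ioo (0 : ℝ) T)), wI (j (v t)) (j ψ) = a₂ (u t) ψ) ∧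
      ∃ U : ℝ → Z, ContinuousOn U (Icc 0 T) ∧
        (∀ᵐ t ∂(volume.restrict (Ioo (0 : ℝ) T)), U t = j (u t)) ∧ U 0 = 0 := by
  simp only [← hF, ← hA₁, ← hA₂, ← hN]
  simp only [← hι]
  exact ⟨fun h => ⟨h.1, h.2, h.3, h.4⟩, fun h => ⟨h.1, h.2.1, h.2.2.1, h.2.2.2⟩⟩

section Wellposed

variable {V Y : Type} {L G H : Fin 3 → Type} [NormedAddCommGroup V] [InnerProductSpace ℝ V]
  [CompleteSpace V] [NormedAddCommGroup Y] [InnerProductSpace ℝ Y] [CompleteSpace Y]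
  [∀ i, NormedAddCommGroup (L i)] [∀ i, InnerProductSpace ℝ (L i)] [∀ i, CompleteSpace (L i)]
  [∀ i, NormedAddCommGroup (G i)] [∀ i, InnerProductSpace ℝ (G i)] [∀ i, CompleteSpace (G i)]
  [∀ i, NormedAddCommGroup (H i)] [∀ i, NormedSpace ℝ (H i)]

/-- Well-posedness of the weak formulation, for forms which are given by components and gradients
and for trace operators which are given by their graphs. -/
theorem wellposed_of_forms {fn : ∀ i, V → L i} {grad : ∀ i, V → G i} {p : ∀ i, V → H i}
    {gr : ∀ i, Submodule ℝ (H i × Y)} {K : Fin 3 → ℝ} {γ : Fin 3 → ℝ} (hγ : ∀ i, 0 < γ i)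
    (fa : ∀ i x y, fn i (x + y) = fn i x + fn i y)
    (fm : ∀ i (a : ℝ) x, fn i (a • x) = a • fn i x)
    (ga : ∀ i x y, grad i (x + y) = grad i x + grad i y)
    (gm : ∀ i (a : ℝ) x, grad i (a • x) = a • grad i x)
    (hn : ∀ x, ‖x‖ ^ 2 = ∑ i, (‖fn i x‖ ^ 2 + ‖grad i x‖ ^ 2))
    (hi : ∀ x, (∀ i, fn i x = 0) → x = 0)
    (hgr : ∀ i, ∀ q ∈ gr i, ‖q.2‖ ≤ K i * ‖q.1‖)
    (pa : ∀ i x y, p i (x + y) = p i x + p i y)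
    (pm : ∀ i (a : ℝ) x, p i (a • x) = a • p i x) (pn : ∀ i x, ‖p i x‖ ≤ ‖x‖)
    (hex : ∀ x, ∃ τ : Fin 3 → Y, ∀ i, (p i x, τ i) ∈ (gr i).topologicalClosure)
    {j : V → PiLp 2 L} {wI : PiLp 2 L → PiLp 2 L → ℝ} {a : ℝ → V → V → ℝ}
    {bd : Y → Y → (Fin 3 → Y) → ℝ}
    (hj : ∀ x, j x = WithLp.toLp 2 fun i => fn i x)
    (hw : ∀ z y, wI z y = ∑ i, γ i * ⟪z i, y i⟫)
    (ha : ∀ C x y, a C x y = ∑ i, γ i * (⟪grad i x, grad i y⟫ + C * ⟪fn i x, fn i y⟫))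
    (hbd : ∀ y z τ, bd y z τ = γ 0 * ⟪y, τ 0⟫ - γ 2 * ⟪z, τ 2⟫)
    {Cu Cv : ℝ} (hCu : 1 ≤ Cu) (hCv : 1 ≤ Cv) {T : ℝ} (hT : 0 < T)
    {Sol : L2T T (PiLp 2 L) → L2T T Y → L2T T Y → L2T T V → L2T T V →
      L2T T (StrongDual ℝ V) → Prop}
    (hSol : ∀ f b₅ b₆ u v w, Sol f b₅ b₆ u v w ↔
      (∀ φ : ℝ → ℝ, ContDiff ℝ ∞ φ → HasCompactSupport φ → tsupport φ ⊆ Ioo 0 T → ∀ ζ : V,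
        ∫ t in Ioo 0 T, deriv φ t * wI (j (u t)) (j ζ) = -∫ t in Ioo 0 T, φ t * w t ζ) ∧
      (∀ ζ : V, ∀ τ : Fin 3 → Y, (∀ i, (p i ζ, τ i) ∈ (gr i).topologicalClosure) →
        ∀ᵐ t ∂(volume.restrict (Ioo (0 : ℝ) T)),
          w t ζ = -a Cu (v t) ζ + bd (b₅ t) (b₆ t) τ + wI (f t) (j ζ)) ∧
      (∀ ψ : V, ∀ᵐ t ∂(volume.restrict (Ioo (0 : ℝ) T)), wI (j (v t)) (j ψ) = a Cv (u t) ψ) ∧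
      ∃ U : ℝ → PiLp 2 L, ContinuousOn U (Icc 0 T) ∧
        (∀ᵐ t ∂(volume.restrict (Ioo (0 : ℝ) T)), U t = j (u t)) ∧ U 0 = 0) :
    ∃ C : ℝ, 0 < C ∧ ∀ (f : L2T T (PiLp 2 L)) (b₅ b₆ : L2T T Y), ∃ (u v : L2T T V)
      (w : L2T T (StrongDual ℝ V)), Sol f b₅ b₆ u v w ∧
      (∀ (u' v' : L2T T V) (w' : L2T T (StrongDual ℝ V)),
        Sol f b₅ b₆ u' v' w' → u' = u ∧ v' = v) ∧
      ∃ U : ℝ → V, ContinuousOn U (Icc 0 T) ∧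
        (∀ᵐ t ∂(volume.restrict (Ioo (0 : ℝ) T)), U t = u t) ∧
        ∀ t ∈ Icc 0 T, ‖U t‖ + ‖u‖ + ‖w‖ + ‖v‖ ≤ C * (‖f‖ + (‖b₅‖ + ‖b₆‖)) := by
  obtain ⟨ι, F, A, g, hg, hι, hF, hA, hco, hs, hB, hBi⟩ := exists_rieszForm hγ fa fm ga gm hn hi
  choose τ₀ hτ₀ using hex
  choose Q hQ using fun i =>
    exists_clm_of_graph (hgr i) (pa i) (pm i) (pn i) fun x => ⟨τ₀ x i, hτ₀ x i⟩
  obtain ⟨N₅, hN₅⟩ := exists_riesz_trace (Q 0) (γ 0)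
  obtain ⟨N₆, hN₆⟩ := exists_riesz_trace (Q 2) (-γ 2)
  obtain ⟨C, hC, h⟩ := hilbert_wellposed ι F (A Cu) (A Cv) N₅ N₆ hT hg (hco Cu hCu) (hco Cv hCv)
    (hs Cv) hB hBi
  -- Since traces are unique, requiring the parabolic equation for all traces `τ` of `ζ` amounts to
  -- requiring it for the chosen one.
  have hτ : ∀ y z ζ τ, (∀ i, (p i ζ, τ i) ∈ (gr i).topologicalClosure) →
      bd y z (τ₀ ζ) = bd y z τ := fun y z ζ τ h => by
    rw [hbd, hbd, hQ 0 ζ _ (h 0), hQ 2 ζ _ (h 2), hQ 0 ζ _ (hτ₀ ζ 0), hQ 2 ζ _ (hτ₀ ζ 2)]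
  have key : ∀ f b₅ b₆ u v w,
      IsHilbertWeakSolution ι F (A Cu) (A Cv) N₅ N₆ f b₅ b₆ u v w ↔ Sol f b₅ b₆ u v w := by
    intro f b₅ b₆ u v w
    rw [hSol]
    refine (isHilbertWeakSolution_iff ι F (A Cu) (A Cv) N₅ N₆ (b := fun y z x => bd y z (τ₀ x))
      (fun x => by rw [hι, hj]) (fun z x => by rw [hF, hw, hj])
      (fun x y => by rw [hA, ha]) (fun x y => by rw [hA, ha]) (fun y z x => ?_) f b₅ b₆ u v w).trans
      (and_congr_right fun _ => and_congr_left fun _ => forall_congr' fun ζ =>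
        ⟨fun h τ h' => ?_, fun h => h (τ₀ ζ) (hτ₀ ζ)⟩)
    · rw [inner_add_left, hN₅, hN₆, hbd, hQ 0 x _ (hτ₀ x 0), hQ 2 x _ (hτ₀ x 2), neg_mul,
        sub_eq_add_neg]
    · filter_upwards [h] with t ht
      rw [ht, hτ _ _ _ _ h']
  refine ⟨C, hC, fun f b₅ b₆ => ?_⟩
  obtain ⟨u, v, w, h1, h2, h3⟩ := h f b₅ b₆
  exact ⟨u, v, w, (key f b₅ b₆ u v w).1 h1,
    fun u' v' w' h' => h2 u' v' w' ((key f b₅ b₆ u' v' w').2 h'), h3⟩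

end Wellposed

end TripleJunctionCluster

/-! ### The concrete spaces: completeness, bounded traces, injectivity -/

theorem completeSpace_H1 {n : ℕ} (Γ S : Set (Amb n)) : CompleteSpace (H1 Γ S) :=
  (isClosed_H1 Γ S).completeSpace_coe

namespace TripleJunctionCluster

theorem isCompact_S {n : ℕ} (c : TripleJunctionCluster n) : IsCompact c.S := by
  rw [← c.inter_eq 0 1 (by decide)]
  exact (c.isCompact 0).inter (c.isCompact 1)

variable {n : ℕ} (c : TripleJunctionCluster n) (γ : Fin 3 → ℝ)

theorem exists_trace_le (hn : 1 ≤ n) : ∃ C : Fin 3 → ℝ, ∀ i,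
    ∀ q ∈ restrictionGraph (c.Γ i) c.S, ‖q.2‖ ≤ C i * ‖q.1‖ := by
  obtain ⟨m, rfl⟩ := Nat.exists_eq_add_of_le' hn
  exact ⟨fun i => ((c.isHypersurface i).exists_trace_le c.isCompact_S).choose,
    fun i => ((c.isHypersurface i).exists_trace_le c.isCompact_S).choose_spec⟩

theorem isClosed_E (hn : 1 ≤ n) : IsClosed (c.E γ : Set c.HH1) := by
  obtain ⟨C, hC⟩ := c.exists_trace_le hn
  exact isClosed_setOf_traces (fun i => restrictionGraph (c.Γ i) c.S) γ hC

theorem completeSpace_E (hn : 1 ≤ n) : CompleteSpace (c.E γ) :=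
  have := fun i => completeSpace_H1 (c.Γ i) c.S
  (c.isClosed_E γ hn).completeSpace_coe

variable {c γ} in
theorem E.norm_sq (u : c.E γ) :
    ‖u‖ ^ 2 = ∑ i, (‖H1.fn (u.1 i)‖ ^ 2 + ‖H1.grad (u.1 i)‖ ^ 2) :=
  (PiLp.norm_sq_eq_of_L2 _ u.1).trans
    (Finset.sum_congr rfl fun i _ => WithLp.prod_norm_sq_eq_of_L2 (u.1 i).1)

variable {c γ}

/-- An element of `H1` is a pair whose gradient is constrained only through parametrizations; that
the function determines the gradient in `L²` holds because charts cover `Γ` up to a null set. -/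
theorem grad_eq_zero (hn : 1 ≤ n) {i : Fin 3} {u : H1 (c.Γ i) c.S} (h : H1.fn u = 0) :
    H1.grad u = 0 := by
  obtain ⟨m, rfl⟩ := Nat.exists_eq_add_of_le' hn
  have hu : HasSurfaceGradient (c.Γ i) c.S (H1.fn u) (H1.grad u) := u.2
  refine Lp.ext ((hu.ae_eq_zero (c.isHypersurface i) ?_ (c.isCompact i).measurableSet).trans
    (Lp.coeFn_zero _ _ _).symm)
  rw [h]
  exact Lp.coeFn_zero _ _ _

/-- This is injectivity of `𝓔 → 𝓛`, hence of `B`, on which the injectivity of `P` and so uniqueness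
of `v` depend. -/
theorem E.eq_zero_of_fn_eq_zero (hn : 1 ≤ n) {u : c.E γ} (h : ∀ i, H1.fn (u.1 i) = 0) : u = 0 := by
  have hg : ∀ i, H1.grad (u.1 i) = 0 := fun i => grad_eq_zero hn (h i)
  have h0 : ∑ i, (‖H1.fn (u.1 i)‖ ^ 2 + ‖H1.grad (u.1 i)‖ ^ 2) = 0 :=
    Finset.sum_eq_zero fun i _ => by
      rw [h, hg, norm_zero, norm_zero]
      norm_num
  exact norm_eq_zero.1 (pow_eq_zero_iff two_ne_zero |>.1 ((E.norm_sq u).trans h0))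

theorem weightedInner_eq (γ : Fin 3 → ℝ) (z ζ : c.L2) :
    weightedInner γ z ζ = ∑ i, γ i * ⟪z i, ζ i⟫ := by
  refine Finset.sum_congr rfl fun i _ => ?_
  rw [L2.inner_def]
  congr 1
  refine integral_congr_ae (Filter.Eventually.of_forall fun x => ?_)
  simp [mul_comm]

theorem integral_inner_add_mul {X F : Type} [MeasurableSpace X] {μ : Measure X}
    [NormedAddCommGroup F] [InnerProductSpace ℝ F] (C : ℝ) (p q : Lp F 2 μ) (f g : Lp ℝ 2 μ) :
    ∫ x, (⟪p x, q x⟫ + C * (f x * g x)) ∂μ = ⟪p, q⟫ + C * ⟪f, g⟫ := by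
  rw [L2.inner_def, L2.inner_def, ← integral_const_mul, ← integral_add (L2.integrable_inner _ _)
    ((L2.integrable_inner _ _).const_mul C)]
  refine integral_congr_ae (Filter.Eventually.of_forall fun x => ?_)
  simp only [RCLike.inner_apply, conj_trivial]
  rw [mul_comm (g x)]

theorem integral_mul_sub_mul {X : Type} [MeasurableSpace X] {μ : Measure X}
    (a b : ℝ) (f g p q : Lp ℝ 2 μ) :
    ∫ x, (a * (f x * g x) - b * (p x * q x)) ∂μ = a * ⟪f, g⟫ - b * ⟪p, q⟫ := by
  rw [L2.inner_def, L2.inner_def, ← integral_const_mul, ← integral_const_mul,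
    ← integral_sub ((L2.integrable_inner _ _).const_mul a) ((L2.integrable_inner _ _).const_mul b)]
  refine integral_congr_ae (Filter.Eventually.of_forall fun x => ?_)
  simp only [RCLike.inner_apply, conj_trivial]
  rw [mul_comm (g x), mul_comm (q x)]

theorem form_eq (C : ℝ) (u ζ : c.E γ) : form C u ζ = ∑ i, γ i *
    (⟪H1.grad (u.1 i), H1.grad (ζ.1 i)⟫ + C * ⟪H1.fn (u.1 i), H1.fn (ζ.1 i)⟫) :=
  Finset.sum_congr rfl fun _ _ => congrArg _ (integral_inner_add_mul _ _ _ _ _)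

end TripleJunctionCluster

/-! ### The theorem for triple junction clusters -/

set_option maxHeartbeats 4000000 in
theorem mainTheorem6 {n : ℕ} (hn : 1 ≤ n) (c : TripleJunctionCluster n)
    (γ : Fin 3 → ℝ) (hγ : ∀ i, 0 < γ i) :
    ∃ C₀ : ℝ, 0 < C₀ ∧ ∀ Cu Cv : ℝ, C₀ ≤ Cu → C₀ ≤ Cv → ∀ T : ℝ, 0 < T →
      ∃ C : ℝ, 0 < C ∧
        ∀ (f : TripleJunctionCluster.L2T T c.L2) (b₅ b₆ : TripleJunctionCluster.L2T T c.L2S),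
          ∃ (u v : TripleJunctionCluster.L2T T (c.E γ))
            (w : TripleJunctionCluster.L2T T (StrongDual ℝ (c.E γ))),
            TripleJunctionCluster.IsWeakSolution Cu Cv f b₅ b₆ u v w ∧
            (∀ (u' v' : TripleJunctionCluster.L2T T (c.E γ))
              (w' : TripleJunctionCluster.L2T T (StrongDual ℝ (c.E γ))),
              TripleJunctionCluster.IsWeakSolution Cu Cv f b₅ b₆ u' v' w' → u' = u ∧ v' = v) ∧
            ∃ U : ℝ → c.E γ, ContinuousOn U (Set.Icc 0 T) ∧
              (∀ᵐ t ∂(MeasureTheory.volume.restrict (Set.Ioo 0 T)), U t = u t) ∧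
              ∀ t ∈ Set.Icc 0 T,
                ‖U t‖ + ‖u‖ + ‖w‖ + ‖v‖ ≤ C * (‖f‖ + (‖b₅‖ + ‖b₆‖)) := by
  have := c.completeSpace_E γ hn
  -- `C₀ = 1` works because for `C ≥ 1` the form already dominates `min γ` times the squared
  -- `𝓗¹`-norm; no Poincaré-type inequality enters.
  exact ⟨1, one_pos, fun Cu Cv hCu hCv T hT => TripleJunctionCluster.wellposed_of_forms
    (V := c.E γ) (Y := c.L2S) (L := fun i => SurfL2 n (c.Γ i) ℝ)
    (G := fun i => SurfL2 n (c.Γ i) (Amb n)) (H := fun i => H1 (c.Γ i) c.S)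
    (fn := fun i u => H1.fn (u.1 i)) (grad := fun i u => H1.grad (u.1 i))
    (p := fun i u => u.1 i) (gr := fun i => restrictionGraph (c.Γ i) c.S) hγ
    (fun _ _ _ => rfl) (fun _ _ _ => rfl) (fun _ _ _ => rfl) (fun _ _ _ => rfl)
    TripleJunctionCluster.E.norm_sq (fun _ => TripleJunctionCluster.E.eq_zero_of_fn_eq_zero hn)
    (c.exists_trace_le hn).choose_spec (fun _ _ _ => rfl) (fun _ _ _ => rfl)
    (fun i ζ => PiLp.norm_apply_le ζ.1 i) (fun u => ⟨u.2.choose, u.2.choose_spec.1⟩)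
    (j := TripleJunctionCluster.E.toL2) (wI := TripleJunctionCluster.weightedInner γ)
    (a := TripleJunctionCluster.form)
    (bd := fun y z τ =>
      ∫ x, (γ 0 * (y x * τ 0 x) - γ 2 * (z x * τ 2 x)) ∂(surfaceMeasure (n - 1) c.S))
    (fun _ => rfl) (TripleJunctionCluster.weightedInner_eq γ) TripleJunctionCluster.form_eq
    (fun y z τ => TripleJunctionCluster.integral_mul_sub_mul _ _ y (τ 0) z (τ 2)) hCu hCv hT
    (Sol := fun f b₅ b₆ u v w => TripleJunctionCluster.IsWeakSolution Cu Cv f b₅ b₆ u v w)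
    fun f b₅ b₆ u v w => ⟨fun h => ⟨h.1, h.2, h.3, h.4⟩, fun h => ⟨h.1, h.2.1, h.2.2.1, h.2.2.2⟩⟩⟩
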